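/- **Setting.** Let $X$ be a complete Hausdorff locally convex topological vector space over $\mathbb C$, and let $J\subseteq\mathbb R$ be a nonempty open interval. Let $C^\infty(J,X)$ be the space of infinitely differentiable functions $J\to X$, with the topology of uniform convergence of all derivatives on compact subsets, and let $R=C^\infty(J)=C^\infty(J,\mathbb C)$. A *smooth deformation* is a family $\{m_t\}_{t\in J}$ of associative bilinear products on $X$ such that $(x,y)\mapsto (t\mapsto m_t(x,y))$ is a jointly continuous map $X\times X\to C^\infty(J,X)$. Its *algebra of sections* is the $R$-algebra $A=A_J=C^\infty(J,X)$ with product $(a_1a_2)(t)=m_t(a_1(t),a_2(t))$. A *connection* on a topological $R$-module $M$ is a continuous $\mathbb C$-linear map $\nabla:M\to M$ with $\nabla(f\cdot m)=f'\cdot m+f\cdot\nabla m$ for all $f\in R$, $m\in M$. Let $A_+=A\oplus R$ be the unitization of $A$ over $R$, with unit $e$. Let $C_0(A)=A$ and, for $n\ge1$, let $C_n(A)=A_+\widehat\otimes_R A^{\widehat\otimes_R n}$ (completed projective tensor product over $R$); elementary tensors are written $(a_0,\dots,a_n)$. Let $C_{\rm per}(A)=C_{\rm even}(A)\oplus C_{\rm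 odd}(A)$ with $C_{\rm even}(A)=\prod_n C_{2n}(A)$, $C_{\rm odd}(A)=\prod_n C_{2n+1}(A)$, with the product topologies. The continuous $R$-linear operators $b,B$ are given by $$b(a_0,\dots,a_n)=\sum_{j=0}^{n-1}(-1)^j(a_0,\dots,a_ja_{j+1},\dots,a_n)+(-1)^n(a_na_0,a_1,\dots,a_{n-1}),$$ $$B(a_0,\dots,a_n)=\sum_{j=0}^n(-1)^{jn}(e,a_j,\dots,a_n,a_0,\dots,a_{j-1})\ \ (a_0\in A),\qquad B(e,a_1,\dots,a_n)=0,$$ with $b=0$ on $C_0(A)$. The even and odd homology of $(C_{\rm per}(A),b+B)$, with the quotient topology, are the $R$-modules $HP_0(A)$ and $HP_1(A)$. For a connection $\nabla$ on $A$ let $E=\delta\nabla$, that is, $E(a_1,a_2)=\nabla(a_1)a_2+a_1\nabla(a_2)-\nabla(a_1a_2)$. Extend $\nabla$ to a connection on $A_+$ by $\nabla e=0$, i.e. $\nabla(a+f e)=\nabla a+f' e$. Put $$L_\nabla(a_0,\dots,a_n)=\sum_{i=0}^n(a_0,\dots,\nabla a_i,\dots,a_n),\qquad \iota_E(a_0,\dots,a_n)=-(a_0E(a_1,a_2),a_3,\dots,a_n),$$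 $$S_E(a_0,\dots,a_n)=\sum_{i=1}^{n-1}\sum_{j=0}^{n-i-1}(-1)^{i+j(n-1)}(e,a_{n-j+1},\dots,a_n,a_0,\dots,a_{i-1},E(a_i,a_{i+1}),a_{i+2},\dots,a_{n-j})\ \ (a_0\in A),$$ $S_E(e,a_1,\dots,a_n)=0$, with $\iota_E=0$ on $C_0(A)$ and $C_1(A)$, and $I_E=\iota_E+S_E$. **Proposition (Gauss–Manin connection).** For every smooth deformation, $b$ and $B$ are well-defined continuous $R$-linear operators, and for every connection $\nabla$ on $A_J$, with $E=\delta\nabla$, the formulas above define continuous operators $L_\nabla$ ($\mathbb C$-linear) and $I_E$ ($R$-linear) on $C_{\rm per}(A_J)$. The operator $$\nabla_{GM}=L_\nabla-I_E$$ is a connection on $C_{\rm per}(A_J)$ that commutes with $b+B$. It maps even (odd) cycles to even (odd) cycles, and $[z]\mapsto[\nabla_{GM}z]$ is a well-defined connection on the $R$-module $HP_p(A_J)$ for $p=0,1$. This induced connection on $HP_\bullet(A_J)$ does not depend on the choice of the connection $\nabla$ on $A_J$. -/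

import Mathlib

open Filter Topology TopologicalSpace
open scoped TensorProduct

noncomputable section

namespace GaussManin

section Smooth

variable {J : Opens ℝ} {X Y Z : Type*}

def HasDeriv [AddCommGroup X] [Module ℂ X] [TopologicalSpace X] (f f' : J → X) : Prop :=
  ∀ t : J, Tendsto (fun s : J => (((s : ℝ) - (t : ℝ) : ℝ) : ℂ)⁻¹ • (f s - f t))
    (𝓝[≠] t) (𝓝 (f' t))

def IsSmooth [AddCommGroup X] [Module ℂ X] [TopologicalSpace X] (f : J → X) : Prop :=
  ∃ g : ℕ → J → X, g 0 = f ∧ ∀ k, HasDeriv (g k) (g (k + 1))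

variable [AddCommGroup X] [Module ℂ X] [TopologicalSpace X] [IsTopologicalAddGroup X]
  [ContinuousSMul ℂ X]
variable [AddCommGroup Y] [Module ℂ Y] [TopologicalSpace Y] [IsTopologicalAddGroup Y]
  [ContinuousSMul ℂ Y]
variable [AddCommGroup Z] [Module ℂ Z] [TopologicalSpace Z] [IsTopologicalAddGroup Z]
  [ContinuousSMul ℂ Z]

theorem HasDeriv.add {f f' g g' : J → X} (hf : HasDeriv f f') (hg : HasDeriv g g') :
    HasDeriv (f + g) (f' + g') := fun t => by
  refine ((hf t).add (hg t)).congr fun s => ?_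
  rw [← smul_add]; congr 1; simp only [Pi.add_apply]; abel

theorem HasDeriv.const_smul {f f' : J → X} (c : ℂ) (hf : HasDeriv f f') :
    HasDeriv (c • f) (c • f') := fun t => by
  refine ((hf t).const_smul c).congr fun s => ?_
  rw [smul_comm, smul_sub]; rfl

theorem hasDeriv_const (x : X) : HasDeriv (fun _ : J => x) (fun _ => 0) := fun t => by
  simpa using tendsto_const_nhds

theorem HasDeriv.continuous {f f' : J → X} (hf : HasDeriv f f') : Continuous f := by
  refine continuous_iff_continuousAt.2 fun t => ?_
  rw [← continuousWithinAt_compl_self]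
  have h1 : Tendsto (fun s : J => (((s : ℝ) - (t : ℝ) : ℝ) : ℂ)) (𝓝[≠] t) (𝓝 0) := by
    have : Continuous fun s : J => (((s : ℝ) - (t : ℝ) : ℝ) : ℂ) := by fun_prop
    simpa using (this.tendsto t).mono_left nhdsWithin_le_nhds
  have h2 := (h1.smul (hf t)).add_const (f t)
  rw [zero_smul, zero_add] at h2
  refine h2.congr' ?_
  filter_upwards [self_mem_nhdsWithin] with s hs
  have : (((s : ℝ) - (t : ℝ) : ℝ) : ℂ) ≠ 0 := by
    rw [Complex.ofReal_ne_zero, sub_ne_zero]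
    exact fun h => hs (Subtype.ext h)
  rw [smul_inv_smul₀ this, sub_add_cancel]

instance punctured_neBot (t : J) : NeBot (𝓝[≠] t) := by
  have h : Topology.IsOpenEmbedding (Subtype.val : J → ℝ) := J.isOpen.isOpenEmbedding_subtypeVal
  have := h.toIsEmbedding.map_nhdsWithin_eq {t}ᶜ t
  have h2 : (Subtype.val '' ({t}ᶜ : Set J)) = (J : Set ℝ) \ {(t : ℝ)} := by
    ext s
    constructor
    · rintro ⟨u, hu, rfl⟩
      exact ⟨u.2, fun h => hu (Subtype.ext h)⟩
    · rintro ⟨h1, h2⟩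
      exact ⟨⟨s, h1⟩, fun h => h2 (congrArg Subtype.val h), rfl⟩
  rw [h2, Set.sdiff_eq, Set.inter_comm, nhdsWithin_inter_of_mem'] at this
  · rw [← Filter.map_neBot_iff (Subtype.val : J → ℝ), this]; infer_instance
  · exact mem_nhdsWithin_of_mem_nhds (J.isOpen.mem_nhds t.2)

theorem HasDeriv.unique [T2Space X] {f f' g' : J → X} (h : HasDeriv f f') (h' : HasDeriv f g') :
    f' = g' := funext fun t => tendsto_nhds_unique (h t) (h' t)

theorem isSmooth_of_set (S : Set (J → X)) (hS : ∀ f ∈ S, ∃ f' ∈ S, HasDeriv f f')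
    {f : J → X} (hf : f ∈ S) : IsSmooth f := by
  choose! d hd hd' using hS
  have hm : ∀ k, d^[k] f ∈ S := fun k => by
    induction k with
    | zero => exact hf
    | succ k ih => rw [Function.iterate_succ_apply']; exact hd _ ih
  refine ⟨fun k => d^[k] f, rfl, fun k => ?_⟩
  have := hd' _ (hm k)
  rwa [← Function.iterate_succ_apply' d] at this

variable (J X) in
/-- The smooth functions, as a subspace of all functions `J → X`. -/
def smoothSubmodule : Submodule ℂ (J → X) where
  carrier := {f | IsSmooth f}
  zero_mem' := ⟨fun _ => 0, rfl, fun _ => hasDeriv_const 0⟩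
  add_mem' := by
    rintro f g ⟨F, rfl, hF⟩ ⟨G, rfl, hG⟩
    exact ⟨fun k => F k + G k, rfl, fun k => (hF k).add (hG k)⟩
  smul_mem' := by
    rintro c f ⟨F, rfl, hF⟩
    exact ⟨fun k => c • F k, rfl, fun k => (hF k).const_smul c⟩

variable (J X) in
/-- The space `C^∞(J, X)`. -/
structure SmoothFun where
  toFun : J → X
  isSmooth' : IsSmooth toFun

namespace SmoothFun

instance : FunLike (SmoothFun J X) J X where
  coe := toFun
  coe_injective := fun ⟨_, _⟩ ⟨_, _⟩ h => by congr

instance : Zero (SmoothFun J X) := ⟨⟨0, (smoothSubmodule J X).zero_mem⟩⟩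
instance : Add (SmoothFun J X) :=
  ⟨fun f g => ⟨f + g, (smoothSubmodule J X).add_mem f.isSmooth' g.isSmooth'⟩⟩
instance : Neg (SmoothFun J X) :=
  ⟨fun f => ⟨-f, (smoothSubmodule J X).neg_mem f.isSmooth'⟩⟩
instance : Sub (SmoothFun J X) :=
  ⟨fun f g => ⟨f - g, (smoothSubmodule J X).sub_mem f.isSmooth' g.isSmooth'⟩⟩
instance : SMul ℂ (SmoothFun J X) :=
  ⟨fun c f => ⟨c • f, (smoothSubmodule J X).smul_mem c f.isSmooth'⟩⟩
instance : SMul ℕ (SmoothFun J X) :=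
  ⟨fun c f => ⟨c • f, (smoothSubmodule J X).nsmul_mem f.isSmooth' c⟩⟩
instance : SMul ℤ (SmoothFun J X) :=
  ⟨fun c f => ⟨c • f, (smoothSubmodule J X).toAddSubgroup.zsmul_mem f.isSmooth' c⟩⟩

instance : AddCommGroup (SmoothFun J X) :=
  DFunLike.coe_injective.addCommGroup (fun f : SmoothFun J X => (f : J → X)) rfl
    (fun _ _ => rfl) (fun _ => rfl) (fun _ _ => rfl) (fun _ _ => rfl) (fun _ _ => rfl)

instance : Module ℂ (SmoothFun J X) :=
  Function.Injective.module ℂ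
    { toFun := fun f : SmoothFun J X => (f : J → X), map_zero' := rfl, map_add' := fun _ _ => rfl }
    DFunLike.coe_injective (fun _ _ => rfl)

theorem isSmooth (f : SmoothFun J X) : IsSmooth f := f.isSmooth'

@[ext] theorem ext {f g : SmoothFun J X} (h : ∀ t, f t = g t) : f = g := DFunLike.ext _ _ h

@[simp] theorem mk_apply (f : J → X) (hf : IsSmooth f) (t : J) :
    (⟨f, hf⟩ : SmoothFun J X) t = f t := rfl
@[simp] theorem add_apply (f g : SmoothFun J X) (t : J) : (f + g) t = f t + g t := rfl
@[simp] theorem zero_apply (t : J) : (0 : SmoothFun J X) t = 0 := rfl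
@[simp] theorem smul_apply (c : ℂ) (f : SmoothFun J X) (t : J) : (c • f) t = c • f t := rfl
@[simp] theorem neg_apply (f : SmoothFun J X) (t : J) : (-f) t = -f t := rfl
@[simp] theorem sub_apply (f g : SmoothFun J X) (t : J) : (f - g) t = f t - g t := rfl

theorem exists_hasDeriv (f : SmoothFun J X) : ∃ f' : SmoothFun J X, HasDeriv f f' := by
  obtain ⟨g, h0, hg⟩ := f.isSmooth
  exact ⟨⟨g 1, fun k => g (k + 1), rfl, fun k => hg (k + 1)⟩, by rw [← h0]; exact hg 0⟩

variable [T2Space X] [T2Space Y] [T2Space Z]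

/-- The operator `d/dt` on `C^∞(J, X)`. -/
def D : SmoothFun J X →ₗ[ℂ] SmoothFun J X where
  toFun f := f.exists_hasDeriv.choose
  map_add' f g := ext fun t => congrFun
    ((f + g).exists_hasDeriv.choose_spec.unique
      (f.exists_hasDeriv.choose_spec.add g.exists_hasDeriv.choose_spec)) t
  map_smul' c f := ext fun t => congrFun
    ((c • f).exists_hasDeriv.choose_spec.unique (f.exists_hasDeriv.choose_spec.const_smul c)) t

theorem hasDeriv_D (f : SmoothFun J X) : HasDeriv f (D f) := f.exists_hasDeriv.choose_spec

theorem D_eq {f f' : SmoothFun J X} (h : HasDeriv f f') : D f = f' :=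
  ext fun t => congrFun ((hasDeriv_D f).unique h) t

/-- A smooth function as a continuous function. -/
def toC : SmoothFun J X →ₗ[ℂ] C(J, X) where
  toFun f := ⟨f, (hasDeriv_D f).continuous⟩
  map_add' _ _ := rfl
  map_smul' _ _ := rfl

/-- The topology of uniform convergence of functions and all their derivatives on compact
subsets of `J`. -/
instance : TopologicalSpace (SmoothFun J X) :=
  ⨅ k : ℕ, TopologicalSpace.induced (fun f => toC ((D ^ k) f)) inferInstance

instance : IsTopologicalAddGroup (SmoothFun J X) :=
  topologicalAddGroup_iInf fun k => topologicalAddGroup_induced (toC ∘ₗ (D ^ k))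

theorem continuous_rng_iff {W : Type*} [TopologicalSpace W] {F : W → SmoothFun J X} :
    Continuous F ↔ ∀ k, Continuous fun w => toC ((D ^ k) (F w)) := by
  simp only [continuous_iInf_rng, continuous_induced_rng, Function.comp_def]

theorem continuous_toC_pow (k : ℕ) :
    Continuous fun f : SmoothFun J X => toC ((D ^ k) f) :=
  continuous_rng_iff.1 continuous_id k

theorem continuous_D : Continuous (D : SmoothFun J X → SmoothFun J X) :=
  continuous_rng_iff.2 fun k => continuous_toC_pow (k + 1)

theorem continuous_D_pow (k : ℕ) : Continuous ((D ^ k : SmoothFun J X →ₗ[ℂ] SmoothFun J X)) := by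
  induction k with
  | zero => exact continuous_id
  | succ k ih => rw [pow_succ]; exact ih.comp continuous_D

theorem continuous_eval : Continuous fun p : SmoothFun J X × J => p.1 p.2 := by
  have : LocallyCompactSpace J := J.isOpen.locallyCompactSpace
  have h : Continuous fun f : SmoothFun J X => toC f := continuous_toC_pow 0
  exact (ContinuousEval.continuous_eval (F := C(J, X))).comp (h.prodMap continuous_id)

variable (J) in
/-- Constant functions. -/
def const : X →ₗ[ℂ] SmoothFun J X where
  toFun x := ⟨fun _ => x, fun k _ => if k = 0 then x else 0, by simp, fun k => by
    by_cases hk : k = 0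
    · simpa [hk] using hasDeriv_const x
    · simpa [hk] using hasDeriv_const 0⟩
  map_add' _ _ := rfl
  map_smul' _ _ := rfl

@[simp] theorem const_apply (x : X) (t : J) : const J x t = x := rfl

theorem D_const (x : X) : D (const J x) = 0 := D_eq (hasDeriv_const x)

theorem continuous_const : Continuous (const J : X → SmoothFun J X) := by
  refine continuous_rng_iff.2 fun k => ?_
  cases k with
  | zero => exact ContinuousMap.continuous_const'
  | succ k =>
    have : (fun w : X => toC ((D ^ (k + 1)) (const J w))) = fun _ => 0 := by
      funext w; rw [pow_succ]; simp [D_const]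
    rw [this]; exact _root_.continuous_const

/-- Leibniz rule for a smooth family of bilinear maps. -/
theorem hasDeriv_bilin (N : X →ₗ[ℂ] Y →ₗ[ℂ] SmoothFun J Z)
    (hN : Continuous fun p : X × Y => N p.1 p.2) (a : SmoothFun J X) (b : SmoothFun J Y) :
    HasDeriv (fun t => N (a t) (b t) t)
      ((fun t => D (N (a t) (b t)) t) +
        ((fun t => N (D a t) (b t) t) + fun t => N (a t) (D b t) t)) := fun t => by
  have hcont : ∀ x y, Tendsto (fun q : (X × Y) × J => N q.1.1 q.1.2 q.2) (𝓝 ((x, y), t))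
      (𝓝 (N x y t)) := fun x y =>
    (continuous_eval.comp (hN.prodMap continuous_id)).tendsto ((x, y), t)
  have hid : Tendsto (fun s : J => s) (𝓝[≠] t) (𝓝 t) := nhdsWithin_le_nhds
  have hb : Tendsto (fun s : J => b s) (𝓝[≠] t) (𝓝 (b t)) :=
    ((hasDeriv_D b).continuous.tendsto t).mono_left nhdsWithin_le_nhds
  have h1 := hasDeriv_D (N (a t) (b t)) t
  have h2 := (hcont _ _).comp ((((hasDeriv_D a) t).prodMk_nhds hb).prodMk_nhds hid)
  have h3 := (hcont _ _).comp (((tendsto_const_nhds (x := a t)).prodMk_nhds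
    ((hasDeriv_D b) t)).prodMk_nhds hid)
  refine (h1.add (h2.add h3)).congr fun s => ?_
  simp only [Function.comp, map_smul, LinearMap.smul_apply, map_sub, LinearMap.sub_apply,
    smul_apply, sub_apply, ← smul_add]
  congr 1; abel

theorem isSmooth_bilin (M : X →ₗ[ℂ] Y →ₗ[ℂ] SmoothFun J Z)
    (hM : Continuous fun p : X × Y => M p.1 p.2) (a : SmoothFun J X) (b : SmoothFun J Y) :
    IsSmooth (fun t => M (a t) (b t) t) := by
  let G : Set (J → Z) := {h | ∃ k i j : ℕ, h = fun t =>
    (D ^ k) (M ((D ^ i) a t) ((D ^ j) b t)) t}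
  refine isSmooth_of_set (AddSubmonoid.closure G : Set (J → Z)) (fun f hf => ?_)
    (AddSubmonoid.subset_closure ⟨0, 0, 0, rfl⟩)
  induction hf using AddSubmonoid.closure_induction with
  | mem f hf =>
    obtain ⟨k, i, j, rfl⟩ := hf
    have key := hasDeriv_bilin (M.compr₂ (D ^ k)) ((continuous_D_pow k).comp hM)
      ((D ^ i) a) ((D ^ j) b)
    refine ⟨_, ?_, key⟩
    refine add_mem (AddSubmonoid.subset_closure ⟨k + 1, i, j, ?_⟩)
      (add_mem (AddSubmonoid.subset_closure ⟨k, i + 1, j, ?_⟩)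
        (AddSubmonoid.subset_closure ⟨k, i, j + 1, ?_⟩)) <;> simp [pow_succ']
  | zero => exact ⟨0, zero_mem _, hasDeriv_const 0⟩
  | add f g _ _ hf hg =>
    obtain ⟨f', hf', h1⟩ := hf
    obtain ⟨g', hg', h2⟩ := hg
    exact ⟨f' + g', add_mem hf' hg', h1.add h2⟩

variable (J X) in
/-- The constant family with value the scalar multiplication `ℂ × X → X`. -/
def smulBilin : ℂ →ₗ[ℂ] X →ₗ[ℂ] SmoothFun J X := (LinearMap.lsmul ℂ X).compr₂ (const J)

theorem continuous_smulBilin : Continuous fun p : ℂ × X => smulBilin J X p.1 p.2 :=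
  continuous_const.comp continuous_smul

/-- The pointwise product of a scalar function and an `X`-valued function. -/
def fsmul (f : SmoothFun J ℂ) (x : SmoothFun J X) : SmoothFun J X :=
  ⟨fun t => f t • x t, isSmooth_bilin _ continuous_smulBilin f x⟩

@[simp] theorem fsmul_apply (f : SmoothFun J ℂ) (x : SmoothFun J X) (t : J) :
    fsmul f x t = f t • x t := rfl

theorem D_fsmul (f : SmoothFun J ℂ) (x : SmoothFun J X) :
    D (fsmul f x) = fsmul (D f) x + fsmul f (D x) := by
  refine D_eq ?_
  have h := hasDeriv_bilin _ continuous_smulBilin f x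
  have e : (fun t => D (smulBilin J X (f t) (x t)) t) = 0 := funext fun t => by
    have : D (smulBilin J X (f t) (x t)) = 0 := D_const _
    rw [this]; rfl
  rw [e, zero_add] at h
  exact h

theorem continuous_fsmul (f : SmoothFun J ℂ) :
    Continuous fun x : SmoothFun J X => fsmul f x := by
  refine continuous_rng_iff.2 fun k => ?_
  induction k generalizing f with
  | zero =>
    have h0 : Continuous fun x : SmoothFun J X => toC x := continuous_toC_pow 0
    refine ContinuousMap.continuous_of_continuous_uncurry _ ?_
    have h : Continuous fun q : SmoothFun J X × J => f q.2 • q.1 q.2 :=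
      ((hasDeriv_D f).continuous.comp continuous_snd).smul continuous_eval
    exact h
  | succ k ih =>
    have : (fun x : SmoothFun J X => toC ((D ^ (k + 1)) (fsmul f x))) =
        fun x => toC ((D ^ k) (fsmul (D f) x)) + toC ((D ^ k) (fsmul f (D x))) := by
      funext x
      rw [pow_succ, Module.End.mul_apply, D_fsmul, map_add, map_add]
    rw [this]
    exact (ih (D f)).add ((ih f).comp continuous_D)

/-- The ring `C^∞(J) = C^∞(J, ℂ)` with pointwise operations. -/
instance : CommRing (SmoothFun J ℂ) where
  __ := (inferInstance : AddCommGroup (SmoothFun J ℂ))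
  mul f g := fsmul f g
  one := const J 1
  mul_assoc _ _ _ := ext fun _ => mul_assoc _ _ _
  one_mul _ := ext fun _ => one_mul _
  mul_one _ := ext fun _ => mul_one _
  left_distrib _ _ _ := ext fun _ => mul_add _ _ _
  right_distrib _ _ _ := ext fun _ => add_mul _ _ _
  zero_mul _ := ext fun _ => zero_mul _
  mul_zero _ := ext fun _ => mul_zero _
  mul_comm _ _ := ext fun _ => mul_comm _ _

instance : Algebra ℂ (SmoothFun J ℂ) :=
  Algebra.ofModule (fun c f g => ext fun t => smul_mul_assoc c (f t) (g t))
    (fun c f g => ext fun t => mul_smul_comm c (f t) (g t))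

@[simp] theorem mul_apply (f g : SmoothFun J ℂ) (t : J) : (f * g) t = f t * g t := rfl
@[simp] theorem one_apply (t : J) : (1 : SmoothFun J ℂ) t = 1 := rfl

end SmoothFun

end Smooth

/-! ### Smooth deformations and their algebras of sections -/

section Deformation

variable (J : Opens ℝ) (X : Type*) [AddCommGroup X] [Module ℂ X] [TopologicalSpace X]
  [IsTopologicalAddGroup X] [ContinuousSMul ℂ X] [T2Space X]

/-- A smooth one-parameter deformation of algebras with underlying space `X`: associative
products `m_t` on `X` such that `(x, y) ↦ (t ↦ m_t(x, y))` is a jointly continuous bilinear map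
from `X × X` to `C^∞(J, X)`, that is, a continuous linear map on the completed projective tensor
square of `X`. -/
structure SmoothDeformation where
  mul : J → X →ₗ[ℂ] X →ₗ[ℂ] X
  assoc : ∀ t x y z, mul t (mul t x y) z = mul t x (mul t y z)
  smooth : ∃ M : X → X → SmoothFun J X, Continuous (fun p : X × X => M p.1 p.2) ∧
    ∀ x y t, M x y t = mul t x y

variable {J X}

namespace SmoothDeformation

theorem isSmooth_mul (𝒜 : SmoothDeformation J X) (a b : SmoothFun J X) :
    IsSmooth (fun t => 𝒜.mul t (a t) (b t)) := by
  obtain ⟨M, hM, h⟩ := 𝒜.smooth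
  let M' : X →ₗ[ℂ] X →ₗ[ℂ] SmoothFun J X := LinearMap.mk₂ ℂ M
    (fun _ _ _ => SmoothFun.ext fun _ => by simp [h])
    (fun _ _ _ => SmoothFun.ext fun _ => by simp [h])
    (fun _ _ _ => SmoothFun.ext fun _ => by simp [h])
    (fun _ _ _ => SmoothFun.ext fun _ => by simp [h])
  have := SmoothFun.isSmooth_bilin M' hM a b
  simpa [M', h] using this

/-- The algebra of sections `A_J`: the space `C^∞(J, X)` with the product
`(a b)(t) = m_t(a(t), b(t))`. -/
def Sections (_ : SmoothDeformation J X) : Type _ := SmoothFun J X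

variable (𝒜 : SmoothDeformation J X)

instance : AddCommGroup 𝒜.Sections := inferInstanceAs (AddCommGroup (SmoothFun J X))
instance : Module ℂ 𝒜.Sections := inferInstanceAs (Module ℂ (SmoothFun J X))
instance : FunLike 𝒜.Sections J X := inferInstanceAs (FunLike (SmoothFun J X) J X)
instance : TopologicalSpace 𝒜.Sections := inferInstanceAs (TopologicalSpace (SmoothFun J X))
instance : IsTopologicalAddGroup 𝒜.Sections :=
  inferInstanceAs (IsTopologicalAddGroup (SmoothFun J X))

variable {𝒜}

@[ext] theorem Sections.ext {a b : 𝒜.Sections} (h : ∀ t, a t = b t) : a = b :=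
  SmoothFun.ext h

instance : Mul 𝒜.Sections := ⟨fun a b => SmoothFun.mk _ (𝒜.isSmooth_mul a b)⟩
instance : SMul (SmoothFun J ℂ) 𝒜.Sections := ⟨fun f a => SmoothFun.fsmul (X := X) f a⟩

@[simp] theorem mul_apply (a b : 𝒜.Sections) (t : J) : (a * b) t = 𝒜.mul t (a t) (b t) := rfl
@[simp] theorem fsmul_apply (f : SmoothFun J ℂ) (a : 𝒜.Sections) (t : J) :
    (f • a) t = f t • a t := rfl
@[simp] theorem smul_apply (c : ℂ) (a : 𝒜.Sections) (t : J) : (c • a) t = c • a t := rfl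
@[simp] theorem add_apply (a b : 𝒜.Sections) (t : J) : (a + b) t = a t + b t := rfl
@[simp] theorem zero_apply (t : J) : (0 : 𝒜.Sections) t = 0 := rfl

instance : NonUnitalRing 𝒜.Sections where
  __ := (inferInstance : AddCommGroup 𝒜.Sections)
  left_distrib _ _ _ := Sections.ext fun _ => by simp
  right_distrib _ _ _ := Sections.ext fun _ => by simp
  zero_mul _ := Sections.ext fun _ => by simp
  mul_zero _ := Sections.ext fun _ => by simp
  mul_assoc _ _ _ := Sections.ext fun _ => 𝒜.assoc _ _ _ _

instance : Module (SmoothFun J ℂ) 𝒜.Sections where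
  one_smul _ := Sections.ext fun _ => one_smul _ _
  mul_smul _ _ _ := Sections.ext fun _ => mul_smul _ _ _
  smul_zero _ := Sections.ext fun _ => smul_zero _
  smul_add _ _ _ := Sections.ext fun _ => smul_add _ _ _
  add_smul _ _ _ := Sections.ext fun _ => add_smul _ _ _
  zero_smul _ := Sections.ext fun _ => zero_smul _ _

instance : IsScalarTower ℂ (SmoothFun J ℂ) 𝒜.Sections :=
  ⟨fun c f a => Sections.ext fun t => smul_assoc c (f t) (a t)⟩

instance : IsScalarTower (SmoothFun J ℂ) 𝒜.Sections 𝒜.Sections :=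
  ⟨fun _ _ _ => Sections.ext fun _ => by simp⟩

instance : SMulCommClass (SmoothFun J ℂ) 𝒜.Sections 𝒜.Sections :=
  ⟨fun _ _ _ => Sections.ext fun _ => by simp⟩

instance : ContinuousConstSMul (SmoothFun J ℂ) 𝒜.Sections :=
  ⟨fun f => SmoothFun.continuous_fsmul (X := X) f⟩

instance : ContinuousConstSMul (SmoothFun J ℂ) (SmoothFun J ℂ) :=
  ⟨fun f => SmoothFun.continuous_fsmul f⟩

end SmoothDeformation

end Deformation

/-! ### Chains, and the periodic cyclic complex, of a topological algebra over a commutative ring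

`R` is a commutative topological algebra over `ℂ` and `A` is a topological algebra over `R`,
possibly without unit. `Unitization R A` is `A₊ = A ⊕ R`; its unit `1` is written `e` below. -/

section Chains

/-- The topology of `A₊ = R ⊕ A`, that of the product. -/
instance unitizationTopology (R : Type) (A : Type*) [TopologicalSpace R] [TopologicalSpace A] :
    TopologicalSpace (Unitization R A) :=
  TopologicalSpace.induced (fun x => (x.fst, x.snd)) inferInstance

theorem continuous_unitization_smul {R : Type} {A : Type*} [CommRing R] [TopologicalSpace R]
    [ContinuousConstSMul R R] [AddCommGroup A] [Module R A] [TopologicalSpace A]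
    [ContinuousConstSMul R A] (r : R) : Continuous fun x : Unitization R A => r • x := by
  have h : Continuous fun x : Unitization R A => (x.fst, x.snd) := continuous_induced_dom
  refine continuous_induced_rng.2 ?_
  exact ((continuous_fst.comp h).const_smul r).prodMk ((continuous_snd.comp h).const_smul r)

variable (R : Type) (A : Type*) [CommRing R] [Algebra ℂ R] [TopologicalSpace R]
  [ContinuousConstSMul R R]
  [NonUnitalRing A] [Module ℂ A] [Module R A] [IsScalarTower ℂ R A] [IsScalarTower R A A]
  [SMulCommClass R A A] [TopologicalSpace A] [IsTopologicalAddGroup A] [ContinuousConstSMul R A]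

/-- The algebraic tensor product `A₊ ⊗ A ⊗ ⋯ ⊗ A` over `R`, with `n` factors `A`. -/
def PreChain (n : ℕ) : Type _ := Unitization R A ⊗[R] (⨂[R] _ : Fin n, A)

variable {R A}

namespace PreChain

variable {n : ℕ}

instance : AddCommGroup (PreChain R A n) :=
  inferInstanceAs (AddCommGroup (Unitization R A ⊗[R] (⨂[R] _ : Fin n, A)))
instance : Module R (PreChain R A n) :=
  inferInstanceAs (Module R (Unitization R A ⊗[R] (⨂[R] _ : Fin n, A)))
instance : Module ℂ (PreChain R A n) :=
  inferInstanceAs (Module ℂ (Unitization R A ⊗[R] (⨂[R] _ : Fin n, A)))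
instance : IsScalarTower ℂ R (PreChain R A n) :=
  inferInstanceAs (IsScalarTower ℂ R (Unitization R A ⊗[R] (⨂[R] _ : Fin n, A)))

/-- The elementary tensor `a₀ ⊗ a₁ ⊗ ⋯ ⊗ aₙ`. -/
def tensor (s : Unitization R A × (Fin n → A)) : PreChain R A n :=
  s.1 ⊗ₜ[R] PiTensorProduct.tprod R s.2

theorem smul_tensor (r : R) (s : Unitization R A × (Fin n → A)) :
    r • tensor s = tensor (r • s.1, s.2) := rfl

/-- The seminorm `p` is continuous for the projective topology: the canonical multilinear map
`(a₀, …, aₙ) ↦ a₀ ⊗ ⋯ ⊗ aₙ` is jointly continuous into the space seminormed by `p`. -/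
def IsProjective (p : Seminorm ℂ (PreChain R A n)) : Prop :=
  ∀ s : Unitization R A × (Fin n → A),
    Tendsto (fun u => p (tensor u - tensor s)) (𝓝 s) (𝓝 0)

/-- The projective topology: the strongest locally convex topology for which the canonical
multilinear map is jointly continuous. -/
instance : UniformSpace (PreChain R A n) :=
  ⨅ p : {p : Seminorm ℂ (PreChain R A n) // IsProjective p},
    p.1.toAddGroupSeminorm.toSeminormedAddCommGroup.toUniformSpace

instance : IsUniformAddGroup (PreChain R A n) :=
  isUniformAddGroup_iInf fun p =>
    @SeminormedAddCommGroup.to_isUniformAddGroup _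
      p.1.toAddGroupSeminorm.toSeminormedAddCommGroup

/-- A linear map that pulls projective seminorms back to multiples of projective seminorms is
uniformly continuous. -/
theorem uniformContinuous_of_le (T : PreChain R A n →+ PreChain R A n)
    (h : ∀ p : Seminorm ℂ (PreChain R A n), IsProjective p →
      ∃ q : Seminorm ℂ (PreChain R A n), IsProjective q ∧ ∃ c : ℝ, ∀ x, p (T x) ≤ c * q x) :
    UniformContinuous T := by
  refine uniformContinuous_iInf_rng.2 fun p => ?_
  obtain ⟨q, hq, c, hc⟩ := h p.1 p.2
  refine uniformContinuous_iInf_dom (i := (⟨q, hq⟩ : {p // IsProjective p})) ?_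
  have L := @AddMonoidHomClass.lipschitz_of_bound (PreChain R A n →+ PreChain R A n) _ _
    q.toAddGroupSeminorm.toSeminormedAddCommGroup.toSeminormedAddGroup
    p.1.toAddGroupSeminorm.toSeminormedAddCommGroup.toSeminormedAddGroup _ _ T c hc
  exact @LipschitzWith.uniformContinuous _ _
    q.toAddGroupSeminorm.toSeminormedAddCommGroup.toPseudoMetricSpace.toPseudoEMetricSpace
    p.1.toAddGroupSeminorm.toSeminormedAddCommGroup.toPseudoMetricSpace.toPseudoEMetricSpace
    _ _ L

instance : UniformContinuousConstSMul ℂ (PreChain R A n) :=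
  ⟨fun c => uniformContinuous_of_le (DistribSMul.toAddMonoidHom _ c)
    fun p hp => ⟨p, hp, ‖c‖, fun x => (map_smul_eq_mul p c x).le⟩⟩

instance : UniformContinuousConstSMul R (PreChain R A n) :=
  ⟨fun r => uniformContinuous_of_le (DistribSMul.toAddMonoidHom _ r) fun p hp => by
    have : SMulCommClass R ℂ (PreChain R A n) := IsScalarTower.to_smulCommClass'
    refine ⟨p.comp (DistribSMul.toLinearMap ℂ _ r), fun s => ?_, 1, fun x => (one_mul _).ge⟩
    have hc : Continuous fun u : Unitization R A × (Fin n → A) => (r • u.1, u.2) :=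
      ((continuous_unitization_smul r).comp continuous_fst).prodMk continuous_snd
    refine ((hp (r • s.1, s.2)).comp (hc.tendsto s)).congr fun u => ?_
    simp [Function.comp, ← smul_tensor, smul_sub]⟩

end PreChain

variable (R A) in
/-- The space of Hochschild `n`-chains: `C_0(A) = A`, and `C_n(A)` is the completed projective
tensor product over `R` of `A₊` and `n` copies of `A` for `n ≥ 1`. -/
def Chain : ℕ → Type _
  | 0 => A
  | n + 1 => UniformSpace.Completion (PreChain R A (n + 1))

namespace Chain

instance : ∀ n, AddCommGroup (Chain R A n)
  | 0 => inferInstanceAs (AddCommGroup A)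
  | n + 1 => inferInstanceAs (AddCommGroup (UniformSpace.Completion (PreChain R A (n + 1))))

instance : ∀ n, Module R (Chain R A n)
  | 0 => inferInstanceAs (Module R A)
  | n + 1 => inferInstanceAs (Module R (UniformSpace.Completion (PreChain R A (n + 1))))

instance : ∀ n, Module ℂ (Chain R A n)
  | 0 => inferInstanceAs (Module ℂ A)
  | n + 1 => inferInstanceAs (Module ℂ (UniformSpace.Completion (PreChain R A (n + 1))))

instance : ∀ n, IsScalarTower ℂ R (Chain R A n)
  | 0 => inferInstanceAs (IsScalarTower ℂ R A)
  | n + 1 => inferInstanceAs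
      (IsScalarTower ℂ R (UniformSpace.Completion (PreChain R A (n + 1))))

instance : ∀ n, TopologicalSpace (Chain R A n)
  | 0 => inferInstanceAs (TopologicalSpace A)
  | n + 1 => inferInstanceAs
      (TopologicalSpace (UniformSpace.Completion (PreChain R A (n + 1))))

instance : ∀ n, IsTopologicalAddGroup (Chain R A n)
  | 0 => inferInstanceAs (IsTopologicalAddGroup A)
  | n + 1 => inferInstanceAs
      (IsTopologicalAddGroup (UniformSpace.Completion (PreChain R A (n + 1))))

/-- The elementary chain `(x₀, x₁, …, xₙ)`. The entries `x₁, …, xₙ` (and `x₀` if `n = 0`) are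
projected from `A₊` to `A` along `e`; so a chain with `e` in one of these places is `0`. -/
def elem : ∀ n, (ℕ → Unitization R A) → Chain R A n
  | 0, x => (x 0).snd
  | n + 1, x =>
    ((PreChain.tensor (x 0, fun i : Fin (n + 1) => (x (i + 1)).snd) : PreChain R A (n + 1)) :
      UniformSpace.Completion (PreChain R A (n + 1)))

end Chain

/-- The word `(a₀, a₁, a₂, …)` with `a₀ ∈ A₊` and `aᵢ ∈ A` for `i ≥ 1`. -/
def word (a₀ : Unitization R A) (a : ℕ → A) : ℕ → Unitization R A :=
  fun i => if i = 0 then a₀ else (a i : Unitization R A)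

/-- The operator `T` is given on elementary chains by the formula `φ`. -/
def ActsBy {S : Type*} [Semiring S] {n m : ℕ} [Module S (Chain R A n)] [Module S (Chain R A m)]
    (T : Chain R A n →L[S] Chain R A m) (φ : (ℕ → Unitization R A) → Chain R A m) : Prop :=
  ∀ (a₀ : Unitization R A) (a : ℕ → A), (n = 0 → a₀.fst = 0) →
    T (Chain.elem n (word a₀ a)) = φ (word a₀ a)

open Classical in
/-- The continuous `S`-linear operator given on elementary chains by the formula `φ` (if there
is one; it is unique because the elementary chains span a dense subspace). -/
def extend (S : Type*) [Semiring S] (n m : ℕ) [Module S (Chain R A n)] [Module S (Chain R A m)]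
    (φ : (ℕ → Unitization R A) → Chain R A m) : Chain R A n →L[S] Chain R A m :=
  if h : ∃ T : Chain R A n →L[S] Chain R A m, ActsBy T φ then h.choose else 0

/-- `b(a₀, …, aₙ₊₁) = ∑_{j=0}^{n} (-1)^j (a₀, …, aⱼaⱼ₊₁, …, aₙ₊₁)
+ (-1)^{n+1} (aₙ₊₁a₀, a₁, …, aₙ)`. -/
def bFormula (n : ℕ) (x : ℕ → Unitization R A) : Chain R A n :=
  ∑ j ∈ Finset.range (n + 1), (-1 : ℤ) ^ j • Chain.elem n (fun i =>
    if i < j then x i else if i = j then x j * x (j + 1) else x (i + 1)) +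
  (-1 : ℤ) ^ (n + 1) • Chain.elem n (fun i => if i = 0 then x (n + 1) * x 0 else x i)

/-- `B(a₀, …, aₙ) = ∑_{j=0}^{n} (-1)^{jn} (e, aⱼ, …, aₙ, a₀, …, aⱼ₋₁)` for `a₀ ∈ A`, and
`B(e, a₁, …, aₙ) = 0`. -/
def BFormula (n : ℕ) (x : ℕ → Unitization R A) : Chain R A (n + 1) :=
  ∑ j ∈ Finset.range (n + 1), (-1 : ℤ) ^ (j * n) • Chain.elem (n + 1) (fun i =>
    if i = 0 then 1 else x ((i - 1 + j) % (n + 1)))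

/-- `L(a₀, …, aₙ) = ∑_{i=0}^{n} (a₀, …, ∇aᵢ, …, aₙ)`, where `∇` is extended to `A₊` by
`∇(a + r e) = ∇a + (∂r) e`; here `∂` is the derivation of `R` that enters the Leibniz rule of
`∇`, so that this is the extension with `∇e = 0`. -/
def lieFormula (der : R → R) (nabla : A → A) (n : ℕ) (x : ℕ → Unitization R A) : Chain R A n :=
  ∑ i ∈ Finset.range (n + 1), Chain.elem n (Function.update x i
    (Unitization.inl (der (x i).fst) + (nabla (x i).snd : Unitization R A)))

/-- `ι_E(a₀, …, aₙ₊₂) = -(a₀E(a₁, a₂), a₃, …, aₙ₊₂)` for a `2`-cochain `E`. -/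
def iotaFormula (E : A → A → A) (n : ℕ) (x : ℕ → Unitization R A) : Chain R A n :=
  -Chain.elem n (fun i =>
    if i = 0 then x 0 * (E (x 1).snd (x 2).snd : Unitization R A) else x (i + 2))

/-- `S_E(a₀, …, aₙ) = ∑_{i=1}^{n-1} ∑_{j=0}^{n-i-1} (-1)^{i+j(n-1)}
(e, aₙ₋ⱼ₊₁, …, aₙ, a₀, …, aᵢ₋₁, E(aᵢ, aᵢ₊₁), aᵢ₊₂, …, aₙ₋ⱼ)` for a `2`-cochain `E` and `a₀ ∈ A`,
and `S_E(e, a₁, …, aₙ) = 0`. -/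
def sFormula (E : A → A → A) (n : ℕ) (x : ℕ → Unitization R A) : Chain R A n :=
  ∑ i ∈ Finset.Icc 1 (n - 1), ∑ j ∈ Finset.range (n - i),
    (-1 : ℤ) ^ (i + j * (n - 1)) • Chain.elem n (fun k =>
      if k = 0 then 1
      else if k ≤ j then x (n - j + k)
      else if k ≤ j + i then x (k - j - 1)
      else if k = j + i + 1 then (E (x i).snd (x (i + 1)).snd : Unitization R A)
      else x (k - j))

variable (R A) in
/-- The Hochschild boundary `b : C_{n+1}(A) → C_n(A)`. -/
def hochschildB (n : ℕ) : Chain R A (n + 1) →L[R] Chain R A n := extend R _ _ (bFormula n)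

variable (R A) in
/-- The operator `B : C_n(A) → C_{n+1}(A)`. -/
def connesB (n : ℕ) : Chain R A n →L[R] Chain R A (n + 1) := extend R _ _ (BFormula n)

/-- The Lie derivative along a connection, on `C_n(A)`. -/
def lie (der : R → R) (nabla : A → A) (n : ℕ) : Chain R A n →L[ℂ] Chain R A n :=
  extend ℂ _ _ (lieFormula der nabla n)

variable (R) in
/-- The contraction `ι_E : C_{n+2}(A) → C_n(A)`. -/
def iota (E : A → A → A) (n : ℕ) : Chain R A (n + 2) →L[R] Chain R A n :=
  extend R _ _ (iotaFormula E n)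

variable (R) in
/-- The operator `S_E : C_n(A) → C_n(A)`. -/
def cyclicS (E : A → A → A) (n : ℕ) : Chain R A n →L[R] Chain R A n :=
  extend R _ _ (sFormula E n)

variable (R A) in
/-- The space `C_per(A)`, the product of all `C_n(A)` with the product topology. It is the direct
sum of its even part and its odd part, see `parity`. -/
abbrev Per : Type _ := ∀ n, Chain R A n

variable (R A) in
/-- The differential `b + B` on `C_per(A)`. -/
def perD : Per R A →L[R] Per R A :=
  ContinuousLinearMap.pi fun n => match n with
    | 0 => hochschildB R A 0 ∘L ContinuousLinearMap.proj 1
    | n + 1 => hochschildB R A (n + 1) ∘L ContinuousLinearMap.proj (n + 2) +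
        connesB R A n ∘L ContinuousLinearMap.proj n

/-- The Lie derivative along a connection, on `C_per(A)`. -/
def perLie (der : R → R) (nabla : A → A) : Per R A →L[ℂ] Per R A :=
  ContinuousLinearMap.pi fun n => lie der nabla n ∘L ContinuousLinearMap.proj n

variable (R) in
/-- The cyclic contraction `I_E = ι_E + S_E` on `C_per(A)` with a `2`-cochain `E`. -/
def perI (E : A → A → A) : Per R A →L[R] Per R A :=
  ContinuousLinearMap.pi fun n => iota R E n ∘L ContinuousLinearMap.proj (n + 2) +
    cyclicS R E n ∘L ContinuousLinearMap.proj n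

/-- The Hochschild coboundary of a `1`-cochain:
`(δD)(a₁, a₂) = D(a₁)a₂ + a₁D(a₂) - D(a₁a₂)`. -/
def coboundary (D : A → A) (a₁ a₂ : A) : A := D a₁ * a₂ + a₁ * D a₂ - D (a₁ * a₂)

/-- `L_∇ - I_E` with `E = δ∇`. -/
def perGM (der : R → R) (nabla : A → A) : Per R A →L[ℂ] Per R A :=
  perLie der nabla - (perI R (coboundary nabla)).restrictScalars ℂ

variable (R A) in
/-- The even (`p = 0`) and odd (`p = 1`) part of `C_per(A)`. -/
def parity (p : ZMod 2) : Submodule R (Per R A) where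
  carrier := {x | ∀ n : ℕ, (n : ZMod 2) ≠ p → x n = 0}
  zero_mem' _ _ := rfl
  add_mem' hx hy n hn := by simp [hx n hn, hy n hn]
  smul_mem' r x hx n hn := by simp [hx n hn]

variable (R A) in
/-- The cycles of parity `p`. -/
def cycles (p : ZMod 2) : Submodule R (Per R A) :=
  LinearMap.ker (perD R A : Per R A →ₗ[R] Per R A) ⊓ parity R A p

variable (R A) in
/-- The boundaries of parity `p`. -/
def boundaries (p : ZMod 2) : Submodule R (Per R A) :=
  (parity R A (p + 1)).map (perD R A : Per R A →ₗ[R] Per R A)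

variable (R A) in
/-- The periodic cyclic homology `HP_p(A)` over `R`, with the quotient topology. -/
abbrev HP (p : ZMod 2) : Type _ := cycles R A p ⧸ (boundaries R A p).submoduleOf (cycles R A p)

/-- `N` is the operator on `HP_p(A)` induced by the operator `T` on `C_per(A)`: `T` maps cycles
of parity `p` to such cycles, and `N[z] = [Tz]`. -/
def Induces (T : Per R A →L[ℂ] Per R A) (p : ZMod 2) (N : HP R A p →L[ℂ] HP R A p) : Prop :=
  ∀ z : cycles R A p, ∃ h : T z ∈ cycles R A p,
    N (Submodule.Quotient.mk z) = Submodule.Quotient.mk ⟨T z, h⟩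

end Chains

/-! ### Connections -/

/-- A continuous `ℂ`-linear operator on a topological `C^∞(J)`-module is a connection if it
satisfies the Leibniz rule. -/
def IsConnection {J : Opens ℝ} {M : Type*} [AddCommGroup M] [Module ℂ M]
    [Module (SmoothFun J ℂ) M] [TopologicalSpace M] (nabla : M →L[ℂ] M) : Prop :=
  ∀ (f : SmoothFun J ℂ) (m : M), nabla (f • m) = SmoothFun.D f • m + f • nabla m

section

variable {J : Opens ℝ} {X : Type*} [AddCommGroup X] [Module ℂ X] [TopologicalSpace X]
  [IsTopologicalAddGroup X] [ContinuousSMul ℂ X] [T2Space X]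

/-- The operator `∇_GM = L_∇ - I_E`, `E = δ∇`, on `C_per(A_J)`. -/
def gaussManin {𝒜 : SmoothDeformation J X} (nabla : 𝒜.Sections →L[ℂ] 𝒜.Sections) :
    Per (SmoothFun J ℂ) 𝒜.Sections →L[ℂ] Per (SmoothFun J ℂ) 𝒜.Sections :=
  perGM SmoothFun.D nabla

end

end GaussManin

end

/-!
For functions of words in a ring with unit `e` and any additive operator `D` with `D e = 0`, put
`I_D(a₀, …, aₙ) = ± (a₀ D(a₁), a₂, …, aₙ)` plus the sum of all
`± (e, aⱼ, …, aₙ, a₀, …, D(aᵢ), …, aⱼ₋₁)`. A finite computation gives the homotopy formula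
`L_D - I_{δD} = [b + B, I_D]`. Since `(b + B)² = 0`, the left hand side commutes with `b + B`. For
a connection `D = ∇` the operator `I_∇` is not compatible with the tensor product over `R`, but
`L_∇`, `I_{δ∇}` and `b + B` are, and an identity between operators on `C_per(A)` may be checked on
words, which span a dense subspace. The difference `T` of two connections is `R`-linear, so `I_T`
does act on `C_per(A)` and is a homotopy between the two Gauss–Manin connections.

The formulas define operators on completed tensor products because they are balanced, hence factor
through the algebraic tensor product, and continuous in each seminorm, as the operations of `R` and
of `A` are jointly continuous. The completions can be computed in `A` itself because
`C^∞(J, X)` is complete: derivatives pass to limits of convergent nets, since by the Hahn–Banach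
theorem they may be tested on continuous functionals.
-/

noncomputable section

namespace GaussManin

/-! ### Words in a ring -/

section Words

variable {U : Type*}

/-- The word obtained from `x` by replacing the letters `m` and `m + 1` by the single letter
`β (x m) (x (m + 1))`. A word is a sequence of letters; a word of length `n + 1` is encoded by any
sequence with the given letters at the places `0, …, n`. -/
def mergeAt (β : U → U → U) (m : ℕ) (x : ℕ → U) : ℕ → U :=
  fun i => if i < m then x i else if i = m then β (x m) (x (m + 1)) else x (i + 1)

/-- The word obtained from `x` by applying `D` to the letter `p`. -/
def applyAt (D : U → U) (p : ℕ) (x : ℕ → U) : ℕ → U := Function.update x p (D (x p))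

/-- The cyclic rotation of the letters `0, …, n` of a word to the right by `j ≤ n + 1` places. -/
def rotate (n j : ℕ) (x : ℕ → U) : ℕ → U :=
  fun i => if i < j then x (n + 1 - j + i) else x (i - j)

/-- The word `(1, x₀, x₁, …)`. -/
def consOne [One U] (x : ℕ → U) : ℕ → U := fun i => if i = 0 then 1 else x (i - 1)

/-- The `k`-th Hochschild face, `k ≤ n`, of a word with letters `0, …, n`. -/
def face [Mul U] (n k : ℕ) (x : ℕ → U) : ℕ → U :=
  if k < n then mergeAt (· * ·) k x else fun i => if i = 0 then x n * x 0 else x i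

theorem rotate_zero (n : ℕ) (x : ℕ → U) : rotate n 0 x = x := by
  funext i; simp [rotate]

theorem rotate_full {n i : ℕ} (hi : i ≤ n) (x : ℕ → U) : rotate n (n + 1) x i = x i := by
  simp only [rotate]; grind

theorem rotate_one_rotate {n j i : ℕ} (hj : j ≤ n) (x : ℕ → U) :
    rotate n 1 (rotate n j x) i = rotate n (j + 1) x i := by
  simp only [rotate]; grind

theorem rotate_applyAt {n j i : ℕ} (D : U → U) (h : i + j ≤ n) (x : ℕ → U) :
    rotate n j (applyAt D i x) = applyAt D (i + j) (rotate n j x) := by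
  funext k
  simp only [rotate, applyAt, Function.update_apply]; grind

theorem rotate_applyAt_eq_zero {n j i k : ℕ} (D : U → U) (hj : 1 ≤ j) (hk : k ≤ n)
    (h : i + j = n + 1) (x : ℕ → U) :
    rotate n j (applyAt D i x) k = applyAt D 0 (rotate n j x) k := by
  simp only [rotate, applyAt, Function.update_apply]; grind

theorem mergeAt_applyAt_of_lt {m p : ℕ} (D : U → U) (β : U → U → U) (h : p < m) (x : ℕ → U) :
    mergeAt β m (applyAt D p x) = applyAt D p (mergeAt β m x) := by
  funext k
  simp only [mergeAt, applyAt, Function.update_apply]; grind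

theorem mergeAt_applyAt_of_gt {m p : ℕ} (D : U → U) (β : U → U → U) (h : m + 1 < p) (x : ℕ → U) :
    mergeAt β m (applyAt D p x) = applyAt D (p - 1) (mergeAt β m x) := by
  funext k
  simp only [mergeAt, applyAt, Function.update_apply]; grind

theorem mergeAt_zero_applyAt_consOne [MulOneClass U] (D : U → U) (x : ℕ → U) :
    mergeAt (· * ·) 0 (applyAt D 1 (consOne x)) = applyAt D 0 x := by
  funext i
  simp only [mergeAt, applyAt, consOne, Function.update_apply]; grind [one_mul]

section Faces

variable [Mul U]

theorem mergeAt_rotate_of_le {n m j i : ℕ} (h : j ≤ m) (hm : m ≤ n) (x : ℕ → U) :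
    mergeAt (· * ·) m (rotate (n + 1) j x) i = rotate n j (face (n + 1) (m - j) x) i := by
  have : m - j < n + 1 := by omega
  simp only [face, this, if_true, mergeAt, rotate]
  grind

theorem mergeAt_rotate_of_lt {n m j i : ℕ} (h : m < j) (hj : j ≤ n + 1) (hi : i ≤ n)
    (x : ℕ → U) :
    mergeAt (· * ·) m (rotate (n + 1) j x) i =
      rotate n (j - 1) (face (n + 1) (n + 2 - j + m) x) i := by
  unfold face
  split_ifs with h1
  · simp only [mergeAt, rotate]; grind
  · simp only [mergeAt, rotate]; grind

theorem mergeAt_applyAt_rotate_diag {n j i : ℕ} (D : U → U) (hj : j ≤ n) (x : ℕ → U) :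
    mergeAt (· * ·) j (applyAt D (j + 1) (rotate (n + 1) j x)) i =
      rotate n j (mergeAt (· * ·) 0 (applyAt D 1 x)) i := by
  rw [add_comm j 1, ← rotate_applyAt D (by omega), mergeAt_rotate_of_le le_rfl hj, Nat.sub_self,
    face, if_pos (Nat.succ_pos n)]

end Faces

theorem face_face [Semigroup U] {n i j t : ℕ} (hij : i < j) (hj : j ≤ n + 2) (ht : t ≤ n)
    (x : ℕ → U) :
    face (n + 1) i (face (n + 2) j x) t = face (n + 1) (j - 1) (face (n + 2) i x) t := by
  have hi : i < n + 2 := by omega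
  rcases (show i < n + 1 ∨ i = n + 1 by omega) with hi' | rfl
  · by_cases hj' : j < n + 2
    · have : j - 1 < n + 1 := by omega
      simp only [face, mergeAt, hi, hi', hj', this, if_true]
      grind [mul_assoc]
    · have : ¬ (j - 1 < n + 1) := by omega
      obtain rfl : j = n + 2 := by omega
      simp only [face, mergeAt, hi, hi', hj', this, if_true, if_false]
      grind [mul_assoc]
  · obtain rfl : j = n + 2 := by omega
    simp only [face, mergeAt, hi, lt_irrefl, Nat.add_one_sub_one, if_true, if_false]
    grind [mul_assoc]

theorem mergeAt_applyAt_face [Semigroup U] {n k i : ℕ} (hk : k ≤ n) (hi : i ≤ n) (D : U → U)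
    (x : ℕ → U) :
    mergeAt (· * ·) 0 (applyAt D 1 (face (n + 2) (k + 2) x)) i =
      face (n + 1) (k + 1) (mergeAt (· * ·) 0 (applyAt D 1 x)) i := by
  rcases hk.lt_or_eq with h | rfl
  · have h1 : k + 1 < n + 1 := by omega
    have h2 : k + 2 < n + 2 := by omega
    simp only [face, h1, h2, if_true, mergeAt, applyAt, Function.update_apply]; grind
  · simp only [face, lt_irrefl, if_false, mergeAt, applyAt, Function.update_apply]
    grind [mul_assoc]

section FaceConsOne

variable [MulOneClass U]

theorem face_consOne_zero (n : ℕ) (x : ℕ → U) : face (n + 1) 0 (consOne x) = x := by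
  funext i
  simp only [face, mergeAt, consOne, Nat.zero_lt_succ, if_true]; grind [one_mul, mul_one]

theorem face_consOne_succ {n k : ℕ} (hk : k < n) (x : ℕ → U) :
    face (n + 1) (k + 1) (consOne x) = consOne (mergeAt (· * ·) k x) := by
  funext i
  have : k + 1 < n + 1 := by omega
  simp only [face, mergeAt, consOne, this, if_true]; grind [one_mul, mul_one]

theorem face_consOne_last {n i : ℕ} (x : ℕ → U) :
    face (n + 1) (n + 1) (consOne x) i = rotate n 1 x i := by
  simp only [face, rotate, consOne]; grind [one_mul, mul_one]

/-- This is why the Hochschild boundary passes to normalized chains. -/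
theorem face_pred_eq_face {n k i : ℕ} {x : ℕ → U} (hk : k ≤ n) (hx : x (k + 1) = 1)
    (hi : i ≤ n) : face (n + 1) k x i = face (n + 1) (k + 1) x i := by
  rcases hk.lt_or_eq with h | rfl
  · have h1 : k < n + 1 := by omega
    have h2 : k + 1 < n + 1 := by omega
    simp only [face, mergeAt, h1, h2, if_true]; grind [one_mul, mul_one]
  · simp only [face, mergeAt, Nat.lt_succ_self, lt_irrefl, if_true, if_false]
    grind [one_mul, mul_one]

theorem face_eq_one_of_lt {n k l : ℕ} {x : ℕ → U} (hx : x (l + 1) = 1) (hk : k < l)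
    (hl : l ≤ n) : face (n + 1) k x l = 1 := by
  have : k < n + 1 := by omega
  simp only [face, mergeAt, this, if_true]; grind

theorem face_eq_one_of_gt {n k l : ℕ} {x : ℕ → U} (hx : x l = 1) (hl : 0 < l) (hk : l < k) :
    face (n + 1) k x l = 1 := by
  unfold face
  split_ifs
  · simp only [mergeAt]; grind
  · grind

end FaceConsOne

end Words

/-! ### Operators on functions of words -/

section Reindexing

variable {M : Type*} [AddCommMonoid M]

theorem sum_range_sum_Ico_eq_sum_Ico_sum_range (N : ℕ) (F : ℕ → ℕ → M) :
    ∑ j ∈ Finset.range N, ∑ p ∈ Finset.Ico (j + 1) N, F p j =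
      ∑ i ∈ Finset.Ico 1 N, ∑ j ∈ Finset.range (N - i), F (i + j) j := by
  rw [eq_comm, Finset.sum_comm' (t' := Finset.range N) (s' := fun j => Finset.Ico 1 (N - j))
    fun i j => by simp only [Finset.mem_Ico, Finset.mem_range]; omega]
  refine Finset.sum_congr rfl fun j hj => ?_
  rw [Finset.sum_Ico_add' (fun p => F p j), Nat.sub_add_cancel (Finset.mem_range.1 hj).le,
    add_comm 1 j]

/-- Under this reindexing of the pairs (face, rotation) a rotated face becomes a merged rotation. -/
theorem sum_face_sum_rotate_eq (n : ℕ) (H : ℕ → ℕ → M) :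
    ∑ k ∈ Finset.range (n + 2), ∑ j ∈ Finset.range (n + 1), H k j =
      ∑ j ∈ Finset.range (n + 2), ∑ m ∈ Finset.range (n + 1),
        if m < j then H (n + 2 - j + m) (j - 1) else H (m - j) j := by
  rw [← Finset.sum_product', ← Finset.sum_product']
  refine Finset.sum_nbij' (fun a => if a.1 + a.2 ≤ n then (a.2, a.1 + a.2)
      else (a.2 + 1, a.1 + a.2 - (n + 1)))
    (fun a => if a.2 < a.1 then (n + 2 - a.1 + a.2, a.1 - 1) else (a.2 - a.1, a.1)) ?_ ?_ ?_ ?_ ?_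
  all_goals
    rintro ⟨j, p⟩ h
    simp only [Finset.mem_product, Finset.mem_range] at h ⊢
    grind

end Reindexing

theorem neg_one_pow_add_two_mul (a c : ℕ) : (-1 : ℤ) ^ (a + 2 * c) = (-1) ^ a := by
  rw [pow_add, pow_mul, neg_one_sq, one_pow, mul_one]

section Operators

variable {U M : Type*} [AddCommGroup M]

/-- The function `g` depends only on the letters `0, …, n` of a word. -/
def IsLocal {U M : Type*} (n : ℕ) (g : (ℕ → U) → M) : Prop :=
  ∀ ⦃x y : ℕ → U⦄, (∀ i ≤ n, x i = y i) → g x = g y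

variable (M) in
/-- The Hochschild boundary, acting by transposition on functions of words: the value of
`hochschildOp M n g` at `(x₀, …, xₙ₊₁)` is `g (b(x₀, …, xₙ₊₁))`. -/
def hochschildOp [Mul U] (n : ℕ) : ((ℕ → U) → M) →ₗ[ℤ] ((ℕ → U) → M) :=
  ∑ k ∈ Finset.range (n + 2), (-1 : ℤ) ^ k • LinearMap.funLeft ℤ M (face (n + 1) k)

variable (M) in
/-- Connes' operator, acting by transposition on functions of words: the value of
`connesOp M n g` at `(x₀, …, xₙ)` is `g (B(x₀, …, xₙ))`. -/
def connesOp [One U] (n : ℕ) : ((ℕ → U) → M) →ₗ[ℤ] ((ℕ → U) → M) :=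
  ∑ j ∈ Finset.range (n + 1),
    (-1 : ℤ) ^ (j * n) • LinearMap.funLeft ℤ M fun x => consOne (rotate n j x)

variable (M) in
/-- The Lie derivative along `D`, acting by transposition on functions of words of
length `n + 1`. -/
def lieOp (D : U → U) (n : ℕ) : ((ℕ → U) → M) →ₗ[ℤ] ((ℕ → U) → M) :=
  ∑ i ∈ Finset.range (n + 1), LinearMap.funLeft ℤ M (applyAt D i)

variable (M) in
/-- The contraction with a `1`-cochain `D`, acting by transposition on functions of words:
`(x₀, x₁, x₂, …) ↦ (x₀ D(x₁), x₂, …)`. -/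
def contractOne [Mul U] (D : U → U) : ((ℕ → U) → M) →ₗ[ℤ] ((ℕ → U) → M) :=
  LinearMap.funLeft ℤ M fun x => mergeAt (· * ·) 0 (applyAt D 1 x)

variable (M) in
/-- The cyclic part of the contraction with a `1`-cochain `D`, acting by transposition on functions
of words of length `n + 1`: the signed sum of all words `(1, xₙ₋ⱼ₊₁, …, xₙ, x₀, …, D(xᵢ), …, xₙ₋ⱼ)`
with `i ≥ 1`. -/
def cyclicOne [One U] (D : U → U) (n : ℕ) : ((ℕ → U) → M) →ₗ[ℤ] ((ℕ → U) → M) :=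
  ∑ j ∈ Finset.range (n + 1), ∑ p ∈ Finset.Ico (j + 1) (n + 1),
    (-1 : ℤ) ^ (j * n) • LinearMap.funLeft ℤ M fun x => consOne (applyAt D p (rotate n j x))

variable (M) in
/-- The contraction `ι_E` with a `2`-cochain, acting by transposition on functions of words. -/
def contractTwo [Mul U] (E : U → U → U) : ((ℕ → U) → M) →ₗ[ℤ] ((ℕ → U) → M) :=
  -LinearMap.funLeft ℤ M fun x => mergeAt (· * ·) 0 (mergeAt E 1 x)

variable (M) in
/-- The operator `S_E` of a `2`-cochain, acting by transposition on functions of words of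
length `n + 1`. The indices `i`, `j` of the usual formula correspond to `m - j`, `j` here. -/
def cyclicTwo [One U] (E : U → U → U) (n : ℕ) : ((ℕ → U) → M) →ₗ[ℤ] ((ℕ → U) → M) :=
  ∑ j ∈ Finset.range n, ∑ m ∈ Finset.Ico (j + 1) n,
    (-1 : ℤ) ^ (m + j * n) • LinearMap.funLeft ℤ M fun x => consOne (mergeAt E m (rotate n j x))

section Apply

variable {n : ℕ} {g : (ℕ → U) → M} {x : ℕ → U}

theorem hochschildOp_apply [Mul U] : hochschildOp M n g x =
    ∑ k ∈ Finset.range (n + 2), (-1 : ℤ) ^ k • g (face (n + 1) k x) := by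
  simp only [hochschildOp, LinearMap.sum_apply, LinearMap.smul_apply, Finset.sum_apply,
    Pi.smul_apply, LinearMap.funLeft_apply]

theorem connesOp_apply [One U] : connesOp M n g x =
    ∑ j ∈ Finset.range (n + 1), (-1 : ℤ) ^ (j * n) • g (consOne (rotate n j x)) := by
  simp only [connesOp, LinearMap.sum_apply, LinearMap.smul_apply, Finset.sum_apply, Pi.smul_apply,
    LinearMap.funLeft_apply]

theorem lieOp_apply {D : U → U} :
    lieOp M D n g x = ∑ i ∈ Finset.range (n + 1), g (applyAt D i x) := by
  simp only [lieOp, LinearMap.sum_apply, Finset.sum_apply, LinearMap.funLeft_apply]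

theorem contractOne_apply [Mul U] {D : U → U} :
    contractOne M D g x = g (mergeAt (· * ·) 0 (applyAt D 1 x)) := rfl

theorem cyclicOne_apply [One U] {D : U → U} : cyclicOne M D n g x =
    ∑ j ∈ Finset.range (n + 1), ∑ p ∈ Finset.Ico (j + 1) (n + 1),
      (-1 : ℤ) ^ (j * n) • g (consOne (applyAt D p (rotate n j x))) := by
  simp only [cyclicOne, LinearMap.sum_apply, LinearMap.smul_apply, Finset.sum_apply, Pi.smul_apply,
    LinearMap.funLeft_apply]

theorem contractTwo_apply [Mul U] {E : U → U → U} :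
    contractTwo M E g x = -g (mergeAt (· * ·) 0 (mergeAt E 1 x)) := rfl

theorem cyclicTwo_apply [One U] {E : U → U → U} : cyclicTwo M E n g x =
    ∑ j ∈ Finset.range n, ∑ m ∈ Finset.Ico (j + 1) n,
      (-1 : ℤ) ^ (m + j * n) • g (consOne (mergeAt E m (rotate n j x))) := by
  simp only [cyclicTwo, LinearMap.sum_apply, LinearMap.smul_apply, Finset.sum_apply, Pi.smul_apply,
    LinearMap.funLeft_apply]

end Apply

section Identities

variable {n : ℕ} {g : (ℕ → U) → M}

omit [AddCommGroup M] in
theorem IsLocal.comp_consOne [One U] (hg : IsLocal (n + 1) g) :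
    IsLocal n fun x => g (consOne x) := fun x y hxy => hg fun i hi => by
  unfold consOne
  split_ifs
  · rfl
  · exact hxy _ (by omega)

omit [AddCommGroup M] in
theorem IsLocal.comp_applyAt (hg : IsLocal n g) (D : U → U) (p : ℕ) :
    IsLocal n fun z => g (applyAt D p z) := fun x y hxy => hg fun i hi => by
  simp only [applyAt, Function.update_apply]
  split_ifs with h
  · rw [← h, hxy i hi]
  · exact hxy i hi

theorem IsLocal.sum {ι : Type*} {s : Finset ι} {g : ι → (ℕ → U) → M}
    (hg : ∀ i ∈ s, IsLocal n (g i)) : IsLocal n fun x => ∑ i ∈ s, g i x := fun _ _ hxy =>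
  Finset.sum_congr rfl fun i hi => hg i hi hxy

theorem sum_rotate_sub_rotate_one (hg : IsLocal n g) (x : ℕ → U) {c : ℕ} (hc : c ≤ n + 1) :
    ∑ j ∈ Finset.range c, (-1 : ℤ) ^ (j * n) •
        (g (rotate n j x) - (-1 : ℤ) ^ n • g (rotate n 1 (rotate n j x))) =
      g x - (-1 : ℤ) ^ (c * n) • g (rotate n c x) := by
  have h : ∀ j ∈ Finset.range c, (-1 : ℤ) ^ (j * n) •
      (g (rotate n j x) - (-1 : ℤ) ^ n • g (rotate n 1 (rotate n j x))) =
      (-1 : ℤ) ^ (j * n) • g (rotate n j x) -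
        (-1 : ℤ) ^ ((j + 1) * n) • g (rotate n (j + 1) x) := fun j hj => by
    have := Finset.mem_range.1 hj
    rw [hg fun i _ => rotate_one_rotate (by omega) x, smul_sub, smul_smul, ← pow_add]
    congr 4; ring
  rw [Finset.sum_congr rfl h, Finset.sum_range_sub']
  simp [rotate_zero]

variable [Monoid U]

theorem hochschildOp_hochschildOp (hg : IsLocal n g) :
    hochschildOp M (n + 1) (hochschildOp M n g) = 0 := by
  funext x
  simp only [hochschildOp_apply, Finset.smul_sum, ← Finset.sum_product', smul_smul, ← pow_add]
  refine Finset.sum_involution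
    (fun a _ => if a.2 < a.1 then (a.2, a.1 - 1) else (a.2 + 1, a.1)) ?_ ?_ ?_ ?_
  · rintro ⟨j, i⟩ h
    simp only [Finset.mem_product, Finset.mem_range] at h ⊢
    by_cases hij : i < j
    · obtain ⟨j, rfl⟩ : ∃ k, j = k + 1 := ⟨j - 1, by omega⟩
      rw [if_pos hij, hg fun t ht => face_face hij (by omega) ht x, ← add_smul,
        show j + 1 + i = i + j + 1 by ring, pow_succ]
      simp
    · rw [if_neg hij, hg (y := face (n + 1) i (face (n + 1 + 1) j x)) fun t ht =>
        face_face (i := j) (j := i + 1) (by omega) (by omega) ht x, ← add_smul,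
        show i + 1 + j = j + i + 1 by ring, pow_succ]
      simp
  all_goals
    rintro ⟨j, i⟩ h
    simp only [Finset.mem_product, Finset.mem_range] at h ⊢
    grind

theorem hochschildOp_consOne (hg : IsLocal n g) (x : ℕ → U) :
    hochschildOp M n g (consOne x) = g x -
      ∑ m ∈ Finset.range n, (-1 : ℤ) ^ m • g (consOne (mergeAt (· * ·) m x)) -
      (-1 : ℤ) ^ n • g (rotate n 1 x) := by
  rw [hochschildOp_apply, Finset.sum_range_succ, Finset.sum_range_succ', face_consOne_zero,
    hg fun i _ => face_consOne_last x]
  have h : ∀ m ∈ Finset.range n, (-1 : ℤ) ^ (m + 1) • g (face (n + 1) (m + 1) (consOne x)) =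
      -((-1 : ℤ) ^ m • g (consOne (mergeAt (· * ·) m x))) := fun m hm => by
    rw [face_consOne_succ (Finset.mem_range.1 hm), pow_succ]; simp
  rw [Finset.sum_congr rfl h, Finset.sum_neg_distrib, pow_succ]
  simp only [pow_zero, one_smul, mul_neg, mul_one, neg_smul]
  abel

theorem connesOp_hochschildOp_zero {g : (ℕ → U) → M} (hg : IsLocal 0 g) :
    connesOp M 0 (hochschildOp M 0 g) = 0 := by
  funext x
  simp only [connesOp_apply, zero_add, Finset.sum_range_one, mul_zero, pow_zero, one_smul,
    hochschildOp_consOne hg, rotate_zero, Finset.range_zero, Finset.sum_empty, sub_zero]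
  rw [hg fun _ hi => rotate_full hi x, sub_self, Pi.zero_apply]

theorem sum_face_rotate_eq_sum_mergeAt_rotate {h : ℕ → (ℕ → U) → M} (hh : ∀ j, IsLocal n (h j))
    (x : ℕ → U) :
    ∑ k ∈ Finset.range (n + 2), (-1 : ℤ) ^ k • ∑ j ∈ Finset.range (n + 1), (-1 : ℤ) ^ (j * n) •
        h j (rotate n j (face (n + 1) k x)) =
      ∑ j ∈ Finset.range (n + 2), (-1 : ℤ) ^ (j * (n + 1)) • ∑ m ∈ Finset.range (n + 1),
        (-1 : ℤ) ^ m •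
          h (if m < j then j - 1 else j) (mergeAt (· * ·) m (rotate (n + 1) j x)) := by
  simp only [Finset.smul_sum, smul_smul, ← pow_add]
  rw [sum_face_sum_rotate_eq]
  refine Finset.sum_congr rfl fun j hj => Finset.sum_congr rfl fun m hm => ?_
  rw [Finset.mem_range] at hj hm
  split_ifs with hmj
  · rw [hh _ fun i hi => mergeAt_rotate_of_lt hmj (by omega) hi x]
    congr 1
    obtain ⟨j, rfl⟩ : ∃ i, j = i + 1 := ⟨j - 1, by omega⟩
    obtain ⟨c, rfl⟩ : ∃ c, n = j + c := ⟨n - j, by omega⟩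
    rw [← neg_one_pow_add_two_mul _ j, show j + c + 2 - (j + 1) = c + 1 by omega,
      Nat.add_sub_cancel]
    congr 1; ring
  · rw [hh _ fun i _ => mergeAt_rotate_of_le (n := n) (by omega) (by omega) x]
    congr 1
    obtain ⟨c, rfl⟩ : ∃ c, m = j + c := ⟨m - j, by omega⟩
    rw [← neg_one_pow_add_two_mul _ j, Nat.add_sub_cancel_left]
    congr 1; ring

theorem connesOp_hochschildOp_add (hg : IsLocal (n + 1) g) :
    connesOp M (n + 1) (hochschildOp M (n + 1) g) + hochschildOp M n (connesOp M n g) = 0 := by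
  funext x
  have hfaces := sum_face_rotate_eq_sum_mergeAt_rotate (fun _ => hg.comp_consOne) x
  have htelescope := sum_rotate_sub_rotate_one hg x (c := n + 2) le_rfl
  have hsign : (-1 : ℤ) ^ ((n + 2) * (n + 1)) = 1 := by
    rw [mul_comm]; exact (Nat.even_mul_succ_self (n + 1)).neg_one_pow
  rw [hg fun _ hi => rotate_full hi x, hsign, one_smul, sub_self] at htelescope
  simp only [Pi.add_apply, connesOp_apply, hochschildOp_consOne hg]
  rw [hochschildOp_apply]
  simp only [connesOp_apply]
  rw [hfaces, ← Finset.sum_add_distrib, Pi.zero_apply, ← htelescope]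
  refine Finset.sum_congr rfl fun j _ => ?_
  rw [← smul_add]; congr 1; abel

end Identities

section Multilinear

variable (S : Type*) [CommRing S] [Ring U] [Algebra S U] [Module S M]

/-- The function `g` of words depends only on the letters `0, …, n`, and it is `S`-linear in each of
them. -/
structure IsWordMultilinear (n : ℕ) (g : (ℕ → U) → M) : Prop where
  isLocal : IsLocal n g
  isLinearMap : ∀ k ≤ n, ∀ x, IsLinearMap S fun u => g (Function.update x k u)

variable {S} {n : ℕ} {g : (ℕ → U) → M}

theorem IsWordMultilinear.apply_update_smul (hg : IsWordMultilinear S n g) {k : ℕ} (hk : k ≤ n)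
    (x : ℕ → U) (r : S) : g (Function.update x k (r • x k)) = r • g x := by
  rw [(hg.isLinearMap k hk x).map_smul, Function.update_eq_self]

omit [AddCommGroup M] [Ring U] in
theorem mergeAt_eq_update (β γ : U → U → U) (m : ℕ) (x : ℕ → U) :
    mergeAt β m x = Function.update (mergeAt γ m x) m (β (x m) (x (m + 1))) := by
  funext i
  simp only [mergeAt, Function.update_apply]; grind

theorem IsWordMultilinear.apply_mergeAt_coboundary (hg : IsWordMultilinear S n g) {m : ℕ}
    (hm : m ≤ n) (D : U → U) (x : ℕ → U) :
    g (mergeAt (coboundary D) m x) = g (mergeAt (· * ·) m (applyAt D m x)) +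
      g (mergeAt (· * ·) m (applyAt D (m + 1) x)) - g (applyAt D m (mergeAt (· * ·) m x)) := by
  have hlin := hg.isLinearMap m hm (mergeAt (· * ·) m x)
  rw [mergeAt_eq_update _ (· * ·), coboundary, hlin.map_sub, hlin.map_add]
  congr 3
  · funext i
    simp only [mergeAt, applyAt, Function.update_apply]; grind
  · funext i
    simp only [mergeAt, applyAt, Function.update_apply]; grind
  · simp [mergeAt]

theorem IsWordMultilinear.apply_mergeAt_mergeAt_coboundary (hg : IsWordMultilinear S n g)
    (D : U → U) (x : ℕ → U) :
    g (mergeAt (· * ·) 0 (mergeAt (coboundary D) 1 x)) =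
      g (face (n + 1) 0 (mergeAt (· * ·) 0 (applyAt D 1 x))) +
        g (mergeAt (· * ·) 0 (applyAt D 1 (face (n + 2) 0 x))) -
        g (mergeAt (· * ·) 0 (applyAt D 1 (face (n + 2) 1 x))) := by
  have hlin := hg.isLinearMap 0 n.zero_le fun i => x (i + 2)
  trans g (Function.update (fun i => x (i + 2)) 0
    (x 0 * D (x 1) * x 2 + x 0 * x 1 * D (x 2) - x 0 * D (x 1 * x 2)))
  · congr 1; funext i
    simp only [mergeAt, coboundary, Function.update_apply]; grind
  rw [hlin.map_sub, hlin.map_add]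
  have h1 : 1 < n + 2 := by omega
  congr 3 <;> funext i <;>
    simp only [face, Nat.zero_lt_succ, h1, if_true, mergeAt, applyAt, Function.update_apply] <;>
    grind [mul_assoc]

theorem contractOne_hochschildOp_add (hg : IsWordMultilinear S n g) (D : U → U) :
    contractOne M D (hochschildOp M n g) + hochschildOp M (n + 1) (contractOne M D g) =
      -contractTwo M (coboundary D) g := by
  funext x
  have hinner : ∀ k ∈ Finset.range (n + 1),
      (-1 : ℤ) ^ (k + 1 + 1) • g (mergeAt (· * ·) 0 (applyAt D 1 (face (n + 2) (k + 1 + 1) x))) =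
        -((-1 : ℤ) ^ (k + 1) • g (face (n + 1) (k + 1) (mergeAt (· * ·) 0 (applyAt D 1 x)))) := by
    intro k hk
    rw [pow_succ, mul_neg, mul_one, neg_smul, hg.isLocal fun i hi =>
      mergeAt_applyAt_face (Nat.lt_succ_iff.1 (Finset.mem_range.1 hk)) hi D x]
  simp only [Pi.add_apply, Pi.neg_apply, contractTwo_apply, neg_neg,
    hg.apply_mergeAt_mergeAt_coboundary]
  rw [hochschildOp_apply, contractOne_apply, hochschildOp_apply, Finset.sum_range_succ' _ (n + 2),
    Finset.sum_range_succ' _ (n + 1), Finset.sum_range_succ' _ (n + 1)]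
  simp only [contractOne_apply]
  rw [Finset.sum_congr rfl hinner, Finset.sum_neg_distrib]
  simp only [zero_add, pow_zero, one_smul, pow_one, neg_smul]
  abel

section Homotopy

theorem IsWordMultilinear.comp {m : ℕ} {w : (ℕ → U) → ℕ → U} (hg : IsWordMultilinear S n g)
    (hlocal : ∀ ⦃x y : ℕ → U⦄, (∀ i ≤ m, x i = y i) → ∀ i ≤ n, w x i = w y i)
    (hlinear : ∀ k ≤ m, ∀ x, ∃ l ≤ n, ∃ L : U →ₗ[S] U,
      ∀ u, ∀ i ≤ n, w (Function.update x k u) i = Function.update (w x) l (L u) i) :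
    IsWordMultilinear S m fun x => g (w x) where
  isLocal _ _ hxy := hg.isLocal (hlocal hxy)
  isLinearMap k hk x := by
    obtain ⟨l, hl, L, h⟩ := hlinear k hk x
    rw [funext fun u => hg.isLocal (h u)]
    exact ((hg.isLinearMap l hl (w x)).mk' _ ∘ₗ L).isLinear

theorem IsWordMultilinear.comp_consOne (hg : IsWordMultilinear S (n + 1) g) :
    IsWordMultilinear S n fun x => g (consOne x) := by
  refine hg.comp (fun x y hxy i hi => ?_) fun k hk x =>
    ⟨k + 1, by omega, LinearMap.id, fun u i _ => ?_⟩
  · simp only [consOne]; grind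
  · simp only [consOne, Function.update_apply, LinearMap.id_apply]; grind

theorem sum_Ico_mergeAt_applyAt (hg : IsWordMultilinear S n g) {m j : ℕ} (hm : m < n + 1)
    (D : U → U) (z : ℕ → U) :
    ∑ p ∈ Finset.Ico (j + 1) (n + 2), g (mergeAt (· * ·) m (applyAt D p z)) =
      ∑ p ∈ Finset.Ico ((if m < j then j - 1 else j) + 1) (n + 1),
        g (applyAt D p (mergeAt (· * ·) m z)) +
      if m < j then 0 else if m = j then g (mergeAt (· * ·) j (applyAt D (j + 1) z))
        else g (mergeAt (coboundary D) m z) := by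
  have hshift : ∀ c, m + 1 ≤ c →
      ∑ p ∈ Finset.Ico (c + 1) (n + 2), g (mergeAt (· * ·) m (applyAt D p z)) =
        ∑ p ∈ Finset.Ico c (n + 1), g (applyAt D p (mergeAt (· * ·) m z)) := fun c hc => by
    rw [← Finset.sum_Ico_add' (fun p => g (mergeAt (· * ·) m (applyAt D p z))) c (n + 1) 1]
    refine Finset.sum_congr rfl fun p hp => ?_
    have := (Finset.mem_Ico.1 hp).1
    rw [mergeAt_applyAt_of_gt D _ (by omega), Nat.add_sub_cancel]
  rcases lt_trichotomy m j with hmj | rfl | hjm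
  · simp only [hmj, if_true, add_zero]
    rw [Nat.sub_add_cancel (by omega), hshift j (by omega)]
  · simp only [lt_irrefl, if_true, if_false]
    rw [Finset.sum_eq_sum_Ico_succ_bot (by omega), hshift _ le_rfl, add_comm]
  · simp only [hjm.not_gt, hjm.ne', if_false]
    rw [← Finset.sum_Ico_consecutive _ (show j + 1 ≤ m by omega) (show m ≤ n + 2 by omega),
      ← Finset.sum_Ico_consecutive _ (show j + 1 ≤ m by omega) (show m ≤ n + 1 by omega),
      Finset.sum_eq_sum_Ico_succ_bot (show m < n + 2 by omega),
      Finset.sum_eq_sum_Ico_succ_bot (show m + 1 < n + 2 by omega),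
      Finset.sum_eq_sum_Ico_succ_bot (show m < n + 1 by omega), hshift _ le_rfl,
      hg.apply_mergeAt_coboundary (by omega),
      Finset.sum_congr rfl fun p hp => congrArg g <|
        mergeAt_applyAt_of_lt D _ (Finset.mem_Ico.1 hp).2 z]
    abel

theorem connesOp_contractOne_apply (D : U → U) (x : ℕ → U) :
    connesOp M n (contractOne M D g) x = g (applyAt D 0 x) + ∑ i ∈ Finset.Ico 1 (n + 1),
      (-1 : ℤ) ^ ((n + 1 - i) * n) • g (applyAt D 0 (rotate n (n + 1 - i) x)) := by
  simp only [connesOp_apply, contractOne_apply, mergeAt_zero_applyAt_consOne]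
  rw [Finset.range_eq_Ico, Finset.sum_eq_sum_Ico_succ_bot (by omega), rotate_zero, zero_mul,
    pow_zero, one_smul]
  congr 1
  refine Finset.sum_nbij' (fun j => n + 1 - j) (fun j => n + 1 - j) ?_ ?_ ?_ ?_ ?_
  all_goals intro a ha; simp only [Finset.mem_Ico] at ha ⊢
  any_goals omega
  rw [show n + 1 - (n + 1 - a) = a by omega]

/-- Only the rotations of `(x₀, …, D(xᵢ), …, xₙ)` and the words produced by `b` from the letter `1`
survive: the sum telescopes along each orbit of the rotation. -/
theorem sum_applyAt_rotate_add_connesOp_contractOne (hg : IsLocal n g) (D : U → U) (x : ℕ → U) :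
    ∑ j ∈ Finset.range (n + 1), ∑ p ∈ Finset.Ico (j + 1) (n + 1), (-1 : ℤ) ^ (j * n) •
        (g (applyAt D p (rotate n j x)) -
          (-1 : ℤ) ^ n • g (rotate n 1 (applyAt D p (rotate n j x)))) +
      connesOp M n (contractOne M D g) x = lieOp M D n g x := by
  have htelescope : ∀ i ∈ Finset.Ico 1 (n + 1),
      ∑ j ∈ Finset.range (n + 1 - i), (-1 : ℤ) ^ (j * n) •
        (g (applyAt D (i + j) (rotate n j x)) -
          (-1 : ℤ) ^ n • g (rotate n 1 (applyAt D (i + j) (rotate n j x)))) =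
      g (applyAt D i x) -
        (-1 : ℤ) ^ ((n + 1 - i) * n) • g (applyAt D 0 (rotate n (n + 1 - i) x)) := by
    intro i hi
    rw [Finset.mem_Ico] at hi
    rw [← hg fun k hk => rotate_applyAt_eq_zero (j := n + 1 - i) (i := i) D (by omega) hk
      (by omega) x, ← sum_rotate_sub_rotate_one hg (applyAt D i x) (by omega)]
    refine Finset.sum_congr rfl fun j hj => ?_
    have := Finset.mem_range.1 hj
    rw [← rotate_applyAt (j := j) (i := i) D (by omega)]
  rw [sum_range_sum_Ico_eq_sum_Ico_sum_range, Finset.sum_congr rfl htelescope,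
    Finset.sum_sub_distrib, connesOp_contractOne_apply, lieOp_apply, Finset.range_eq_Ico,
    Finset.sum_eq_sum_Ico_succ_bot (a := 0) (b := n + 1) (by omega)]
  abel

theorem connesOp_contractOne_zero {g : (ℕ → U) → M} (hg : IsLocal 0 g) (D : U → U) :
    connesOp M 0 (contractOne M D g) = lieOp M D 0 g := by
  funext x
  rw [← sum_applyAt_rotate_add_connesOp_contractOne hg]; simp

theorem cyclicOne_hochschildOp_add (hg : IsLocal (n + 1) g) (D : U → U) (x : ℕ → U) :
    cyclicOne M D (n + 1) (hochschildOp M (n + 1) g) x +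
        connesOp M (n + 1) (contractOne M D g) x = lieOp M D (n + 1) g x -
      ∑ j ∈ Finset.range (n + 2), (-1 : ℤ) ^ (j * (n + 1)) • ∑ m ∈ Finset.range (n + 1),
        (-1 : ℤ) ^ m • ∑ p ∈ Finset.Ico (j + 1) (n + 2),
          g (consOne (mergeAt (· * ·) m (applyAt D p (rotate (n + 1) j x)))) := by
  rw [← sum_applyAt_rotate_add_connesOp_contractOne hg, add_sub_right_comm, cyclicOne_apply,
    ← Finset.sum_sub_distrib]
  congr 1
  refine Finset.sum_congr rfl fun j _ => ?_
  simp only [Finset.smul_sum (s := Finset.Ico _ _)]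
  rw [Finset.sum_comm (s := Finset.range (n + 1)), Finset.smul_sum, ← Finset.sum_sub_distrib]
  refine Finset.sum_congr rfl fun p _ => ?_
  rw [hochschildOp_consOne hg, ← smul_sub]; congr 1; abel

theorem hochschildOp_cyclicOne_apply (hg : IsLocal (n + 1) g) (D : U → U) (x : ℕ → U) :
    hochschildOp M n (cyclicOne M D n g) x =
      ∑ j ∈ Finset.range (n + 2), (-1 : ℤ) ^ (j * (n + 1)) • ∑ m ∈ Finset.range (n + 1),
        (-1 : ℤ) ^ m • ∑ p ∈ Finset.Ico ((if m < j then j - 1 else j) + 1) (n + 1),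
          g (consOne (applyAt D p (mergeAt (· * ·) m (rotate (n + 1) j x)))) := by
  rw [← sum_face_rotate_eq_sum_mergeAt_rotate
    (h := fun j z => ∑ p ∈ Finset.Ico (j + 1) (n + 1), g (consOne (applyAt D p z)))
    fun j => IsLocal.sum fun p _ => hg.comp_consOne.comp_applyAt D p]
  simp only [hochschildOp_apply, cyclicOne_apply, Finset.smul_sum]

theorem sum_mergeAt_eq_cyclicTwo_add (D : U → U) (x : ℕ → U) :
    ∑ j ∈ Finset.range (n + 2), (-1 : ℤ) ^ (j * (n + 1)) • ∑ m ∈ Finset.range (n + 1),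
        (-1 : ℤ) ^ m • (if m < j then 0 else if m = j then
          g (consOne (mergeAt (· * ·) j (applyAt D (j + 1) (rotate (n + 1) j x))))
        else g (consOne (mergeAt (coboundary D) m (rotate (n + 1) j x)))) =
      cyclicTwo M (coboundary D) (n + 1) g x + contractOne M D (connesOp M n g) x := by
  rw [cyclicTwo_apply, contractOne_apply, connesOp_apply, ← Finset.sum_add_distrib,
    Finset.sum_range_succ]
  have hlast : ∀ m ∈ Finset.range (n + 1), (-1 : ℤ) ^ m • (if m < n + 1 then (0 : M) else
      if m = n + 1 then
        g (consOne (mergeAt (· * ·) (n + 1) (applyAt D (n + 1 + 1) (rotate (n + 1) (n + 1) x))))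
      else g (consOne (mergeAt (coboundary D) m (rotate (n + 1) (n + 1) x)))) = 0 := fun m hm => by
    rw [if_pos (Finset.mem_range.1 hm), smul_zero]
  rw [Finset.sum_eq_zero hlast, smul_zero, add_zero]
  refine Finset.sum_congr rfl fun j hj => ?_
  rw [Finset.mem_range] at hj
  rw [Finset.range_eq_Ico, ← Finset.sum_Ico_consecutive _ (Nat.zero_le j) hj.le,
    Finset.sum_eq_sum_Ico_succ_bot hj, Finset.sum_eq_zero (s := Finset.Ico 0 j) fun m hm => by
      rw [if_pos (Finset.mem_Ico.1 hm).2, smul_zero],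
    zero_add, if_neg (lt_irrefl j), if_pos rfl, smul_add, add_comm, Finset.smul_sum, smul_smul,
    ← pow_add]
  congr 1
  · refine Finset.sum_congr rfl fun m hm => ?_
    rw [Finset.mem_Ico] at hm
    rw [if_neg (by omega), if_neg (by omega), smul_smul, ← pow_add, add_comm]
  · rw [funext fun i => mergeAt_applyAt_rotate_diag (i := i) D (Nat.lt_succ_iff.1 hj) x,
      ← neg_one_pow_add_two_mul (j * n) j]
    congr 2; ring

/-- The cyclic part of Cartan's homotopy formula. -/
theorem cyclicOne_hochschildOp_add_add (hg : IsWordMultilinear S (n + 1) g) (D : U → U) :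
    cyclicOne M D (n + 1) (hochschildOp M (n + 1) g) + hochschildOp M n (cyclicOne M D n g) +
        contractOne M D (connesOp M n g) + connesOp M (n + 1) (contractOne M D g) =
      lieOp M D (n + 1) g - cyclicTwo M (coboundary D) (n + 1) g := by
  funext x
  have houter := cyclicOne_hochschildOp_add hg.isLocal D x
  have hcommute := fun (j m : ℕ) (hm : m < n + 1) =>
    sum_Ico_mergeAt_applyAt (j := j) hg.comp_consOne hm D (rotate (n + 1) j x)
  rw [Finset.sum_congr (g := fun j => _) rfl fun j _ => congrArg _ <|
    Finset.sum_congr rfl fun m hm => congrArg _ (hcommute j m (Finset.mem_range.1 hm))] at houter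
  simp only [smul_add, Finset.sum_add_distrib] at houter
  rw [← hochschildOp_cyclicOne_apply hg.isLocal, sum_mergeAt_eq_cyclicTwo_add] at houter
  simp only [Pi.add_apply, Pi.sub_apply]
  rw [eq_sub_iff_add_eq, ← eq_sub_iff_add_eq.1 houter]
  abel

end Homotopy

section Cochains

namespace IsWordMultilinear

variable {m : ℕ}

theorem comp_rotate (hg : IsWordMultilinear S n g) {j : ℕ} (hj : j ≤ n + 1) :
    IsWordMultilinear S n fun x => g (rotate n j x) := by
  refine hg.comp (fun x y hxy i hi => ?_) fun k hk x =>
    ⟨if k + j ≤ n then k + j else k + j - (n + 1), by split_ifs <;> omega, LinearMap.id,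
      fun u i _ => ?_⟩
  · simp only [rotate]; grind
  · simp only [rotate, Function.update_apply, LinearMap.id_apply]; grind

theorem comp_applyAt (hg : IsWordMultilinear S n g) {D : U → U} (hD : IsLinearMap S D) (p : ℕ) :
    IsWordMultilinear S n fun x => g (applyAt D p x) := by
  refine hg.comp (fun x y hxy i hi => ?_) fun k hk x => ?_
  · simp only [applyAt, Function.update_apply]; grind
  · by_cases hkp : k = p
    · refine ⟨k, hk, hD.mk' D, fun u i _ => ?_⟩
      simp only [applyAt, Function.update_apply, IsLinearMap.mk'_apply]; grind
    · refine ⟨k, hk, LinearMap.id, fun u i _ => ?_⟩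
      simp only [applyAt, Function.update_apply, LinearMap.id_apply]; grind

theorem comp_mergeAt (hg : IsWordMultilinear S n g) {β : U → U → U}
    (hleft : ∀ v, IsLinearMap S fun u => β u v) (hright : ∀ u, IsLinearMap S (β u)) (hm : m ≤ n) :
    IsWordMultilinear S (n + 1) fun x => g (mergeAt β m x) := by
  refine hg.comp (fun x y hxy i hi => ?_) fun k hk x => ?_
  · simp only [mergeAt]; grind
  · obtain h | rfl | rfl | h : k < m ∨ k = m ∨ k = m + 1 ∨ m + 1 < k := by omega
    · refine ⟨k, by omega, LinearMap.id, fun u i _ => ?_⟩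
      simp only [mergeAt, Function.update_apply, LinearMap.id_apply]; grind
    · refine ⟨k, hm, (hleft (x (k + 1))).mk' _, fun u i _ => ?_⟩
      simp only [mergeAt, Function.update_apply, IsLinearMap.mk'_apply]; grind
    · refine ⟨m, hm, (hright (x m)).mk' _, fun u i _ => ?_⟩
      simp only [mergeAt, Function.update_apply, IsLinearMap.mk'_apply]; grind
    · refine ⟨k - 1, by omega, LinearMap.id, fun u i _ => ?_⟩
      simp only [mergeAt, Function.update_apply, LinearMap.id_apply]; grind

theorem comp_mergeAt_mul (hg : IsWordMultilinear S n g) (hm : m ≤ n) :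
    IsWordMultilinear S (n + 1) fun x => g (mergeAt (· * ·) m x) :=
  hg.comp_mergeAt (fun v => (LinearMap.mulRight S v).isLinear)
    (fun u => (LinearMap.mulLeft S u).isLinear) hm

theorem comp_face (hg : IsWordMultilinear S n g) {k : ℕ} :
    IsWordMultilinear S (n + 1) fun x => g (face (n + 1) k x) := by
  unfold face
  split_ifs with hk
  · exact hg.comp_mergeAt_mul (Nat.lt_succ_iff.1 hk)
  · refine hg.comp (fun x y hxy i hi => ?_) fun k hk x => ?_
    · simp only [hxy _ le_rfl, hxy 0 (by omega), hxy i (by omega)]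
    · obtain rfl | rfl | h : k = 0 ∨ k = n + 1 ∨ 0 < k ∧ k ≤ n := by omega
      · refine ⟨0, n.zero_le, LinearMap.mulLeft S (x (n + 1)), fun u i _ => ?_⟩
        simp only [Function.update_apply, LinearMap.mulLeft_apply]; grind
      · refine ⟨0, n.zero_le, LinearMap.mulRight S (x 0), fun u i _ => ?_⟩
        simp only [Function.update_apply, LinearMap.mulRight_apply]; grind
      · refine ⟨k, h.2, LinearMap.id, fun u i _ => ?_⟩
        simp only [Function.update_apply, LinearMap.id_apply]; grind

theorem sum {ι : Type*} {s : Finset ι} {g : ι → (ℕ → U) → M}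
    (hg : ∀ i ∈ s, IsWordMultilinear S n (g i)) :
    IsWordMultilinear S n fun x => ∑ i ∈ s, g i x where
  isLocal := IsLocal.sum fun i hi => (hg i hi).isLocal
  isLinearMap k hk x :=
    { map_add u v := by
        rw [← Finset.sum_add_distrib]
        exact Finset.sum_congr rfl fun i hi => ((hg i hi).isLinearMap k hk x).map_add u v
      map_smul c u := by
        rw [Finset.smul_sum]
        exact Finset.sum_congr rfl fun i hi => ((hg i hi).isLinearMap k hk x).map_smul c u }

theorem zsmul (hg : IsWordMultilinear S n g) (c : ℤ) : IsWordMultilinear S n fun x => c • g x where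
  isLocal _ _ hxy := congrArg (c • ·) (hg.isLocal hxy)
  isLinearMap k hk x := (c • (hg.isLinearMap k hk x).mk').isLinear

end IsWordMultilinear

variable (S) in
/-- A normalized `S`-multilinear cochain of degree `n`: it vanishes on the words in which one of the
letters `1, …, n` is `1`, and in degree `0`, where chains have all letters in the algebra without
unit, also if the letter `0` is `1`. -/
structure IsCochain (n : ℕ) (g : (ℕ → U) → M) : Prop extends IsWordMultilinear S n g where
  eq_zero_of_eq_one : ∀ x k, k ≤ n → (k = 0 → n = 0) → x k = 1 → g x = 0

theorem IsWordMultilinear.eq_zero_of_eq_zero (hg : IsWordMultilinear S n g) {k : ℕ} (hk : k ≤ n)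
    {x : ℕ → U} (hx : x k = 0) : g x = 0 := by
  have h := (hg.isLinearMap k hk x).map_zero
  rwa [← hx, Function.update_eq_self] at h

namespace IsCochain

variable {k : ℕ} {x : ℕ → U}

theorem map {N : Type*} [AddCommGroup N] [Module S N] (hg : IsCochain S n g) (f : M →ₗ[S] N) :
    IsCochain S n fun x => f (g x) where
  isLocal _ _ hxy := congrArg f (hg.isLocal hxy)
  isLinearMap k hk x := (f ∘ₗ (hg.isLinearMap k hk x).mk' _).isLinear
  eq_zero_of_eq_one x k hk hk0 hx := by rw [hg.eq_zero_of_eq_one x k hk hk0 hx, map_zero]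

theorem add {g₁ g₂ : (ℕ → U) → M} (h₁ : IsCochain S n g₁) (h₂ : IsCochain S n g₂) :
    IsCochain S n (g₁ + g₂) where
  isLocal _ _ hxy := congrArg₂ (· + ·) (h₁.isLocal hxy) (h₂.isLocal hxy)
  isLinearMap k hk x := ((h₁.isLinearMap k hk x).mk' _ + (h₂.isLinearMap k hk x).mk' _).isLinear
  eq_zero_of_eq_one x k hk hk0 hx := by
    rw [Pi.add_apply, h₁.eq_zero_of_eq_one x k hk hk0 hx, h₂.eq_zero_of_eq_one x k hk hk0 hx,
      add_zero]

theorem apply_consOne_eq_zero (hg : IsCochain S (n + 1) g) (hk : k ≤ n) (hx : x k = 1 ∨ x k = 0) :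
    g (consOne x) = 0 := by
  have h : consOne x (k + 1) = x k := rfl
  rcases hx with hx | hx
  · exact hg.eq_zero_of_eq_one _ (k + 1) (by omega) (by omega) (h.trans hx)
  · exact hg.eq_zero_of_eq_zero (k := k + 1) (by omega) (h.trans hx)

theorem apply_consOne_rotate_eq_zero (hg : IsCochain S (n + 1) g) {w : (ℕ → U) → ℕ → U} {m j : ℕ}
    (hw : ∀ y l, l ≤ m → y l = 1 → ∃ i ≤ n, w y i = 1 ∨ w y i = 0) (hj : j ≤ m + 1) (hk : k ≤ m)
    (hx : x k = 1) : g (consOne (w (rotate m j x))) = 0 := by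
  obtain ⟨i, hi, h⟩ := hw (rotate m j x) (if k + j ≤ m then k + j else k + j - (m + 1))
    (by split_ifs <;> omega) (by simp only [rotate]; grind)
  exact hg.apply_consOne_eq_zero hi h

theorem hochschildOp (hg : IsCochain S n g) : IsCochain S (n + 1) (hochschildOp M n g) where
  toIsWordMultilinear := by
    rw [funext fun x => hochschildOp_apply (n := n) (g := g) (x := x)]
    exact .sum fun k _ => hg.comp_face.zsmul _
  eq_zero_of_eq_one x k hk hk0 hx := by
    obtain ⟨k, rfl⟩ : ∃ l, k = l + 1 := ⟨k - 1, by omega⟩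
    have hk' : k ≤ n := by omega
    have hvanish : ∀ m ∈ Finset.range (n + 2), m ≠ k ∧ m ≠ k + 1 →
        (-1 : ℤ) ^ m • g (face (n + 1) m x) = 0 := fun m hm hmk => by
      rcases Nat.lt_or_gt_of_ne hmk.1 with h | h
      · rw [hg.eq_zero_of_eq_one _ k hk' (by omega) (face_eq_one_of_lt hx h hk'), smul_zero]
      · have := Finset.mem_range.1 hm
        rw [hg.eq_zero_of_eq_one _ (k + 1) (by omega) (by omega)
          (face_eq_one_of_gt hx k.succ_pos (by omega)), smul_zero]
    rw [hochschildOp_apply, Finset.sum_eq_add k (k + 1) (by omega) hvanish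
      (fun h => absurd (Finset.mem_range.2 (by omega)) h)
      (fun h => absurd (Finset.mem_range.2 (by omega)) h),
      hg.isLocal fun i hi => face_pred_eq_face hk' hx hi, pow_succ, mul_neg, mul_one, neg_smul,
      add_neg_cancel]

theorem connesOp (hg : IsCochain S (n + 1) g) : IsCochain S n (connesOp M n g) where
  toIsWordMultilinear := by
    rw [funext fun x => connesOp_apply (n := n) (g := g) (x := x)]
    exact .sum fun j hj => (hg.comp_consOne.comp_rotate (Finset.mem_range.1 hj).le).zsmul _
  eq_zero_of_eq_one x k hk _ hx := by
    rw [connesOp_apply]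
    refine Finset.sum_eq_zero fun j hj => ?_
    have hzero : g (consOne (rotate n j x)) = 0 :=
      hg.apply_consOne_rotate_eq_zero (w := id) (fun y l hl hy => ⟨l, hl, .inl hy⟩)
        (Finset.mem_range.1 hj).le hk hx
    rw [hzero, smul_zero]

theorem contractOne (hg : IsCochain S n g) {D : U → U} (hD : IsLinearMap S D) (hD1 : D 1 = 0) :
    IsCochain S (n + 1) (contractOne M D g) where
  toIsWordMultilinear := (hg.comp_mergeAt_mul n.zero_le).comp_applyAt hD 1
  eq_zero_of_eq_one x k hk hk0 hx := by
    obtain rfl | hk1 : k = 1 ∨ 1 < k := by omega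
    · refine hg.eq_zero_of_eq_zero n.zero_le ?_
      simp [mergeAt, applyAt, hx, hD1]
    · refine hg.eq_zero_of_eq_one _ (k - 1) (by omega) (by omega) ?_
      simp only [mergeAt, applyAt, Function.update_apply]; grind

theorem cyclicOne (hg : IsCochain S (n + 1) g) {D : U → U} (hD : IsLinearMap S D) (hD1 : D 1 = 0) :
    IsCochain S n (cyclicOne M D n g) where
  toIsWordMultilinear := by
    rw [funext fun x => cyclicOne_apply (D := D) (n := n) (g := g) (x := x)]
    exact .sum fun j hj => .sum fun p _ =>
      ((hg.comp_consOne.comp_applyAt hD p).comp_rotate (Finset.mem_range.1 hj).le).zsmul _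
  eq_zero_of_eq_one x k hk _ hx := by
    rw [cyclicOne_apply]
    refine Finset.sum_eq_zero fun j hj => Finset.sum_eq_zero fun p _ => ?_
    rw [hg.apply_consOne_rotate_eq_zero (w := applyAt D p) (fun y l hl hy => ⟨l, hl, ?_⟩)
      (Finset.mem_range.1 hj).le hk hx, smul_zero]
    simp only [applyAt, Function.update_apply]; grind

variable {E : U → U → U}

theorem contractTwo (hg : IsCochain S n g) (hleft : ∀ v, IsLinearMap S fun u => E u v)
    (hright : ∀ u, IsLinearMap S (E u)) (hE1 : ∀ u, E 1 u = 0) (h1E : ∀ u, E u 1 = 0) :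
    IsCochain S (n + 2) (contractTwo M E g) where
  toIsWordMultilinear := by
    have h := ((hg.comp_mergeAt_mul n.zero_le).comp_mergeAt hleft hright
      (show 1 ≤ n + 1 by omega)).zsmul (-1)
    simp only [neg_smul, one_smul] at h
    exact h
  eq_zero_of_eq_one x k hk hk0 hx := by
    rw [contractTwo_apply, neg_eq_zero]
    obtain rfl | rfl | hk2 : k = 1 ∨ k = 2 ∨ 2 < k := by omega
    · refine hg.eq_zero_of_eq_zero n.zero_le ?_
      simp [mergeAt, hx, hE1]
    · refine hg.eq_zero_of_eq_zero n.zero_le ?_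
      simp [mergeAt, hx, h1E]
    · refine hg.eq_zero_of_eq_one _ (k - 2) (by omega) (by omega) ?_
      simp only [mergeAt]; grind

theorem cyclicTwo (hg : IsCochain S n g) (hleft : ∀ v, IsLinearMap S fun u => E u v)
    (hright : ∀ u, IsLinearMap S (E u)) (hE1 : ∀ u, E 1 u = 0) (h1E : ∀ u, E u 1 = 0) :
    IsCochain S n (cyclicTwo M E n g) where
  toIsWordMultilinear := by
    rw [funext fun x => cyclicTwo_apply (E := E) (n := n) (g := g) (x := x)]
    refine .sum fun j hj => .sum fun m hm => .zsmul ?_ _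
    rw [Finset.mem_range] at hj
    rw [Finset.mem_Ico] at hm
    obtain ⟨n, rfl⟩ : ∃ l, n = l + 1 := ⟨n - 1, by omega⟩
    exact (hg.comp_consOne.comp_mergeAt hleft hright (by omega)).comp_rotate (by omega)
  eq_zero_of_eq_one x k hk _ hx := by
    rw [cyclicTwo_apply]
    refine Finset.sum_eq_zero fun j hj => Finset.sum_eq_zero fun m hm => ?_
    rw [Finset.mem_range] at hj
    rw [Finset.mem_Ico] at hm
    obtain ⟨n, rfl⟩ : ∃ l, n = l + 1 := ⟨n - 1, by omega⟩
    rw [hg.apply_consOne_rotate_eq_zero (w := mergeAt E m) (fun y l hl hy => ?_) (by omega) hk hx,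
      smul_zero]
    refine ⟨if l < m then l else if l ≤ m + 1 then m else l - 1, by split_ifs <;> omega, ?_⟩
    simp only [mergeAt]; grind

end IsCochain

section Normalized

variable {x : ℕ → U}

theorem connesOp_apply_consOne (hg : IsCochain S (n + 2) g) :
    connesOp M (n + 1) g (consOne x) = 0 := by
  rw [connesOp_apply]
  refine Finset.sum_eq_zero fun j hj => ?_
  have hone : rotate (n + 1) j (consOne x) j = 1 := by simp [rotate, consOne]
  rw [hg.apply_consOne_eq_zero (Nat.lt_succ_iff.1 (Finset.mem_range.1 hj)) (.inl hone), smul_zero]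

theorem connesOp_connesOp (hg : IsCochain S (n + 2) g) :
    connesOp M n (connesOp M (n + 1) g) = 0 := by
  funext x
  simp [connesOp_apply (g := connesOp M (n + 1) g), connesOp_apply_consOne hg]

theorem cyclicOne_connesOp (hg : IsCochain S (n + 2) g) (D : U → U) :
    cyclicOne M D n (connesOp M (n + 1) g) = 0 := by
  funext x
  simp [cyclicOne_apply, connesOp_apply_consOne hg]

theorem connesOp_cyclicOne (hg : IsCochain S (n + 2) g) (D : U → U) :
    connesOp M n (cyclicOne M D (n + 1) g) = 0 := by
  funext x
  have hzero (y : ℕ → U) : cyclicOne M D (n + 1) g (consOne y) = 0 := by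
    rw [cyclicOne_apply]
    refine Finset.sum_eq_zero fun j hj => Finset.sum_eq_zero fun p hp => ?_
    have hjp := (Finset.mem_Ico.1 hp).1
    have hone : applyAt D p (rotate (n + 1) j (consOne y)) j = 1 := by
      rw [applyAt, Function.update_of_ne (by omega)]
      simp [rotate, consOne]
    rw [hg.apply_consOne_eq_zero (Nat.lt_succ_iff.1 (Finset.mem_range.1 hj)) (.inl hone), smul_zero]
  simp [connesOp_apply, hzero]

end Normalized

end Cochains

end Multilinear

section Total

variable (M) in
/-- The operator `b + B`, acting by transposition on sequences of functions of words whose `n`-th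
entry is evaluated at words of length `n + 1`. -/
def totalBoundary [Mul U] [One U] : (ℕ → (ℕ → U) → M) →ₗ[ℤ] (ℕ → (ℕ → U) → M) :=
  LinearMap.pi fun
    | 0 => connesOp M 0 ∘ₗ .proj 1
    | n + 1 => hochschildOp M n ∘ₗ .proj n + connesOp M (n + 1) ∘ₗ .proj (n + 2)

variable (M) in
/-- The Lie derivative along `D`, acting by transposition on sequences of functions of words. -/
def totalLie (D : U → U) : (ℕ → (ℕ → U) → M) →ₗ[ℤ] (ℕ → (ℕ → U) → M) :=
  LinearMap.pi fun n => lieOp M D n ∘ₗ .proj n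

variable (M) in
/-- The contraction `I_D` with a `1`-cochain, acting by transposition on sequences of functions of
words. -/
def totalContractOne [Mul U] [One U] (D : U → U) :
    (ℕ → (ℕ → U) → M) →ₗ[ℤ] (ℕ → (ℕ → U) → M) :=
  LinearMap.pi fun
    | 0 => cyclicOne M D 0 ∘ₗ .proj 1
    | n + 1 => contractOne M D ∘ₗ .proj n + cyclicOne M D (n + 1) ∘ₗ .proj (n + 2)

variable (M) in
/-- The contraction `I_E = ι_E + S_E` with a `2`-cochain, acting by transposition on sequences of
functions of words. -/
def totalContractTwo [Mul U] [One U] (E : U → U → U) :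
    (ℕ → (ℕ → U) → M) →ₗ[ℤ] (ℕ → (ℕ → U) → M) :=
  LinearMap.pi fun
    | 0 => cyclicTwo M E 0 ∘ₗ .proj 0
    | 1 => cyclicTwo M E 1 ∘ₗ .proj 1
    | n + 2 => contractTwo M E ∘ₗ .proj n + cyclicTwo M E (n + 2) ∘ₗ .proj (n + 2)

variable (M) in
/-- The Gauss–Manin operator `L_D - I_{δD}`, acting by transposition on sequences of functions of
words. -/
def totalGaussManin [Ring U] (D : U → U) : (ℕ → (ℕ → U) → M) →ₗ[ℤ] (ℕ → (ℕ → U) → M) :=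
  totalLie M D - totalContractTwo M (coboundary D)

variable {S : Type*} [CommRing S] [Ring U] [Algebra S U] [Module S M] {G : ℕ → (ℕ → U) → M}
  {n : ℕ} {g : (ℕ → U) → M}

theorem IsCochain.totalBoundary (hG : ∀ n, IsCochain S n (G n)) :
    ∀ n, IsCochain S n (totalBoundary M G n)
  | 0 => (hG 1).connesOp
  | n + 1 => (hG n).hochschildOp.add (hG (n + 2)).connesOp

theorem IsCochain.totalContractOne (hG : ∀ n, IsCochain S n (G n)) {D : U → U}
    (hD : IsLinearMap S D) (hD1 : D 1 = 0) : ∀ n, IsCochain S n (totalContractOne M D G n)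
  | 0 => (hG 1).cyclicOne hD hD1
  | n + 1 => ((hG n).contractOne hD hD1).add ((hG (n + 2)).cyclicOne hD hD1)

theorem totalBoundary_totalBoundary (hG : ∀ n, IsCochain S n (G n)) :
    totalBoundary M (totalBoundary M G) = 0 := by
  funext n
  match n with
  | 0 =>
    change connesOp M 0 (hochschildOp M 0 (G 0) + connesOp M 1 (G 2)) = 0
    rw [map_add, connesOp_hochschildOp_zero (hG 0).isLocal, connesOp_connesOp (hG 2), add_zero]
  | 1 =>
    change hochschildOp M 0 (connesOp M 0 (G 1)) +
      connesOp M 1 (hochschildOp M 1 (G 1) + connesOp M 2 (G 3)) = 0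
    rw [map_add, connesOp_connesOp (hG 3), add_zero, add_comm,
      connesOp_hochschildOp_add (hG 1).isLocal]
  | n + 2 =>
    change hochschildOp M (n + 1) (hochschildOp M n (G n) + connesOp M (n + 1) (G (n + 2))) +
      connesOp M (n + 2) (hochschildOp M (n + 2) (G (n + 2)) + connesOp M (n + 3) (G (n + 4))) = 0
    have hBB : connesOp M (n + 2) (connesOp M (n + 3) (G (n + 4))) = 0 :=
      connesOp_connesOp (hG (n + 4))
    rw [map_add, map_add, hochschildOp_hochschildOp (hG n).isLocal, hBB,
      zero_add, add_zero, add_comm, connesOp_hochschildOp_add (hG (n + 2)).isLocal]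

/-- Cartan's homotopy formula. -/
theorem totalBoundary_totalContractOne_add (hG : ∀ n, IsCochain S n (G n)) (D : U → U) :
    totalBoundary M (totalContractOne M D G) + totalContractOne M D (totalBoundary M G) =
      totalGaussManin M D G := by
  funext n
  match n with
  | 0 =>
    change connesOp M 0 (contractOne M D (G 0) + cyclicOne M D 1 (G 2)) +
      cyclicOne M D 0 (hochschildOp M 0 (G 0) + connesOp M 1 (G 2)) = lieOp M D 0 (G 0) - 0
    have hSb : cyclicOne M D 0 (hochschildOp M 0 (G 0)) = 0 := by funext x; simp [cyclicOne_apply]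
    rw [map_add, map_add, connesOp_contractOne_zero (hG 0).isLocal, connesOp_cyclicOne (hG 2),
      cyclicOne_connesOp (hG 2), hSb, add_zero, add_zero, add_zero, sub_zero]
  | 1 =>
    change hochschildOp M 0 (cyclicOne M D 0 (G 1)) +
        connesOp M 1 (contractOne M D (G 1) + cyclicOne M D 2 (G 3)) +
      (contractOne M D (connesOp M 0 (G 1)) +
        cyclicOne M D 1 (hochschildOp M 1 (G 1) + connesOp M 2 (G 3))) =
      lieOp M D 1 (G 1) - cyclicTwo M (coboundary D) 1 (G 1)
    rw [← cyclicOne_hochschildOp_add_add (hG 1).toIsWordMultilinear, map_add, map_add,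
      connesOp_cyclicOne (hG 3), cyclicOne_connesOp (hG 3)]
    abel
  | n + 2 =>
    change hochschildOp M (n + 1) (contractOne M D (G n) + cyclicOne M D (n + 1) (G (n + 2))) +
        connesOp M (n + 2) (contractOne M D (G (n + 2)) + cyclicOne M D (n + 3) (G (n + 4))) +
      (contractOne M D (hochschildOp M n (G n) + connesOp M (n + 1) (G (n + 2))) +
        cyclicOne M D (n + 2) (hochschildOp M (n + 2) (G (n + 2)) +
          connesOp M (n + 3) (G (n + 4)))) =
      lieOp M D (n + 2) (G (n + 2)) - (contractTwo M (coboundary D) (G n) +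
        cyclicTwo M (coboundary D) (n + 2) (G (n + 2)))
    rw [sub_add_eq_sub_sub_swap,
      ← cyclicOne_hochschildOp_add_add (hG (n + 2)).toIsWordMultilinear, sub_eq_add_neg,
      ← contractOne_hochschildOp_add (hG n).toIsWordMultilinear]
    have hBS : connesOp M (n + 2) (cyclicOne M D (n + 3) (G (n + 4))) = 0 :=
      connesOp_cyclicOne (hG (n + 4)) D
    have hSB : cyclicOne M D (n + 2) (connesOp M (n + 3) (G (n + 4))) = 0 :=
      cyclicOne_connesOp (hG (n + 4)) D
    simp only [map_add, hBS, hSB]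
    abel!

theorem totalGaussManin_totalBoundary (hG : ∀ n, IsCochain S n (G n)) {D : U → U}
    (hD : IsLinearMap S D) (hD1 : D 1 = 0) :
    totalGaussManin M D (totalBoundary M G) = totalBoundary M (totalGaussManin M D G) := by
  rw [← totalBoundary_totalContractOne_add hG, map_add,
    totalBoundary_totalBoundary (IsCochain.totalContractOne hG hD hD1), zero_add,
    ← totalBoundary_totalContractOne_add (IsCochain.totalBoundary hG),
    totalBoundary_totalBoundary hG, map_zero, add_zero]

theorem applyAt_sub_eq (hg : IsWordMultilinear S n g) {p : ℕ} (hp : p ≤ n) (D₁ D₂ : U → U)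
    (x : ℕ → U) : g (applyAt (D₁ - D₂) p x) = g (applyAt D₁ p x) - g (applyAt D₂ p x) :=
  (hg.isLinearMap p hp x).map_sub _ _

theorem cyclicOne_sub (hg : IsWordMultilinear S (n + 1) g) (D₁ D₂ : U → U) :
    cyclicOne M (D₁ - D₂) n g = cyclicOne M D₁ n g - cyclicOne M D₂ n g := by
  funext x
  simp only [Pi.sub_apply, cyclicOne_apply, ← Finset.sum_sub_distrib, ← smul_sub]
  refine Finset.sum_congr rfl fun j _ => Finset.sum_congr rfl fun p hp => congrArg _ ?_
  exact applyAt_sub_eq hg.comp_consOne (Nat.lt_succ_iff.1 (Finset.mem_Ico.1 hp).2) D₁ D₂ _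

theorem totalContractOne_sub (hG : ∀ n, IsWordMultilinear S n (G n)) (D₁ D₂ : U → U) :
    totalContractOne M (D₁ - D₂) G = totalContractOne M D₁ G - totalContractOne M D₂ G := by
  funext n
  match n with
  | 0 => exact cyclicOne_sub (hG 1) D₁ D₂
  | n + 1 =>
    have hcontract : contractOne M (D₁ - D₂) (G n) =
        contractOne M D₁ (G n) - contractOne M D₂ (G n) := funext fun x =>
      applyAt_sub_eq ((hG n).comp_mergeAt_mul n.zero_le) (by omega) D₁ D₂ x
    change contractOne M (D₁ - D₂) (G n) + cyclicOne M (D₁ - D₂) (n + 1) (G (n + 2)) =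
      contractOne M D₁ (G n) + cyclicOne M D₁ (n + 1) (G (n + 2)) -
        (contractOne M D₂ (G n) + cyclicOne M D₂ (n + 1) (G (n + 2)))
    rw [hcontract, cyclicOne_sub (hG (n + 2))]
    abel

theorem totalGaussManin_sub (hG : ∀ n, IsCochain S n (G n)) (D₁ D₂ : U → U) :
    totalGaussManin M D₁ G - totalGaussManin M D₂ G =
      totalBoundary M (totalContractOne M (D₁ - D₂) G) +
        totalContractOne M (D₁ - D₂) (totalBoundary M G) := by
  rw [totalContractOne_sub fun n => (hG n).toIsWordMultilinear, totalContractOne_sub fun n =>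
    (IsCochain.totalBoundary hG n).toIsWordMultilinear, map_sub,
    ← totalBoundary_totalContractOne_add hG, ← totalBoundary_totalContractOne_add hG]
  abel

end Total

section Naturality

variable {N : Type*} [AddCommGroup N] (f : M →+ N)

section Operators

variable (g : (ℕ → U) → M) (n : ℕ) (x : ℕ → U)

theorem map_lieOp (D : U → U) : f (lieOp M D n g x) = lieOp N D n (fun y => f (g y)) x := by
  simp only [lieOp_apply, map_sum]

theorem map_hochschildOp [Mul U] :
    f (hochschildOp M n g x) = hochschildOp N n (fun y => f (g y)) x := by
  simp only [hochschildOp_apply, map_sum, map_zsmul]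

theorem map_contractOne [Mul U] (D : U → U) :
    f (contractOne M D g x) = contractOne N D (fun y => f (g y)) x := by
  simp only [contractOne_apply]

theorem map_contractTwo [Mul U] (E : U → U → U) :
    f (contractTwo M E g x) = contractTwo N E (fun y => f (g y)) x := by
  simp only [contractTwo_apply, map_neg]

variable [One U]

theorem map_connesOp : f (connesOp M n g x) = connesOp N n (fun y => f (g y)) x := by
  simp only [connesOp_apply, map_sum, map_zsmul]

theorem map_cyclicOne (D : U → U) :
    f (cyclicOne M D n g x) = cyclicOne N D n (fun y => f (g y)) x := by
  simp only [cyclicOne_apply, map_sum, map_zsmul]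

theorem map_cyclicTwo (E : U → U → U) :
    f (cyclicTwo M E n g x) = cyclicTwo N E n (fun y => f (g y)) x := by
  simp only [cyclicTwo_apply, map_sum, map_zsmul]

end Operators

variable [Ring U] (D : U → U) (G : ℕ → (ℕ → U) → M) (x : ℕ → U)

theorem map_totalBoundary :
    ∀ n, f (totalBoundary M G n x) = totalBoundary N (fun n y => f (G n y)) n x
  | 0 => map_connesOp f (G 1) 0 x
  | _ + 1 => (map_add f _ _).trans
      (congrArg₂ (· + ·) (map_hochschildOp f _ _ x) (map_connesOp f _ _ x))

theorem map_totalContractOne :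
    ∀ n, f (totalContractOne M D G n x) = totalContractOne N D (fun n y => f (G n y)) n x
  | 0 => map_cyclicOne f (G 1) 0 x D
  | _ + 1 => (map_add f _ _).trans
      (congrArg₂ (· + ·) (map_contractOne f _ x D) (map_cyclicOne f _ _ x D))

theorem map_totalContractTwo (E : U → U → U) :
    ∀ n, f (totalContractTwo M E G n x) = totalContractTwo N E (fun n y => f (G n y)) n x
  | 0 => map_cyclicTwo f (G 0) 0 x E
  | 1 => map_cyclicTwo f (G 1) 1 x E
  | _ + 2 => (map_add f _ _).trans
      (congrArg₂ (· + ·) (map_contractTwo f _ x E) (map_cyclicTwo f _ _ x E))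

theorem map_totalGaussManin (n : ℕ) :
    f (totalGaussManin M D G n x) = totalGaussManin N D (fun n y => f (G n y)) n x :=
  (map_sub f _ _).trans
    (congrArg₂ (· - ·) (map_lieOp f _ _ x D) (map_totalContractTwo f G x _ n))

end Naturality

end Operators

section Extension

section Seminorms

variable {M : Type*} [AddCommGroup M] [Module ℂ M]

theorem exists_seminorm_ball_subset [TopologicalSpace M] [PolynormableSpace ℂ M] {V : Set M}
    (hV : V ∈ 𝓝 0) : ∃ p : Seminorm ℂ M, Continuous p ∧ ∃ r > 0, p.ball 0 r ⊆ V := by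
  have hM := PolynormableSpace.withSeminorms ℂ M
  obtain ⟨⟨s, r⟩, hr, hsV⟩ := hM.hasBasis_zero_ball.mem_iff.1 hV
  exact ⟨_, hM.finset_sups.continuous_seminorm s, r, hr, hsV⟩

theorem polynormableSpace_of_exists_seminorm [TopologicalSpace M] [IsTopologicalAddGroup M]
    (h : ∀ V ∈ 𝓝 (0 : M), ∃ p : Seminorm ℂ M, Continuous p ∧ ∃ r > 0, p.ball 0 r ⊆ V) :
    PolynormableSpace ℂ M where
  withSeminorms' := by
    rw [SeminormFamily.withSeminorms_iff_nhds_eq_iInf]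
    refine le_antisymm (le_iInf fun p => ?_) fun V hV => ?_
    · rw [← tendsto_iff_comap, ← map_zero p.1]
      exact p.2.tendsto 0
    · obtain ⟨p, hp, r, hr, hpV⟩ := h V hV
      refine mem_iInf_of_mem ⟨p, hp⟩ ⟨Metric.ball 0 r, Metric.ball_mem_nhds 0 hr, fun x hx => ?_⟩
      refine hpV (p.mem_ball_zero.2 ?_)
      simpa [abs_of_nonneg (apply_nonneg p x)] using hx

variable [UniformSpace M] [IsUniformAddGroup M] [UniformContinuousConstSMul ℂ M]

open UniformSpace in
theorem exists_seminorm_completion {p : Seminorm ℂ M} (hp : UniformContinuous p) :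
    ∃ q : Seminorm ℂ (Completion M), Continuous q ∧ ∀ x : M, q x = p x := by
  have hq : Continuous (Completion.extension p) := Completion.continuous_extension
  have hqp : ∀ x : M, Completion.extension p x = p x := Completion.extension_coe hp
  refine ⟨Seminorm.of (Completion.extension p) (fun x y => ?_) fun c x => ?_, hq, hqp⟩
  · refine Completion.induction_on₂ x y (isClosed_le (by fun_prop) (by fun_prop)) fun a b => ?_
    rw [← Completion.coe_add, hqp, hqp, hqp]
    exact map_add_le_add p a b
  · refine Completion.induction_on x
      (isClosed_eq (hq.comp (continuous_const_smul c)) (by fun_prop)) fun a => ?_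
    rw [← Completion.coe_smul, hqp, hqp]
    exact map_smul_eq_mul p c a

open UniformSpace in
instance polynormableSpace_completion [PolynormableSpace ℂ M] :
    PolynormableSpace ℂ (Completion M) := by
  refine polynormableSpace_of_exists_seminorm fun V hV => ?_
  obtain ⟨W, hW, hWc, hWV⟩ := exists_mem_nhds_isClosed_subset hV
  obtain ⟨p, hp, r, hr, hpW⟩ := exists_seminorm_ball_subset
    ((Completion.continuous_coe M).continuousAt.preimage_mem_nhds
      (by rwa [Completion.coe_zero]) : ((↑) : M → Completion M) ⁻¹' W ∈ 𝓝 0)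
  obtain ⟨q, hq, hqp⟩ := exists_seminorm_completion
    (Seminorm.uniformContinuous_of_continuousAt_zero hp.continuousAt)
  refine ⟨q, hq, r, hr, fun x hx => hWV (hWc.closure_subset_iff.2 ?_
    (Completion.denseRange_coe.open_subset_closure_inter
      (isOpen_lt hq continuous_const) (q.mem_ball_zero.1 hx)))⟩
  rintro _ ⟨hx, a, rfl⟩
  exact hpW (p.mem_ball_zero.2 ((hqp a).symm.trans_lt hx))

end Seminorms

variable {R : Type} {A : Type*} [CommRing R] [NonUnitalRing A]

namespace PreChain

variable {n : ℕ}

/-- The word `(a₀, a₁, …, aₙ, 0, 0, …)` of the elementary tensor `a₀ ⊗ a₁ ⊗ ⋯ ⊗ aₙ`. -/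
def toWord (s : Unitization R A × (Fin n → A)) : ℕ → Unitization R A :=
  fun i => if i = 0 then s.1 else if h : i - 1 < n then (s.2 ⟨i - 1, h⟩ : Unitization R A) else 0

theorem toWord_zero (s : Unitization R A × (Fin n → A)) : toWord s 0 = s.1 := rfl

theorem toWord_succ (s : Unitization R A × (Fin n → A)) (i : Fin n) :
    toWord s (i + 1) = (s.2 i : Unitization R A) := by
  simp [toWord]

theorem update_toWord_zero (u w : Unitization R A) (v : Fin n → A) :
    Function.update (toWord (u, v)) 0 w = toWord (w, v) := by
  funext i
  simp only [toWord, Function.update_apply]; split_ifs <;> rfl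

theorem update_toWord_succ (u : Unitization R A) (v : Fin n → A) (i : Fin n) (a : A) :
    Function.update (toWord (u, v)) (i + 1) (a : Unitization R A) =
      toWord (u, Function.update v i a) := by
  funext k
  simp only [toWord, Function.update_apply]
  by_cases hk : k = 0
  · simp [hk]
  · have : k - 1 = (i : ℕ) ↔ k = i + 1 := by omega
    simp only [hk, if_false, Fin.ext_iff, this]
    split_ifs <;> first | rfl | omega

variable [Module R A]

theorem tensor_induction {P : PreChain R A n → Prop} (zero : P 0)
    (tensor : ∀ s, P (tensor s)) (add : ∀ a b, P a → P b → P (a + b)) (z : PreChain R A n) :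
    P z := by
  refine TensorProduct.induction_on (motive := P) z zero (fun u t => ?_) add
  induction t using PiTensorProduct.induction_on with
  | smul_tprod r v =>
    rw [← TensorProduct.smul_tmul]
    exact tensor (r • u, v)
  | add a b iha ihb => rw [TensorProduct.tmul_add]; exact add _ _ iha ihb

section Lift

variable [IsScalarTower R A A] [SMulCommClass R A A] {S M : Type*} [CommRing S] [AddCommGroup M]
  [Module S M] [Algebra S (Unitization R A)] {φ : (ℕ → Unitization R A) → M}

theorem isLinearMap_toWord (hφ : IsWordMultilinear S n φ)
    (v : Fin n → A) : IsLinearMap S fun u => φ (toWord (u, v)) := by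
  simpa only [update_toWord_zero] using hφ.isLinearMap 0 n.zero_le (toWord (0, v))

theorem exists_addMonoidHom_piTensor (hφ : IsWordMultilinear S n φ)
    (hbal : ∀ k ≤ n, ∀ (x : ℕ → Unitization R A) (r : R),
      φ (Function.update x k (r • x k)) = φ (Function.update x 0 (r • x 0)))
    (u : Unitization R A) :
    ∃ F : (⨂[R] _ : Fin n, A) →+ M, ∀ (r : R) (v : Fin n → A),
      F (PiTensorProduct.tprodCoeff R r v) = φ (toWord (r • u, v)) := by
  have hzero (v : Fin n → A) := (isLinearMap_toWord hφ v).map_zero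
  have hadd (v : Fin n → A) := (isLinearMap_toWord hφ v).map_add
  refine ⟨PiTensorProduct.liftAddHom (fun p : R × (Fin n → A) => φ (toWord (p.1 • u, p.2)))
    (fun r v i hv => ?_) (fun v => by simp only [zero_smul, hzero])
    (fun {inst} r v i a b => ?_) (fun r r' v => by simp only [add_smul, hadd])
    (fun {inst} r v i r' => ?_), fun r v => rfl⟩
  · refine hφ.eq_zero_of_eq_zero (Nat.succ_le_of_lt i.2) ?_
    exact (toWord_succ _ i).trans (by simp only [hv, Unitization.inr_zero])
  · obtain rfl : inst = instDecidableEqFin n := Subsingleton.elim _ _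
    simp only [← update_toWord_succ, Unitization.inr_add]
    exact ((hφ.isLinearMap _ (Nat.succ_le_of_lt i.2) _).map_add _ _).symm
  · obtain rfl : inst = instDecidableEqFin n := Subsingleton.elim _ _
    have := hbal (i + 1) (Nat.succ_le_of_lt i.2) (toWord (r • u, v)) r'
    rw [toWord_succ, toWord_zero, update_toWord_zero, smul_smul] at this
    simpa only [← update_toWord_succ, Unitization.inr_smul] using this

theorem exists_addMonoidHom (hφ : IsWordMultilinear S n φ)
    (hbal : ∀ k ≤ n, ∀ (x : ℕ → Unitization R A) (r : R),
      φ (Function.update x k (r • x k)) = φ (Function.update x 0 (r • x 0))) :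
    ∃ T : PreChain R A n →+ M, ∀ s, T (tensor s) = φ (toWord s) := by
  choose F hF using exists_addMonoidHom_piTensor hφ hbal
  have hadd (v : Fin n → A) := (isLinearMap_toWord hφ v).map_add
  let G : Unitization R A →+ (⨂[R] _ : Fin n, A) →+ M := AddMonoidHom.mk' F fun u w => by
    ext t
    induction t using PiTensorProduct.induction_on' with
    | tprodCoeff r v => rw [AddMonoidHom.add_apply, hF, hF, hF, smul_add, hadd]
    | add a b ha hb => rw [map_add, map_add, ha, hb]
  have hG (r : R) (u : Unitization R A) (t : ⨂[R] _ : Fin n, A) : G (r • u) t = G u (r • t) := by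
    induction t using PiTensorProduct.induction_on' with
    | tprodCoeff r' v =>
      rw [PiTensorProduct.smul_tprodCoeff']
      change F (r • u) _ = F u _
      rw [hF, hF, smul_smul, smul_eq_mul, mul_comm]
    | add a b ha hb => rw [smul_add, map_add, map_add, ha, hb]
  refine ⟨TensorProduct.liftAddHom G hG, fun s => ?_⟩
  change F s.1 (PiTensorProduct.tprodCoeff R 1 s.2) = _
  rw [hF, one_smul]

end Lift

variable [Algebra ℂ R] [Module ℂ A] [IsScalarTower ℂ R A] [TopologicalSpace R]
  [TopologicalSpace A]

theorem withSeminorms : WithSeminorms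
    (fun p : {p : Seminorm ℂ (PreChain R A n) // IsProjective p} => p.1) :=
  (SeminormFamily.withSeminorms_iff_uniformSpace_eq_iInf _).2 rfl

instance : PolynormableSpace ℂ (PreChain R A n) := withSeminorms.toPolynormableSpace

theorem continuous_tensor : Continuous (tensor : Unitization R A × (Fin n → A) → PreChain R A n) :=
  continuous_iff_continuousAt.2 fun s =>
    (withSeminorms.tendsto_nhds _ _).2 fun p _ hε => (p.2 s).eventually_lt_const hε

theorem continuous_of_tensor {M : Type*} [AddCommGroup M] [Module ℂ M] [TopologicalSpace M]
    [PolynormableSpace ℂ M] {T : PreChain R A n →ₗ[ℂ] M} (hT : Continuous fun s => T (tensor s)) :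
    Continuous T := by
  have hM := PolynormableSpace.withSeminorms ℂ M
  have := hM.topologicalAddGroup
  refine hM.continuous_of_continuous_comp T fun p => ?_
  have hp : IsProjective (p.1.comp T) := fun s => by
    have h : Continuous fun u => p.1 (T (tensor u) - T (tensor s)) :=
      p.2.comp (hT.sub continuous_const)
    simpa using h.tendsto s
  exact withSeminorms.continuous_seminorm ⟨_, hp⟩

end PreChain

end Extension

section BalancedCochains

variable {R : Type} {A : Type*} [CommRing R] [NonUnitalRing A] [Module R A]
  [IsScalarTower R A A] [SMulCommClass R A A]

theorem apply_eq_of_snd_eq {S M : Type*} [CommRing S] [Algebra S (Unitization R A)]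
    [AddCommGroup M] [Module S M] {n : ℕ} {φ : (ℕ → Unitization R A) → M}
    (hφ : IsWordMultilinear S n φ)
    (hzero : ∀ x k, k ≤ n → (k = 0 → n = 0) → (x k).snd = 0 → φ x = 0) {x y : ℕ → Unitization R A}
    (h0 : n ≠ 0 → x 0 = y 0) (h : ∀ i ≤ n, (x i).snd = (y i).snd) : φ x = φ y := by
  have hmix (m : ℕ) (hm : m ≤ n + 1) : φ (fun i => if i < m then y i else x i) = φ x := by
    induction m with
    | zero => simp
    | succ m ih =>
      rw [← ih (by omega)]
      set z : ℕ → Unitization R A := fun i => if i < m then y i else x i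
      have hz : (fun i => if i < m + 1 then y i else x i) = Function.update z m (y m) := by
        funext i
        simp only [z, Function.update_apply]; grind
      rw [hz]
      by_cases hmn : m = 0 ∧ n ≠ 0
      · rw [Function.update_eq_self_iff.2]
        simp [z, hmn.1, h0 hmn.2]
      · have hsub := (hφ.isLinearMap m (by omega) z).map_sub (y m) (z m)
        rw [Function.update_eq_self, hzero _ m (by omega) (by omega)] at hsub
        · exact (sub_eq_zero.1 hsub.symm)
        · simp [z, h m (by omega), sub_eq_add_neg]
  rw [← hmix (n + 1) le_rfl]
  exact hφ.isLocal fun i hi => if_pos (Nat.lt_succ_of_le hi)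

namespace IsCochain

variable {M : Type*} [AddCommGroup M] [Module R M] {n : ℕ} {φ : (ℕ → Unitization R A) → M}

theorem eq_zero_of_snd_eq_zero (hφ : IsCochain R n φ) (x : ℕ → Unitization R A) (k : ℕ)
    (hk : k ≤ n) (hkn : k = 0 → n = 0) (hx : (x k).snd = 0) : φ x = 0 := by
  have hxk : x k = (x k).fst • 1 := by ext <;> simp [hx]
  rw [← Function.update_eq_self k x, hxk, (hφ.isLinearMap k hk x).map_smul,
    hφ.eq_zero_of_eq_one _ k hk hkn (Function.update_self ..), smul_zero]

end IsCochain

variable [Algebra ℂ R] [Module ℂ A] [IsScalarTower ℂ R A]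

/-- The function `φ` of words induces a `ℂ`-linear map on `A₊ ⊗ A ⊗ ⋯ ⊗ A` with `n` factors `A`, or
on `A` if `n = 0`: it is `ℂ`-multilinear, scalars in `R` move freely between the letters, and only
the letter `0` may see the unit of `A₊`. -/
structure IsBalancedCochain {M : Type*} [AddCommGroup M] [Module ℂ M] (n : ℕ)
    (φ : (ℕ → Unitization R A) → M) : Prop extends IsWordMultilinear ℂ n φ where
  balanced : ∀ k ≤ n, ∀ (x : ℕ → Unitization R A) (r : R),
    φ (Function.update x k (r • x k)) = φ (Function.update x 0 (r • x 0))
  eq_zero_of_snd_eq_zero : ∀ x k, k ≤ n → (k = 0 → n = 0) → (x k).snd = 0 → φ x = 0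

namespace IsCochain

variable {M : Type*} [AddCommGroup M] [Module R M] [Module ℂ M] [IsScalarTower ℂ R M] {n : ℕ}
  {φ : (ℕ → Unitization R A) → M}

theorem complex (hφ : IsCochain R n φ) : IsCochain ℂ n φ where
  isLocal := hφ.isLocal
  isLinearMap k hk x :=
    ((hφ.isLinearMap k hk x).mk' _ |>.restrictScalars ℂ).isLinear
  eq_zero_of_eq_one := hφ.eq_zero_of_eq_one

theorem isBalancedCochain (hφ : IsCochain R n φ) :
    IsBalancedCochain n φ where
  toIsWordMultilinear := hφ.complex.toIsWordMultilinear
  balanced k hk x r := by rw [hφ.apply_update_smul hk, hφ.apply_update_smul n.zero_le]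
  eq_zero_of_snd_eq_zero := hφ.eq_zero_of_snd_eq_zero

end IsCochain

end BalancedCochains

section ElementaryChains

theorem continuous_unitization_iff {R : Type} {A W : Type*} [TopologicalSpace R]
    [TopologicalSpace A] [TopologicalSpace W] {f : W → Unitization R A} :
    Continuous f ↔ (Continuous fun w => (f w).fst) ∧ Continuous fun w => (f w).snd :=
  continuous_induced_rng.trans continuous_prodMk

variable {R : Type} {A : Type*} [CommRing R] [NonUnitalRing A] [TopologicalSpace R]
  [TopologicalSpace A]

theorem PreChain.continuous_toWord {n : ℕ} :
    Continuous (toWord : Unitization R A × (Fin n → A) → ℕ → Unitization R A) := by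
  have hcoe : Continuous fun a : A => (a : Unitization R A) :=
    continuous_unitization_iff.2 ⟨continuous_const, continuous_id⟩
  refine continuous_pi fun i => ?_
  unfold toWord
  split_ifs <;> fun_prop

variable [Module R A] [Algebra ℂ R] [Module ℂ A] [IsScalarTower ℂ R A]

namespace Chain

open UniformSpace

variable {n : ℕ}

theorem elem_congr {x y : ℕ → Unitization R A} (h0 : n ≠ 0 → x 0 = y 0)
    (h : ∀ i ≤ n, (x i).snd = (y i).snd) : elem n x = elem n y := by
  cases n with
  | zero => exact h 0 le_rfl
  | succ n =>
    have hs : (fun i : Fin (n + 1) => (x (i + 1)).snd) = fun i : Fin (n + 1) => (y (i + 1)).snd :=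
      funext fun i => h (i + 1) (by omega)
    rw [elem, elem, h0 n.succ_ne_zero, hs]

theorem continuous_elem : Continuous (elem (R := R) (A := A) n) := by
  have hsnd (i : ℕ) : Continuous fun x : ℕ → Unitization R A => (x i).snd :=
    (continuous_unitization_iff.1 (continuous_apply i)).2
  cases n with
  | zero => exact hsnd 0
  | succ n =>
    exact (Completion.continuous_coe _).comp (PreChain.continuous_tensor.comp
      ((continuous_apply 0).prodMk (continuous_pi fun i => hsnd _)))

theorem elem_succ_update_succ (x : ℕ → Unitization R A) (i : Fin (n + 1)) (u : Unitization R A) :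
    elem (n + 1) (Function.update x (i + 1) u) = ((PreChain.tensor
      (x 0, Function.update (fun i : Fin (n + 1) => (x (i + 1)).snd) i u.snd) :
        PreChain R A (n + 1)) : Completion (PreChain R A (n + 1))) := by
  simp only [elem]
  congr 3
  funext k
  simp only [Function.update_apply, Fin.ext_iff, Nat.add_right_cancel_iff]
  split_ifs <;> rfl

theorem elem_toWord (s : Unitization R A × (Fin (n + 1) → A)) :
    elem (n + 1) (PreChain.toWord s) =
      ((PreChain.tensor s : PreChain R A (n + 1)) : Completion (PreChain R A (n + 1))) := by
  have hs : (fun i : Fin (n + 1) => (PreChain.toWord s (i + 1)).snd) = s.2 :=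
    funext fun i => by rw [PreChain.toWord_succ, Unitization.snd_inr]
  rw [elem, PreChain.toWord_zero, hs]

theorem addMonoidHom_ext {M : Type*} [AddCommGroup M] [TopologicalSpace M] [T2Space M]
    {S T : Chain R A n →+ M} (hS : Continuous S) (hT : Continuous T)
    (h : ∀ x, S (elem n x) = T (elem n x)) : S = T := by
  ext z
  cases n with
  | zero => exact h fun _ => Unitization.inr (show A from z)
  | succ n =>
    refine Completion.induction_on (α := PreChain R A (n + 1)) z (isClosed_eq hS hT) fun a => ?_
    induction a using PreChain.tensor_induction with
    | zero => exact (map_zero S).trans (map_zero T).symm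
    | tensor s => rw [← elem_toWord]; exact h _
    | add a b ha hb =>
      rw [Completion.coe_add]
      exact (map_add S _ _).trans ((congrArg₂ _ ha hb).trans (map_add T _ _).symm)

variable [IsTopologicalAddGroup A]

theorem completeSpace (hA : @CompleteSpace A (IsTopologicalAddGroup.rightUniformSpace A)) :
    ∀ n, @CompleteSpace (Chain R A n) (IsTopologicalAddGroup.rightUniformSpace _)
  | 0 => hA
  | n + 1 => by
    have hcomplete : CompleteSpace (Completion (PreChain R A (n + 1))) := inferInstance
    rw [← IsUniformAddGroup.rightUniformSpace_eq
      (G := Completion (PreChain R A (n + 1)))] at hcomplete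
    exact hcomplete

variable [ContinuousConstSMul R R] [IsScalarTower R A A] [SMulCommClass R A A]
  [ContinuousConstSMul R A]

theorem smul_elem (r : R) (x : ℕ → Unitization R A) :
    r • elem n x = elem n (Function.update x 0 (r • x 0)) := by
  cases n with
  | zero => rfl
  | succ n => exact (Completion.coe_smul r (PreChain.tensor _)).symm

instance : ∀ n, ContinuousConstSMul R (Chain R A n)
  | 0 => inferInstanceAs (ContinuousConstSMul R A)
  | n + 1 => inferInstanceAs (ContinuousConstSMul R (Completion (PreChain R A (n + 1))))

instance [T2Space A] : ∀ n, T2Space (Chain R A n)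
  | 0 => inferInstanceAs (T2Space A)
  | n + 1 => inferInstanceAs (T2Space (Completion (PreChain R A (n + 1))))

instance [PolynormableSpace ℂ A] : ∀ n, PolynormableSpace ℂ (Chain R A n)
  | 0 => inferInstanceAs (PolynormableSpace ℂ A)
  | n + 1 => inferInstanceAs (PolynormableSpace ℂ (Completion (PreChain R A (n + 1))))

theorem isLinearMap_elem {k : ℕ} (hk : k ≤ n) (x : ℕ → Unitization R A) :
    IsLinearMap R fun u => elem n (Function.update x k u) := by
  cases n with
  | zero =>
    obtain rfl := Nat.le_zero.1 hk
    exact ⟨fun u v => by simp only [elem, Function.update_self]; rfl,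
      fun r u => by simp only [elem, Function.update_self]; rfl⟩
  | succ n =>
    suffices h : ∃ f : Unitization R A →ₗ[R] PreChain R A (n + 1),
        ∀ u, elem (n + 1) (Function.update x k u) = (f u : Completion (PreChain R A (n + 1))) by
      obtain ⟨f, hf⟩ := h
      simp only [hf]
      exact ⟨fun u v => by rw [map_add, Completion.coe_add]; rfl,
        fun r u => by rw [map_smul]; exact Completion.coe_smul r (f u)⟩
    cases k with
    | zero =>
      exact ⟨(TensorProduct.mk R (Unitization R A) (⨂[R] _ : Fin (n + 1), A)).flip
        (PiTensorProduct.tprod R fun i => (x (i + 1)).snd), fun u => rfl⟩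
    | succ k =>
      exact ⟨TensorProduct.mk R (Unitization R A) (⨂[R] _ : Fin (n + 1), A) (x 0) ∘ₗ
        (PiTensorProduct.tprod R).toLinearMap (fun i : Fin (n + 1) => (x (i + 1)).snd)
          ⟨k, by omega⟩ ∘ₗ Unitization.sndHom R R A,
        fun u => elem_succ_update_succ x ⟨k, by omega⟩ u⟩

theorem isCochain_elem : IsCochain R n (elem (R := R) (A := A) n) where
  isLocal x y h := elem_congr (fun _ => h 0 n.zero_le) fun i hi => by rw [h i hi]
  isLinearMap k hk x := isLinearMap_elem hk x
  eq_zero_of_eq_one x k hk hkn hx := by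
    have h := (isLinearMap_elem hk x).map_zero
    rwa [elem_congr (y := x) _ _] at h
    · exact fun hn => Function.update_of_ne (fun h0 => hn (hkn h0.symm)) _ _
    · intro i _
      obtain rfl | hi := eq_or_ne i k
      · simp [hx]
      · rw [Function.update_of_ne hi]

end Chain

end ElementaryChains

section Extension

open UniformSpace

variable {R : Type} {A : Type*} [CommRing R] [NonUnitalRing A] [Algebra ℂ R] [Module R A]
  [Module ℂ A] [IsScalarTower ℂ R A] {n : ℕ}

section Lift

variable [IsScalarTower R A A] [SMulCommClass R A A]

namespace IsBalancedCochain

variable {M : Type*} [AddCommGroup M] [Module ℂ M] {φ : (ℕ → Unitization R A) → M}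

theorem apply_congr (hφ : IsBalancedCochain n φ) {x y : ℕ → Unitization R A}
    (h0 : n ≠ 0 → x 0 = y 0) (h : ∀ i ≤ n, (x i).snd = (y i).snd) : φ x = φ y :=
  apply_eq_of_snd_eq hφ.toIsWordMultilinear hφ.eq_zero_of_snd_eq_zero h0 h

theorem exists_linearMap (hφ : IsBalancedCochain n φ) :
    ∃ T : PreChain R A n →ₗ[ℂ] M, ∀ s, T (PreChain.tensor s) = φ (PreChain.toWord s) := by
  obtain ⟨T, hT⟩ := PreChain.exists_addMonoidHom hφ.toIsWordMultilinear hφ.balanced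
  refine ⟨{ T with map_smul' := fun c z => ?_ }, hT⟩
  induction z using PreChain.tensor_induction with
  | zero => simp
  | tensor s =>
    exact (hT (c • s.1, s.2)).trans (((PreChain.isLinearMap_toWord hφ.toIsWordMultilinear
      s.2).map_smul c s.1).trans (congrArg (c • ·) (hT s).symm))
  | add a b ha hb => simp_all

variable [UniformSpace M] [IsUniformAddGroup M] [PolynormableSpace ℂ M] [T2Space M]
  [CompleteSpace M] [TopologicalSpace R] [TopologicalSpace A]
  [IsTopologicalAddGroup A] [ContinuousConstSMul R R] [ContinuousConstSMul R A]

theorem exists_continuousLinearMap (hφ : IsBalancedCochain n φ) (hcont : Continuous φ) :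
    ∃ T : Chain R A n →L[ℂ] M, ∀ x, T (Chain.elem n x) = φ x := by
  have := (PolynormableSpace.withSeminorms ℂ M).continuousSMul
  cases n with
  | zero =>
    have hlin := hφ.isLinearMap 0 le_rfl 0
    refine ⟨⟨hlin.mk' _ ∘ₗ Unitization.inrHom ℂ R A, ?_⟩, fun x => hφ.apply_congr ?_ ?_⟩
    · exact hcont.comp (continuous_const.update 0
        (continuous_unitization_iff.2 ⟨continuous_const, continuous_id⟩))
    · exact fun h => (h rfl).elim
    · rintro _ ⟨⟩
      rw [Function.update_self]
      rfl
  | succ n =>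
    obtain ⟨T, hT⟩ := hφ.exists_linearMap
    have hTc : Continuous T := PreChain.continuous_of_tensor
      ((hcont.comp PreChain.continuous_toWord).congr fun s => (hT s).symm)
    let e : PreChain R A (n + 1) →L[ℂ] Completion (PreChain R A (n + 1)) :=
      ⟨⟨⟨(↑), Completion.coe_add⟩, Completion.coe_smul⟩, Completion.continuous_coe _⟩
    refine ⟨ContinuousLinearMap.extend ⟨T, hTc⟩ e, fun x => ?_⟩
    refine (ContinuousLinearMap.extend_eq (e := e) _ Completion.denseRange_coe
      (Completion.isUniformInducing_coe _) (PreChain.tensor _)).trans ((hT _).trans ?_)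
    refine hφ.apply_congr (fun _ => PreChain.toWord_zero _) fun i hi => ?_
    cases i with
    | zero => rw [PreChain.toWord_zero]
    | succ i =>
      have hword := PreChain.toWord_succ (x 0, fun i : Fin (n + 1) => (x (i + 1)).snd) ⟨i, by omega⟩
      exact (congrArg (fun u : Unitization R A => u.snd) hword).trans (Unitization.snd_inr R _)

end IsBalancedCochain

end Lift

variable [TopologicalSpace R] [TopologicalSpace A] {m : ℕ}
  {φ : (ℕ → Unitization R A) → Chain R A m}

theorem actsBy_extend {S : Type*} [Semiring S] [Module S (Chain R A n)] [Module S (Chain R A m)]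
    (h : ∃ T : Chain R A n →L[S] Chain R A m, ActsBy T φ) :
    ActsBy (extend S n m φ) φ := by
  rw [extend, dif_pos h]
  exact h.choose_spec

variable [IsScalarTower R A A] [SMulCommClass R A A] [IsTopologicalAddGroup A]
  [ContinuousConstSMul R R] [ContinuousConstSMul R A]

theorem ActsBy.apply_elem {S : Type*} [Semiring S] [Module S (Chain R A n)] [Module S (Chain R A m)]
    {T : Chain R A n →L[S] Chain R A m} (h : ActsBy T φ)
    (hφ : IsBalancedCochain n φ) (x : ℕ → Unitization R A) : T (Chain.elem n x) = φ x := by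
  let a₀ : Unitization R A := if n = 0 then Unitization.inr (x 0).snd else x 0
  have h0 (hn : n ≠ 0) : x 0 = word a₀ (fun i => (x i).snd) 0 := by simp [word, a₀, hn]
  have hsnd (i : ℕ) : (x i).snd = (word a₀ (fun i => (x i).snd) i).snd := by
    simp only [word, a₀]
    split_ifs <;> simp_all
  rw [Chain.elem_congr h0 fun i _ => hsnd i, hφ.apply_congr h0 fun i _ => hsnd i]
  exact h _ _ fun hn => by simp [a₀, hn]

variable [T2Space A] [PolynormableSpace ℂ A]

theorem IsBalancedCochain.actsBy_extend
    (hA : @CompleteSpace A (IsTopologicalAddGroup.rightUniformSpace A))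
    (hφ : IsBalancedCochain n φ) (hcont : Continuous φ) : ActsBy (extend ℂ n m φ) φ := by
  let _ : UniformSpace (Chain R A m) := IsTopologicalAddGroup.rightUniformSpace _
  have : IsUniformAddGroup (Chain R A m) := isUniformAddGroup_of_addCommGroup
  have : CompleteSpace (Chain R A m) := Chain.completeSpace hA m
  obtain ⟨T, hT⟩ := hφ.exists_continuousLinearMap hcont
  exact GaussManin.actsBy_extend ⟨T, fun a₀ a _ => hT _⟩

theorem IsCochain.actsBy_extend
    (hA : @CompleteSpace A (IsTopologicalAddGroup.rightUniformSpace A))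
    (hφ : IsCochain R n φ) (hcont : Continuous φ) : ActsBy (extend R n m φ) φ := by
  have hT := (hφ.isBalancedCochain.actsBy_extend hA hcont).apply_elem hφ.isBalancedCochain
  set T := extend ℂ n m φ
  have hsmul (r : R) (z : Chain R A n) : T (r • z) = r • T z := by
    have hr := continuous_const_smul (T := Chain R A m) r
    refine DFunLike.congr_fun (Chain.addMonoidHom_ext
      (S := (T : Chain R A n →+ _).comp (DistribSMul.toAddMonoidHom _ r))
      (T := (DistribSMul.toAddMonoidHom _ r).comp (T : Chain R A n →+ _))
      (T.continuous.comp (continuous_const_smul r)) (hr.comp T.continuous) fun x => ?_) z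
    change T (r • Chain.elem n x) = r • T (Chain.elem n x)
    rw [Chain.smul_elem, hT, hT, hφ.apply_update_smul n.zero_le]
  exact GaussManin.actsBy_extend
    ⟨⟨⟨⟨T, map_add T⟩, hsmul⟩, T.continuous⟩, fun a₀ a _ => hT _⟩

end Extension

section SmoothBilinear

variable {J : Opens ℝ} {X Y Z : Type*}
variable [AddCommGroup X] [Module ℂ X] [TopologicalSpace X] [IsTopologicalAddGroup X]
  [ContinuousSMul ℂ X] [T2Space X]
variable [AddCommGroup Y] [Module ℂ Y] [TopologicalSpace Y] [IsTopologicalAddGroup Y]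
  [ContinuousSMul ℂ Y] [T2Space Y]
variable [AddCommGroup Z] [Module ℂ Z] [TopologicalSpace Z] [IsTopologicalAddGroup Z]
  [ContinuousSMul ℂ Z] [T2Space Z]

namespace SmoothFun

/-- The product `(a, b) ↦ (t ↦ N_t(a(t), b(t)))` of smooth functions defined by a smooth family
`N` of bilinear maps. -/
def bilin (N : X →ₗ[ℂ] Y →ₗ[ℂ] SmoothFun J Z) (hN : Continuous fun p : X × Y => N p.1 p.2)
    (a : SmoothFun J X) (b : SmoothFun J Y) : SmoothFun J Z :=
  ⟨fun t => N (a t) (b t) t, isSmooth_bilin N hN a b⟩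

theorem D_bilin (N : X →ₗ[ℂ] Y →ₗ[ℂ] SmoothFun J Z) (hN : Continuous fun p : X × Y => N p.1 p.2)
    (a : SmoothFun J X) (b : SmoothFun J Y) :
    D (bilin N hN a b) = bilin (N.compr₂ D) (continuous_D.comp hN) a b +
      (bilin N hN (D a) b + bilin N hN a (D b)) :=
  D_eq (hasDeriv_bilin N hN a b)

theorem continuous_bilin (N : X →ₗ[ℂ] Y →ₗ[ℂ] SmoothFun J Z)
    (hN : Continuous fun p : X × Y => N p.1 p.2) :
    Continuous fun p : SmoothFun J X × SmoothFun J Y => bilin N hN p.1 p.2 := by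
  refine continuous_rng_iff.2 fun k => ?_
  induction k generalizing N with
  | zero =>
    refine ContinuousMap.continuous_of_continuous_uncurry _ ?_
    have hfst : Continuous fun q : (SmoothFun J X × SmoothFun J Y) × J => q.1.1 q.2 :=
      continuous_eval.comp ((continuous_fst.comp continuous_fst).prodMk continuous_snd)
    have hsnd : Continuous fun q : (SmoothFun J X × SmoothFun J Y) × J => q.1.2 q.2 :=
      continuous_eval.comp ((continuous_snd.comp continuous_fst).prodMk continuous_snd)
    exact continuous_eval.comp ((hN.comp (hfst.prodMk hsnd)).prodMk continuous_snd)
  | succ k ih =>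
    have hDk (p : SmoothFun J X × SmoothFun J Y) : toC ((D ^ (k + 1)) (bilin N hN p.1 p.2)) =
        toC ((D ^ k) (bilin (N.compr₂ D) (continuous_D.comp hN) p.1 p.2)) +
          (toC ((D ^ k) (bilin N hN (D p.1) p.2)) + toC ((D ^ k) (bilin N hN p.1 (D p.2)))) := by
      rw [pow_succ, Module.End.mul_apply, D_bilin, map_add, map_add, map_add, map_add]
    simp only [hDk]
    exact (ih _ _).add (((ih N hN).comp (continuous_D.prodMap continuous_id)).add
      ((ih N hN).comp (continuous_id.prodMap continuous_D)))

theorem continuous_fsmul_prod :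
    Continuous fun p : SmoothFun J ℂ × SmoothFun J X => fsmul p.1 p.2 :=
  continuous_bilin _ continuous_smulBilin

instance : ContinuousMul (SmoothFun J ℂ) := ⟨continuous_fsmul_prod⟩

instance : T2Space (SmoothFun J X) :=
  T2Space.of_injective_continuous (f := fun f : SmoothFun J X => toC f)
    (fun _ _ h => SmoothFun.ext fun t => DFunLike.congr_fun h t) (continuous_toC_pow 0)

end SmoothFun

namespace SmoothDeformation

variable {𝒜 : SmoothDeformation J X}

instance : ContinuousMul 𝒜.Sections := by
  obtain ⟨M, hM, h⟩ := 𝒜.smooth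
  let N : X →ₗ[ℂ] X →ₗ[ℂ] SmoothFun J X := LinearMap.mk₂ ℂ M
    (fun _ _ _ => SmoothFun.ext fun _ => by simp [h])
    (fun _ _ _ => SmoothFun.ext fun _ => by simp [h])
    (fun _ _ _ => SmoothFun.ext fun _ => by simp [h])
    (fun _ _ _ => SmoothFun.ext fun _ => by simp [h])
  exact ⟨(SmoothFun.continuous_bilin N hM).congr fun _ => SmoothFun.ext fun _ => h _ _ _⟩

instance : ContinuousSMul (SmoothFun J ℂ) 𝒜.Sections :=
  ⟨SmoothFun.continuous_fsmul_prod (X := X)⟩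

instance : T2Space 𝒜.Sections := inferInstanceAs (T2Space (SmoothFun J X))

end SmoothDeformation

end SmoothBilinear

section WeakDerivative

variable {J : Opens ℝ} {X : Type*} [AddCommGroup X] [Module ℂ X]

theorem map_val_nhdsNE (t : J) : map Subtype.val (𝓝[≠] t) = 𝓝[≠] (t : ℝ) := by
  have hval : IsOpenEmbedding (Subtype.val : J → ℝ) := J.isOpen.isOpenEmbedding_subtypeVal
  have hpre : ({t}ᶜ : Set J) = Subtype.val ⁻¹' {(t : ℝ)}ᶜ :=
    Set.ext fun s => not_congr Subtype.ext_iff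
  rw [hpre, hval.map_nhdsWithin_preimage_eq]

/-- `f'` is the derivative of `f` in the weak topology of `X`. Unlike `HasDeriv`, this reduces to
the derivatives of scalar functions on `ℝ`, which are obtained from functions on `J` by giving
them the value `0` outside `J`. -/
def HasWeakDeriv [TopologicalSpace X] (f f' : J → X) : Prop :=
  ∀ (ℓ : StrongDual ℂ X) (t : J),
    HasDerivAt (Function.extend Subtype.val (ℓ ∘ f) 0) (ℓ (f' t)) t

theorem HasDeriv.hasWeakDeriv [TopologicalSpace X] {f f' : J → X} (h : HasDeriv f f') :
    HasWeakDeriv f f' := by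
  intro ℓ t
  rw [hasDerivAt_iff_tendsto_slope, ← map_val_nhdsNE, tendsto_map'_iff]
  refine ((ℓ.continuous.tendsto _).comp (h t)).congr fun s => ?_
  rw [Function.comp_apply, map_smul, map_sub, ← Complex.ofReal_inv, Complex.coe_smul]
  simp only [Function.comp_apply, slope, vsub_eq_sub, Subtype.val_injective.extend_apply]

theorem exists_dual_apply_eq_seminorm [TopologicalSpace X] [IsTopologicalAddGroup X]
    [ContinuousSMul ℂ X] [PolynormableSpace ℂ X] {q : Seminorm ℂ X} (hq : Continuous q) (w : X) :
    ∃ ℓ : StrongDual ℂ X, ℓ w = q w ∧ ∀ x, ‖ℓ x‖ ≤ q x := by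
  by_cases hw : w = 0
  · exact ⟨0, by simp [hw], fun x => by simp⟩
  · obtain ⟨g, hg, hle⟩ := Module.Dual.exists_continuous_extension_of_le_seminorm
      (Submodule.span ℂ {w}) ((q w : ℂ) • (LinearEquiv.coord ℂ X w hw : _ →ₗ[ℂ] ℂ)) hq (by
        rintro ⟨x, hx⟩
        obtain ⟨c, rfl⟩ := Submodule.mem_span_singleton.1 hx
        have : LinearEquiv.coord ℂ X w hw ⟨c • w, hx⟩ = c := by
          rw [LinearEquiv.coord, LinearEquiv.symm_apply_eq]
          rfl
        simp only [LinearMap.smul_apply, LinearEquiv.coe_coe, this, smul_eq_mul, norm_mul,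
          Complex.norm_real, Real.norm_eq_abs, abs_of_nonneg (apply_nonneg q w)]
        rw [map_smul_eq_mul, mul_comm])
    refine ⟨g, ?_, hle⟩
    have := hg ⟨w, Submodule.mem_span_singleton_self w⟩
    simpa [LinearEquiv.coord_self] using this

variable [TopologicalSpace X] [IsTopologicalAddGroup X] [ContinuousSMul ℂ X]
  [PolynormableSpace ℂ X]

theorem HasWeakDeriv.seminorm_sub_le {f f' : J → X} (h : HasWeakDeriv f f') {q : Seminorm ℂ X}
    (hq : Continuous q) {V : Set J} (hV : Convex ℝ (Subtype.val '' V)) (v : X) {c : ℝ}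
    (hc : ∀ u ∈ V, q (f' u - v) ≤ c) {s t : J} (hs : s ∈ V) (ht : t ∈ V) :
    q (f s - f t - ((s - t : ℝ) : ℂ) • v) ≤ c * |(s - t : ℝ)| := by
  obtain ⟨ℓ, hℓ, hle⟩ := exists_dual_apply_eq_seminorm hq (f s - f t - ((s - t : ℝ) : ℂ) • v)
  let F : ℝ → ℂ := fun u => Function.extend Subtype.val (ℓ ∘ f) 0 u - u • ℓ v
  have hF (u : J) : F u = ℓ (f u) - (u : ℝ) • ℓ v := by
    simp only [F, Subtype.val_injective.extend_apply, Function.comp_apply]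
  let F' : ℝ → ℂ := Function.extend Subtype.val (fun u => ℓ (f' u - v)) 0
  have hF' (u : J) : F' u = ℓ (f' u - v) := Subtype.val_injective.extend_apply _ _ _
  have hderiv (u : J) : HasDerivAt F (F' u) u := by
    rw [hF', map_sub, ← one_smul ℝ (ℓ v)]
    exact (h ℓ u).sub ((hasDerivAt_id (u : ℝ)).smul_const (ℓ v))
  have hmean := hV.norm_image_sub_le_of_norm_hasDerivWithin_le (f := F) (f' := F') (C := c)
    (by rintro _ ⟨u, -, rfl⟩; exact (hderiv u).hasDerivWithinAt)
    (by rintro _ ⟨u, hu, rfl⟩; exact hF' u ▸ (hle _).trans (hc u hu)) ⟨t, ht, rfl⟩ ⟨s, hs, rfl⟩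
  have hFst : F s - F t = ℓ (f s - f t - ((s - t : ℝ) : ℂ) • v) := by
    simp only [hF, map_sub, map_smul, Complex.real_smul, smul_eq_mul, Complex.ofReal_sub]
    ring
  rwa [hFst, hℓ, Complex.norm_real, Real.norm_of_nonneg (apply_nonneg q _), Real.norm_eq_abs]
    at hmean

theorem HasWeakDeriv.hasDeriv {f f' : J → X} (h : HasWeakDeriv f f') (hf' : Continuous f') :
    HasDeriv f f' := by
  intro t
  refine ((PolynormableSpace.withSeminorms ℂ X).tendsto_nhds _ _).2 fun ⟨q, hq⟩ ε hε => ?_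
  have hnear : {u | q (f' u - f' t) < ε / 2} ∈ 𝓝 t :=
    (isOpen_lt (hq.comp (hf'.sub continuous_const)) continuous_const).mem_nhds (by simpa using hε)
  obtain ⟨δ, hδ, hball⟩ := Metric.mem_nhds_iff.1
    (J.isOpen.isOpenEmbedding_subtypeVal.image_mem_nhds.2 hnear)
  let V : Set J := Subtype.val ⁻¹' Metric.ball (t : ℝ) δ
  have hV : Subtype.val '' V = Metric.ball (t : ℝ) δ :=
    Set.image_preimage_eq_of_subset (hball.trans (Set.image_subset_range _ _))
  have htV : t ∈ V := Metric.mem_ball_self hδ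
  have hbound (u) (hu : u ∈ V) : q (f' u - f' t) ≤ ε / 2 := by
    obtain ⟨u', hu', heq⟩ := hball hu
    exact (Subtype.ext heq ▸ hu' : u ∈ {u | q (f' u - f' t) < ε / 2}).le
  filter_upwards [self_mem_nhdsWithin, mem_nhdsWithin_of_mem_nhds
    (continuous_subtype_val.continuousAt.preimage_mem_nhds (Metric.ball_mem_nhds (t : ℝ) hδ))]
    with s hst hsV
  have hne : (s - t : ℝ) ≠ 0 := sub_ne_zero.2 fun h => hst (Subtype.ext h)
  have hquot : ((s - t : ℝ) : ℂ)⁻¹ • (f s - f t) - f' t =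
      ((s - t : ℝ) : ℂ)⁻¹ • (f s - f t - ((s - t : ℝ) : ℂ) • f' t) := by
    rw [smul_sub _ (f s - f t), inv_smul_smul₀ (Complex.ofReal_ne_zero.2 hne)]
  rw [hquot, map_smul_eq_mul, norm_inv, Complex.norm_real, Real.norm_eq_abs,
    inv_mul_lt_iff₀ (abs_pos.2 hne), mul_comm]
  exact (h.seminorm_sub_le hq (hV ▸ convex_ball _ _) _ hbound hsV htV).trans_lt
    (mul_lt_mul_of_pos_right (half_lt_self hε) (abs_pos.2 hne))

end WeakDerivative

section Complete

variable {J : Opens ℝ} {X : Type*} [AddCommGroup X] [Module ℂ X] [UniformSpace X]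
  [IsUniformAddGroup X]

theorem isClosed_setOf_hasWeakDeriv :
    IsClosed {p : C(J, X) × C(J, X) | HasWeakDeriv p.1 p.2} := by
  have : LocallyCompactSpace J := J.isOpen.locallyCompactSpace
  refine isClosed_of_closure_subset fun p hp ℓ t => ?_
  have := mem_closure_iff_nhdsWithin_neBot.1 hp
  set S := {p : C(J, X) × C(J, X) | HasWeakDeriv p.1 p.2}
  have hextend (g : J → X) (u : J) :
      Function.extend Subtype.val (fun u => ℓ (g u)) 0 (u : ℝ) = ℓ (g u) :=
    Subtype.val_injective.extend_apply _ _ _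
  have hsnd : Tendsto Prod.snd (𝓝[S] p) (𝓝 p.2) := (continuous_snd.tendsto p).mono_left inf_le_left
  have hfst : Tendsto Prod.fst (𝓝[S] p) (𝓝 p.1) := (continuous_fst.tendsto p).mono_left inf_le_left
  change HasDerivAt (Function.extend Subtype.val (fun u => ℓ (p.1 u)) 0) _ _
  rw [← hextend]
  refine hasDerivAt_of_tendstoLocallyUniformlyOn J.isOpen (l := 𝓝[S] p)
    (f := fun r => Function.extend Subtype.val (fun u => ℓ (r.1 u)) 0)
    (f' := fun r => Function.extend Subtype.val (fun u => ℓ (r.2 u)) 0) ?_ ?_ ?_ t.2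
  · rw [tendstoLocallyUniformlyOn_iff_tendstoLocallyUniformly_comp_coe]
    simp only [Function.comp_def, hextend]
    exact ℓ.uniformContinuous.comp_tendstoLocallyUniformly
      (ContinuousMap.tendsto_iff_tendstoLocallyUniformly.1 hsnd)
  · filter_upwards [self_mem_nhdsWithin] with r hr u hu
    exact (hextend _ ⟨u, hu⟩).symm ▸ hr ℓ ⟨u, hu⟩
  · intro u hu
    lift u to J using hu
    simp only [hextend]
    exact (ℓ.continuous.tendsto _).comp (((continuous_eval_const u).tendsto _).comp hfst)

variable [ContinuousSMul ℂ X]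

theorem isClosed_setOf_hasDeriv [PolynormableSpace ℂ X] :
    IsClosed {p : C(J, X) × C(J, X) | HasDeriv p.1 p.2} := by
  convert isClosed_setOf_hasWeakDeriv (J := J) (X := X) using 3 with p
  exact ⟨HasDeriv.hasWeakDeriv, fun h => h.hasDeriv p.2.continuous⟩

variable [T2Space X]

namespace SmoothFun

/-- The sequence of all derivatives of a smooth function. The topology of `C^∞(J, X)` is induced
by this map. -/
def jet : SmoothFun J X →+ (ℕ → C(J, X)) where
  toFun f k := toC ((D ^ k) f)
  map_zero' := by
    funext k
    simp only [map_zero, Pi.zero_apply]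
  map_add' f g := by
    funext k
    simp only [map_add, Pi.add_apply]

theorem isInducing_jet : IsInducing (jet : SmoothFun J X →+ (ℕ → C(J, X))) := by
  refine ⟨?_⟩
  simp only [Pi.topologicalSpace, induced_iInf, induced_compose]
  rfl

theorem range_jet : Set.range (jet : SmoothFun J X →+ (ℕ → C(J, X))) =
    {g | ∀ k, HasDeriv (g k) (g (k + 1))} := by
  refine Set.Subset.antisymm ?_ fun g hg => ?_
  · rintro _ ⟨f, rfl⟩ k
    have hD := hasDeriv_D ((D ^ k) f)
    rwa [← Module.End.mul_apply, ← pow_succ'] at hD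
  · let f (k : ℕ) : SmoothFun J X := ⟨g k, fun l => g (k + l), rfl, fun l => hg (k + l)⟩
    have hf (k : ℕ) : (D ^ k) (f 0) = f k := by
      induction k with
      | zero => rfl
      | succ k ih => rw [pow_succ', Module.End.mul_apply, ih, D_eq (f' := f (k + 1)) (hg k)]
    exact ⟨f 0, funext fun k => ContinuousMap.ext fun t => DFunLike.congr_fun (hf k) t⟩

variable [PolynormableSpace ℂ X]

open scoped ComplexOrder in
instance : PolynormableSpace ℂ (SmoothFun J X) := by
  have : LocallyConvexSpace ℝ X := (PolynormableSpace.withSeminorms ℂ X).toLocallyConvexSpace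
  have : ContinuousSMul ℝ X := IsScalarTower.continuousSMul ℂ
  have : ContinuousSMul ℝ C(J, X) := IsScalarTower.continuousSMul ℂ
  have : LocallyConvexSpace ℂ C(J, X) := LocallyConvexSpace.ofBasisZero _ _ _ _
    (LocallyConvexSpace.convex_basis_zero ℝ C(J, X)) fun _ hs =>
      convex_of_nonneg_surjective_algebraMap _
        (fun z hz => (RCLike.nonneg_iff_exists_ofReal (z := z)).1 hz) hs.2
  have : PolynormableSpace ℂ C(J, X) := LocallyConvexSpace.toPolynormableSpace
  exact PolynormableSpace.iInf fun k =>
    PolynormableSpace.induced ((toC : SmoothFun J X →ₗ[ℂ] C(J, X)) ∘ₗ (D ^ k))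

theorem isClosed_range_jet : IsClosed (Set.range (jet : SmoothFun J X →+ (ℕ → C(J, X)))) := by
  simp only [range_jet, Set.ofPred_forall]
  refine isClosed_iInter fun k => ?_
  have hpair : Continuous fun g : ℕ → C(J, X) => (g k, g (k + 1)) := by fun_prop
  exact isClosed_setOf_hasDeriv.preimage hpair

theorem completeSpace [CompleteSpace X] :
    @CompleteSpace (SmoothFun J X) (IsTopologicalAddGroup.rightUniformSpace _) := by
  let _ : UniformSpace (SmoothFun J X) := IsTopologicalAddGroup.rightUniformSpace _
  have : IsUniformAddGroup (SmoothFun J X) := isUniformAddGroup_of_addCommGroup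
  have : LocallyCompactSpace J := J.isOpen.locallyCompactSpace
  have : IsUniformAddGroup C(J, X) := IsUniformInducing.isUniformAddGroup
    ({ toFun := ContinuousMap.toUniformOnFunIsCompact, map_zero' := rfl, map_add' _ _ := rfl } :
      C(J, X) →+ UniformOnFun J X {K | IsCompact K})
    ContinuousMap.isUniformEmbedding_toUniformOnFunIsCompact.isUniformInducing
  rw [completeSpace_iff_isComplete_range
    (AddMonoidHom.isUniformInducing_of_isInducing isInducing_jet)]
  exact isClosed_range_jet.isComplete

end SmoothFun

end Complete

section Continuity

section Words

variable {U M : Type*} [TopologicalSpace U]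

theorem continuous_applyAt {D : U → U} (hD : Continuous D) (p : ℕ) : Continuous (applyAt D p) :=
  continuous_id.update p (hD.comp (continuous_apply p))

theorem continuous_mergeAt {β : U → U → U} (hβ : Continuous fun u : U × U => β u.1 u.2) (m : ℕ) :
    Continuous (mergeAt β m) := continuous_pi fun i => by
  unfold mergeAt
  split_ifs
  · exact continuous_apply i
  · exact hβ.comp (f := fun x : ℕ → U => (x m, x (m + 1))) (by fun_prop)
  · exact continuous_apply (i + 1)

theorem continuous_rotate (n j : ℕ) : Continuous (rotate n j : (ℕ → U) → ℕ → U) :=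
  continuous_pi fun i => by
    unfold rotate
    split_ifs <;> fun_prop

theorem continuous_consOne [One U] : Continuous (consOne : (ℕ → U) → ℕ → U) :=
  continuous_pi fun i => by
    unfold consOne
    split_ifs <;> fun_prop

theorem continuous_face [Mul U] [ContinuousMul U] (n k : ℕ) :
    Continuous (face n k : (ℕ → U) → ℕ → U) := by
  unfold face
  split_ifs
  · exact continuous_mergeAt continuous_mul k
  · refine continuous_pi fun i => ?_
    split_ifs <;> fun_prop

variable [AddCommGroup M] [TopologicalSpace M] {n : ℕ} {g : (ℕ → U) → M}

theorem continuous_contractOne [Mul U] [ContinuousMul U] {D : U → U} (hD : Continuous D)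
    (hg : Continuous g) : Continuous (contractOne M D g) :=
  hg.comp ((continuous_mergeAt continuous_mul 0).comp (continuous_applyAt hD 1))

variable [IsTopologicalAddGroup M]

theorem continuous_hochschildOp [Mul U] [ContinuousMul U] (hg : Continuous g) :
    Continuous (hochschildOp M n g) := by
  refine (continuous_finsetSum _ fun k _ => ?_).congr fun x => hochschildOp_apply.symm
  exact (hg.comp (continuous_face (n + 1) k)).zsmul _

theorem continuous_connesOp [One U] (hg : Continuous g) : Continuous (connesOp M n g) := by
  refine (continuous_finsetSum _ fun j _ => ?_).congr fun x => connesOp_apply.symm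
  exact (hg.comp (continuous_consOne.comp (continuous_rotate n j))).zsmul _

theorem continuous_lieOp {D : U → U} (hD : Continuous D) (hg : Continuous g) :
    Continuous (lieOp M D n g) :=
  (continuous_finsetSum _ fun i _ => hg.comp (continuous_applyAt hD i)).congr
    fun _ => lieOp_apply.symm

theorem continuous_cyclicOne [One U] {D : U → U} (hD : Continuous D) (hg : Continuous g) :
    Continuous (cyclicOne M D n g) := by
  refine (continuous_finsetSum _ fun j _ => continuous_finsetSum _ fun p _ => ?_).congr
    fun x => cyclicOne_apply.symm
  exact (hg.comp (continuous_consOne.comp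
    ((continuous_applyAt hD p).comp (continuous_rotate n j)))).zsmul _

theorem continuous_contractTwo [Mul U] [ContinuousMul U] {E : U → U → U}
    (hE : Continuous fun u : U × U => E u.1 u.2) (hg : Continuous g) :
    Continuous (contractTwo M E g) :=
  (hg.comp ((continuous_mergeAt continuous_mul 0).comp (continuous_mergeAt hE 1))).neg

theorem continuous_cyclicTwo [One U] {E : U → U → U} (hE : Continuous fun u : U × U => E u.1 u.2)
    (hg : Continuous g) : Continuous (cyclicTwo M E n g) := by
  refine (continuous_finsetSum _ fun j _ => continuous_finsetSum _ fun m _ => ?_).congr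
    fun x => cyclicTwo_apply.symm
  exact (hg.comp (continuous_consOne.comp
    ((continuous_mergeAt hE m).comp (continuous_rotate n j)))).zsmul _

end Words

section Unitization

variable {R : Type} {A : Type*} [CommRing R] [NonUnitalRing A] [Module R A] [TopologicalSpace R]
  [TopologicalSpace A]

instance [ContinuousMul R] [ContinuousMul A] [ContinuousAdd A] [ContinuousSMul R A] :
    ContinuousMul (Unitization R A) where
  continuous_mul := by
    obtain ⟨hfst, hsnd⟩ := continuous_unitization_iff.1 (continuous_id (X := Unitization R A))
    have hfst₁ := hfst.comp (continuous_fst (Y := Unitization R A))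
    have hfst₂ := hfst.comp (continuous_snd (X := Unitization R A))
    have hsnd₁ := hsnd.comp (continuous_fst (Y := Unitization R A))
    have hsnd₂ := hsnd.comp (continuous_snd (X := Unitization R A))
    exact continuous_unitization_iff.2 ⟨hfst₁.mul hfst₂,
      ((hfst₁.smul hsnd₂).add (hfst₂.smul hsnd₁)).add (hsnd₁.mul hsnd₂)⟩

end Unitization

end Continuity

section Connections

/-- The operator `T` on an `R`-module satisfies the Leibniz rule along `der`, which is a derivation
of `R` in all applications. -/
def IsConnectionAlong {R M : Type*} [SMul R M] [Add M] (der : R → R) (T : M → M) : Prop :=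
  ∀ (r : R) (m : M), T (r • m) = der r • m + r • T m

namespace IsConnectionAlong

theorem isLinearMap_sub {R M : Type*} [Ring R] [AddCommGroup M] [Module R M] {der : R → R}
    {T T' : M →+ M} (h : IsConnectionAlong der T) (h' : IsConnectionAlong der T') :
    IsLinearMap R (T - T') where
  map_add := map_add (T - T')
  map_smul r m := by
    rw [AddMonoidHom.sub_apply, h r, h' r, add_sub_add_left_eq_sub, ← smul_sub,
      AddMonoidHom.sub_apply]

variable {R U : Type*} [CommRing R] {der : R → R}

section Coboundary

variable [NonUnitalRing U] [Module R U] {D : U →+ U}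

theorem isLinearMap_coboundary_left [IsScalarTower R U U] (hD : IsConnectionAlong der D) (v : U) :
    IsLinearMap R fun u => coboundary D u v where
  map_add u w := by simp only [coboundary, map_add, add_mul]; abel
  map_smul r u := by
    simp only [coboundary, smul_mul_assoc, hD r, add_mul, smul_add, smul_sub]; abel

theorem isLinearMap_coboundary_right [SMulCommClass R U U] (hD : IsConnectionAlong der D) (u : U) :
    IsLinearMap R (coboundary D u) where
  map_add v w := by simp only [coboundary, map_add, mul_add]; abel
  map_smul r v := by
    simp only [coboundary, mul_smul_comm, hD r, mul_add, smul_add, smul_sub]; abel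

end Coboundary

theorem lieOp_update_smul {M : Type*} [AddCommGroup M] [Module R M] [Ring U] [Algebra R U]
    {D : U → U} (hD : IsConnectionAlong der D) {n : ℕ} {g : (ℕ → U) → M}
    (hg : IsWordMultilinear R n g) {k : ℕ} (hk : k ≤ n) (x : ℕ → U) (r : R) :
    lieOp M D n g (Function.update x k (r • x k)) = der r • g x + r • lieOp M D n g x := by
  have hterm (i : ℕ) : g (applyAt D i (Function.update x k (r • x k))) =
      (if i = k then der r • g x else 0) + r • g (applyAt D i x) := by
    split_ifs with hik
    · subst hik
      have hlin := hg.isLinearMap i hk x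
      rw [applyAt, Function.update_self, Function.update_idem, hD, hlin.map_add, hlin.map_smul,
        hlin.map_smul, Function.update_eq_self, applyAt]
    · rw [zero_add, ← hg.apply_update_smul hk, applyAt, applyAt, Function.update_of_ne hik,
        Function.update_of_ne (Ne.symm hik), Function.update_comm hik]
  simp only [lieOp_apply, hterm, Finset.sum_add_distrib, Finset.sum_ite_eq', Finset.smul_sum]
  rw [if_pos (Finset.mem_range.2 (Nat.lt_succ_of_le hk))]

end IsConnectionAlong

section UnitalExt

variable {R : Type} {A : Type*} [CommRing R] [Algebra ℂ R] [NonUnitalRing A] [Module ℂ A]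
  [TopologicalSpace A]

/-- The extension of an operator on `A` to the unitization `A₊ = A ⊕ R` that is `der` on `R`; it
kills the unit. -/
def unitalExt (der : Derivation ℂ R R) (nabla : A →L[ℂ] A) :
    Unitization R A →ₗ[ℂ] Unitization R A where
  toFun u := Unitization.inl (der u.fst) + (nabla u.snd : Unitization R A)
  map_add' u v := by ext <;> simp
  map_smul' c u := by ext <;> simp

variable (der : Derivation ℂ R R) (nabla : A →L[ℂ] A)

theorem fst_unitalExt (u : Unitization R A) : (unitalExt der nabla u).fst = der u.fst := by
  simp [unitalExt]

theorem snd_unitalExt (u : Unitization R A) : (unitalExt der nabla u).snd = nabla u.snd := by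
  simp [unitalExt]

theorem unitalExt_one : unitalExt der nabla 1 = 0 := by
  ext <;> simp [unitalExt]

theorem unitalExt_sub_unitalExt [IsTopologicalAddGroup A] (nabla' : A →L[ℂ] A) :
    (unitalExt der nabla - unitalExt der nabla' : Unitization R A → Unitization R A) =
      unitalExt 0 (nabla - nabla') := by
  funext u
  ext <;> simp [unitalExt, sub_eq_add_neg]

theorem continuous_unitalExt [TopologicalSpace R] (hder : Continuous der) :
    Continuous (unitalExt der nabla) := by
  obtain ⟨hfst, hsnd⟩ := continuous_unitization_iff.1 (continuous_id (X := Unitization R A))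
  refine continuous_unitization_iff.2 ⟨?_, ?_⟩
  · exact (hder.comp hfst).congr fun u => (fst_unitalExt der nabla u).symm
  · exact (nabla.continuous.comp hsnd).congr fun u => (snd_unitalExt der nabla u).symm

variable {der nabla} [Module R A]

theorem IsConnectionAlong.unitalExt (h : IsConnectionAlong der nabla) :
    IsConnectionAlong der (unitalExt der nabla) := fun r u => by
  ext
  · simp [fst_unitalExt, mul_comm, add_comm]
  · simp [snd_unitalExt, h r]

theorem coboundary_unitalExt [IsScalarTower R A A] [SMulCommClass R A A]
    (h : IsConnectionAlong der nabla) (u v : Unitization R A) :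
    coboundary (unitalExt der nabla) u v = Unitization.inr (coboundary nabla u.snd v.snd) := by
  ext
  · simp only [coboundary, sub_eq_add_neg, Unitization.fst_add, Unitization.fst_neg,
      Unitization.fst_mul, fst_unitalExt, Derivation.leibniz, smul_eq_mul, Unitization.fst_inr]
    ring
  · simp only [coboundary, sub_eq_add_neg, Unitization.snd_add, Unitization.snd_neg,
      Unitization.snd_mul, fst_unitalExt, snd_unitalExt, map_add, h _ _, Unitization.snd_inr]
    abel

end UnitalExt

end Connections

section Formulas

theorem rotate_eq_apply_mod {U : Type*} {n i j : ℕ} (hj : j ≤ n + 1) (hi : i ≤ n) (x : ℕ → U) :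
    rotate n j x i = x ((i + (n + 1 - j)) % (n + 1)) := by
  unfold rotate
  split_ifs with hij
  · rw [Nat.mod_eq_of_lt (by omega), Nat.add_comm]
  · rw [Nat.mod_eq_sub_mod (by omega), Nat.mod_eq_of_lt (by omega)]
    congr 1; omega

theorem consOne_mergeAt_rotate {U : Type*} [One U] (E : U → U → U) {n i j : ℕ} (hij : i + j < n)
    (x : ℕ → U) (k : ℕ) :
    consOne (mergeAt E (i + j) (rotate n j x)) k =
      if k = 0 then 1
      else if k ≤ j then x (n - j + k)
      else if k ≤ j + i then x (k - j - 1)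
      else if k = j + i + 1 then E (x i) (x (i + 1))
      else x (k - j) := by
  have h1 : ¬ i + j < j := by omega
  have h2 : ¬ i + j + 1 < j := by omega
  have h3 : i + j + 1 - j = i + 1 := by omega
  simp only [consOne, mergeAt, rotate, h1, h2, h3, if_false, Nat.add_sub_cancel]
  grind

variable {R : Type} {A : Type*} [CommRing R] [Algebra ℂ R] [TopologicalSpace R]
  [NonUnitalRing A] [Module ℂ A] [Module R A] [IsScalarTower ℂ R A] [TopologicalSpace A]

theorem bFormula_eq_hochschildOp (n : ℕ) :
    bFormula n = hochschildOp (Chain R A n) n (Chain.elem (R := R) (A := A) n) := by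
  funext x
  rw [bFormula, hochschildOp_apply, Finset.sum_range_succ _ (n + 1)]
  refine congrArg₂ (· + ·) (Finset.sum_congr rfl fun j hj => ?_) ?_
  · rw [face, if_pos (Finset.mem_range.1 hj)]
    rfl
  · rw [face, if_neg (lt_irrefl _)]

theorem lieFormula_eq_lieOp (der : Derivation ℂ R R) (nabla : A →L[ℂ] A) (n : ℕ) :
    lieFormula der nabla n =
      lieOp (Chain R A n) (unitalExt der nabla) n (Chain.elem (R := R) n) := by
  funext x
  rw [lieOp_apply]
  rfl

theorem iotaFormula_eq_contractTwo (E : A → A → A) (n : ℕ) :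
    iotaFormula E n = contractTwo (Chain R A n) (fun u v => (E u.snd v.snd : Unitization R A))
      (Chain.elem (R := R) n) := by
  funext x
  rw [iotaFormula, contractTwo_apply]
  congr 2
  funext i
  simp only [mergeAt]; grind

theorem sFormula_eq_cyclicTwo (E : A → A → A) (n : ℕ) :
    sFormula E n = cyclicTwo (Chain R A n) (fun u v => (E u.snd v.snd : Unitization R A)) n
      (Chain.elem (R := R) n) := by
  funext x
  have hIcc : Finset.Icc 1 (n - 1) = Finset.Ico 1 n := by
    ext i; simp only [Finset.mem_Icc, Finset.mem_Ico]; omega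
  rw [sFormula, cyclicTwo_apply, hIcc, sum_range_sum_Ico_eq_sum_Ico_sum_range n fun m j =>
    (-1 : ℤ) ^ (m + j * n) • Chain.elem n (consOne (mergeAt _ m (rotate n j x)))]
  refine Finset.sum_congr rfl fun i hi => Finset.sum_congr rfl fun j hj => ?_
  rw [Finset.mem_Ico] at hi
  rw [Finset.mem_range] at hj
  rw [funext (consOne_mergeAt_rotate _ (show i + j < n by omega) x)]
  obtain ⟨m, rfl⟩ : ∃ m, n = m + 1 := ⟨n - 1, by omega⟩
  rw [← neg_one_pow_add_two_mul _ j, Nat.add_sub_cancel]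
  congr 2; ring

variable [IsScalarTower R A A] [SMulCommClass R A A] [ContinuousConstSMul R R]
  [IsTopologicalAddGroup A] [ContinuousConstSMul R A]

theorem BFormula_eq_connesOp (n : ℕ) :
    BFormula n = connesOp (Chain R A (n + 1)) n (Chain.elem (R := R) (A := A) (n + 1)) := by
  funext x
  -- The rotation by `j` places starts with the letter `n + 1 - j`.
  have hword (j : ℕ) (hj : j ≤ n + 1) :
      Chain.elem (R := R) (A := A) (n + 1) (consOne (rotate n (n + 1 - j) x)) =
        Chain.elem (n + 1) (fun i => if i = 0 then 1 else x ((i - 1 + j) % (n + 1))) :=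
    Chain.isCochain_elem.isLocal fun i hi => by
      unfold consOne
      split_ifs
      · rfl
      · rw [rotate_eq_apply_mod (by omega) (by omega), Nat.sub_sub_self hj]
  rw [BFormula, connesOp_apply, Finset.sum_range_succ', Finset.sum_range_succ',
    ← Finset.sum_range_reflect]
  refine congrArg₂ (· + ·) (Finset.sum_congr rfl fun j hj => ?_) ?_
  · have hjn := Finset.mem_range.1 hj
    have hsum : (n - 1 - j + 1) + (j + 1) = n + 1 := by omega
    have heven : Even ((n - 1 - j + 1) * n + (j + 1) * n) := by
      rw [← add_mul, hsum, mul_comm]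
      exact Nat.even_mul_succ_self n
    rw [neg_one_pow_congr (Nat.even_add.1 heven), ← hword _ (by omega)]
    congr 4; omega
  · rw [← hword 0 (Nat.zero_le _), Nat.sub_zero, rotate_zero]
    congr 1
    refine Chain.isCochain_elem.isLocal fun i hi => ?_
    unfold consOne
    split_ifs
    · rfl
    · exact rotate_full (by omega) x

end Formulas

section ChainOperators

theorem isLinearMap_inr_comp_snd {R A : Type*} [CommRing R] [NonUnitalRing A] [Module R A]
    {f : A → A} (hf : IsLinearMap R f) :
    IsLinearMap R fun u : Unitization R A => (f u.snd : Unitization R A) :=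
  ((Unitization.inrHom R R A).comp ((hf.mk' f).comp (Unitization.sndHom R R A))).isLinear

theorem continuous_inr_comp_snd_snd {R : Type} {A : Type*} [CommRing R] [NonUnitalRing A]
    [TopologicalSpace R] [TopologicalSpace A] {E : A → A → A}
    (hE : Continuous fun a : A × A => E a.1 a.2) :
    Continuous fun u : Unitization R A × Unitization R A =>
      (E u.1.snd u.2.snd : Unitization R A) := by
  have hsnd : Continuous fun u : Unitization R A => u.snd :=
    (continuous_unitization_iff.1 continuous_id).2
  exact continuous_unitization_iff.2 ⟨continuous_const, hE.comp (hsnd.prodMap hsnd)⟩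

theorem continuous_coboundary {A : Type*} [NonUnitalRing A] [TopologicalSpace A]
    [IsTopologicalAddGroup A] [ContinuousMul A] {D : A → A} (hD : Continuous D) :
    Continuous fun a : A × A => coboundary D a.1 a.2 := by
  unfold coboundary
  fun_prop

variable {R : Type} {A : Type*} [CommRing R] [Algebra ℂ R] [NonUnitalRing A] [Module ℂ A]
  [Module R A] [IsScalarTower ℂ R A] [IsScalarTower R A A] [SMulCommClass R A A]

theorem isBalancedCochain_lieOp [TopologicalSpace A] {M : Type*} [AddCommGroup M]
    [Module R M] [Module ℂ M] [IsScalarTower ℂ R M] {der : Derivation ℂ R R} {nabla : A →L[ℂ] A}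
    (h : IsConnectionAlong der nabla) {n : ℕ} {g : (ℕ → Unitization R A) → M}
    (hg : IsCochain R n g) : IsBalancedCochain n (lieOp M (unitalExt der nabla) n g) where
  toIsWordMultilinear := by
    have hterm (i : ℕ) := hg.complex.toIsWordMultilinear.comp_applyAt
      (unitalExt der nabla).isLinear i
    convert IsWordMultilinear.sum (s := Finset.range (n + 1)) fun i _ => hterm i using 1
    funext x
    rw [lieOp_apply]
  balanced k hk x r := by
    rw [h.unitalExt.lieOp_update_smul hg.toIsWordMultilinear hk,
      h.unitalExt.lieOp_update_smul hg.toIsWordMultilinear n.zero_le]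
  eq_zero_of_snd_eq_zero x k hk hk0 hx := by
    rw [lieOp_apply]
    refine Finset.sum_eq_zero fun i _ => hg.eq_zero_of_snd_eq_zero _ k hk hk0 ?_
    rcases eq_or_ne k i with rfl | hki
    · rw [applyAt, Function.update_self, snd_unitalExt, hx, map_zero]
    · rw [applyAt, Function.update_of_ne hki, hx]

section Cochains

variable [TopologicalSpace R] [ContinuousConstSMul R R] [TopologicalSpace A]
  [IsTopologicalAddGroup A] [ContinuousConstSMul R A]

theorem isCochain_bFormula (n : ℕ) : IsCochain R (n + 1) (bFormula (R := R) (A := A) n) :=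
  bFormula_eq_hochschildOp (R := R) (A := A) n ▸ Chain.isCochain_elem.hochschildOp

theorem isCochain_BFormula (n : ℕ) : IsCochain R n (BFormula (R := R) (A := A) n) :=
  BFormula_eq_connesOp (R := R) (A := A) n ▸ Chain.isCochain_elem.connesOp

section TwoCochain

variable {E : A → A → A} (hleft : ∀ b, IsLinearMap R fun a => E a b)
  (hright : ∀ a, IsLinearMap R (E a))
include hleft hright

theorem isCochain_iotaFormula (n : ℕ) : IsCochain R (n + 2) (iotaFormula (R := R) E n) := by
  rw [iotaFormula_eq_contractTwo]
  exact Chain.isCochain_elem.contractTwo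
    (fun v => isLinearMap_inr_comp_snd (hleft v.snd))
    (fun u => isLinearMap_inr_comp_snd (hright u.snd))
    (fun u => by simp [(hleft u.snd).map_zero]) (fun u => by simp [(hright u.snd).map_zero])

theorem isCochain_sFormula (n : ℕ) : IsCochain R n (sFormula (R := R) E n) := by
  rw [sFormula_eq_cyclicTwo]
  exact Chain.isCochain_elem.cyclicTwo
    (fun v => isLinearMap_inr_comp_snd (hleft v.snd))
    (fun u => isLinearMap_inr_comp_snd (hright u.snd))
    (fun u => by simp [(hleft u.snd).map_zero]) (fun u => by simp [(hright u.snd).map_zero])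

end TwoCochain

end Cochains

section OneCochain

variable [TopologicalSpace R] [ContinuousConstSMul R R] [TopologicalSpace A]
  [IsTopologicalAddGroup A] [ContinuousConstSMul R A]

/-- The contraction `(a₀, …, aₙ₊₁) ↦ (a₀D(a₁), a₂, …, aₙ₊₁)` with an `R`-linear `1`-cochain `D` on
`A₊` that kills `e`. -/
def iotaOne (D : Unitization R A → Unitization R A) (n : ℕ) : Chain R A (n + 1) →L[R] Chain R A n :=
  extend R _ _ (contractOne (Chain R A n) D (Chain.elem n))

/-- The cyclic counterpart `C_n(A) → C_{n+1}(A)` of `iotaOne`. -/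
def cyclicSOne (D : Unitization R A → Unitization R A) (n : ℕ) :
    Chain R A n →L[R] Chain R A (n + 1) :=
  extend R _ _ (cyclicOne (Chain R A (n + 1)) D n (Chain.elem (n + 1)))

end OneCochain

section ActsBy

variable [TopologicalSpace R] [ContinuousMul R] [TopologicalSpace A] [IsTopologicalAddGroup A]
  [ContinuousSMul R A] [T2Space A] [PolynormableSpace ℂ A]
  (hA : @CompleteSpace A (IsTopologicalAddGroup.rightUniformSpace A))

include hA in
theorem actsBy_connesB (n : ℕ) : ActsBy (connesB R A n) (BFormula n) :=
  (isCochain_BFormula n).actsBy_extend hA <|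
    BFormula_eq_connesOp (R := R) (A := A) n ▸ continuous_connesOp Chain.continuous_elem

include hA in
theorem actsBy_lie {der : Derivation ℂ R R} {nabla : A →L[ℂ] A} (hder : Continuous der)
    (h : IsConnectionAlong der nabla) (n : ℕ) :
    ActsBy (lie der nabla n) (lieFormula der nabla n) := by
  rw [lie, lieFormula_eq_lieOp]
  exact (isBalancedCochain_lieOp h Chain.isCochain_elem).actsBy_extend hA
    (continuous_lieOp (continuous_unitalExt der nabla hder) Chain.continuous_elem)

variable {D : Unitization R A → Unitization R A} (hD : IsLinearMap R D) (hD1 : D 1 = 0)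
  (hDcont : Continuous D)

include hA hD hD1 hDcont in
theorem cyclicSOne_elem (n : ℕ) (x : ℕ → Unitization R A) :
    cyclicSOne D n (Chain.elem n x) =
      cyclicOne (Chain R A (n + 1)) D n (Chain.elem (n + 1)) x :=
  have hφ := Chain.isCochain_elem.cyclicOne hD hD1
  (hφ.actsBy_extend hA (continuous_cyclicOne hDcont Chain.continuous_elem)).apply_elem
    hφ.isBalancedCochain x

variable {E : A → A → A} (hleft : ∀ b, IsLinearMap R fun a => E a b)
  (hright : ∀ a, IsLinearMap R (E a)) (hE : Continuous fun a : A × A => E a.1 a.2)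

include hA hleft hright hE in
theorem actsBy_cyclicS (n : ℕ) : ActsBy (cyclicS R E n) (sFormula E n) := by
  refine (isCochain_sFormula hleft hright n).actsBy_extend hA ?_
  rw [sFormula_eq_cyclicTwo]
  exact continuous_cyclicTwo (continuous_inr_comp_snd_snd hE) Chain.continuous_elem

variable [ContinuousMul A]

include hA in
theorem actsBy_hochschildB (n : ℕ) : ActsBy (hochschildB R A n) (bFormula n) :=
  (isCochain_bFormula n).actsBy_extend hA <|
    bFormula_eq_hochschildOp (R := R) (A := A) n ▸ continuous_hochschildOp Chain.continuous_elem

include hA hD hD1 hDcont in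
theorem iotaOne_elem (n : ℕ) (x : ℕ → Unitization R A) :
    iotaOne D n (Chain.elem (n + 1) x) = contractOne (Chain R A n) D (Chain.elem n) x :=
  have hφ := Chain.isCochain_elem.contractOne hD hD1
  (hφ.actsBy_extend hA (continuous_contractOne hDcont Chain.continuous_elem)).apply_elem
    hφ.isBalancedCochain x

include hA hleft hright hE in
theorem actsBy_iota (n : ℕ) : ActsBy (iota R E n) (iotaFormula E n) := by
  refine (isCochain_iotaFormula hleft hright n).actsBy_extend hA ?_
  rw [iotaFormula_eq_contractTwo]
  exact continuous_contractTwo (continuous_inr_comp_snd_snd hE) Chain.continuous_elem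

end ActsBy

end ChainOperators

section Periodic

theorem map_single_of_injective {ι κ : Type*} [DecidableEq κ] {P Q : κ → Type*}
    [∀ k, AddCommGroup (P k)] [∀ k, AddCommGroup (Q k)] {e e' : ι → κ} (he : Function.Injective e)
    (he' : Function.Injective e') (f : ∀ i, P (e i) →+ Q (e' i)) (i j : ι) (z : P (e i)) :
    f j (Pi.single (e i) z (e j)) = (Pi.single (e' i) (f i z) : ∀ k, Q k) (e' j) := by
  rcases eq_or_ne j i with rfl | hji
  · rw [Pi.single_eq_same, Pi.single_eq_same]
  · rw [Pi.single_eq_of_ne (he.ne hji), Pi.single_eq_of_ne (he'.ne hji), map_zero]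

variable {R : Type} {A : Type*} [CommRing R] [Algebra ℂ R] [NonUnitalRing A] [Module ℂ A]
  [Module R A] [IsScalarTower ℂ R A] [TopologicalSpace R] [TopologicalSpace A]

/-- The elementary chain of the letters `0, …, n` of a word, as an element of `C_per(A)`. -/
def Per.ofWord [IsScalarTower R A A] [SMulCommClass R A A] [ContinuousConstSMul R R]
    [IsTopologicalAddGroup A] [ContinuousConstSMul R A] (n : ℕ) (x : ℕ → Unitization R A) :
    Per R A :=
  Pi.single n (Chain.elem n x)

namespace Per

variable [IsScalarTower R A A] [SMulCommClass R A A] [ContinuousConstSMul R R]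
  [IsTopologicalAddGroup A] [ContinuousConstSMul R A]

theorem isCochain_ofWord (n : ℕ) : IsCochain R n (ofWord (R := R) (A := A) n) :=
  Chain.isCochain_elem.map (LinearMap.single R (Chain R A) n)

theorem addMonoidHom_ext {M : Type*} [AddCommGroup M] [TopologicalSpace M] [T2Space M]
    {S T : Per R A →+ M} (hS : Continuous S) (hT : Continuous T)
    (h : ∀ n x, S (ofWord n x) = T (ofWord n x)) : S = T := by
  have hsingle (n : ℕ) (z : Chain R A n) : S (Pi.single n z) = T (Pi.single n z) :=
    DFunLike.congr_fun (Chain.addMonoidHom_ext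
      (S := S.comp (AddMonoidHom.single (Chain R A) n))
      (T := T.comp (AddMonoidHom.single (Chain R A) n))
      (hS.comp (continuous_single n)) (hT.comp (continuous_single n)) (h n)) z
  ext c
  have hc : HasSum (fun n => Pi.single n (c n)) c := Pi.hasSum.2 fun m => by
    simpa using hasSum_single (f := fun n => (Pi.single n (c n) : Per R A) m) m
      fun n hn => Pi.single_eq_of_ne hn.symm _
  exact (hc.map S hS).unique (by simpa only [Function.comp_def, hsingle] using hc.map T hT)

end Per

end Periodic

section PeriodicOperators

variable {R : Type} {A : Type*} [CommRing R] [Algebra ℂ R] [NonUnitalRing A] [Module ℂ A]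
  [Module R A] [IsScalarTower ℂ R A] [IsScalarTower R A A] [SMulCommClass R A A]
  [TopologicalSpace R] [TopologicalSpace A]

section Definition

variable [ContinuousConstSMul R R] [IsTopologicalAddGroup A] [ContinuousConstSMul R A]

/-- The operator on `C_per(A)` with the components `f n : C_{n+1}(A) → C_n(A)` and
`g n : C_n(A) → C_{n+1}(A)`; operators of odd degree such as `b + B` have this form. -/
def perOdd (f : ∀ n, Chain R A (n + 1) →L[R] Chain R A n)
    (g : ∀ n, Chain R A n →L[R] Chain R A (n + 1)) : Per R A →L[R] Per R A :=
  ContinuousLinearMap.pi fun n => match n with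
    | 0 => f 0 ∘L ContinuousLinearMap.proj 1
    | n + 1 => f (n + 1) ∘L ContinuousLinearMap.proj (n + 2) + g n ∘L ContinuousLinearMap.proj n

/-- The contraction `I_D` on `C_per(A)` with an `R`-linear `1`-cochain `D` on `A₊` that kills
`e`. -/
def perIOne (D : Unitization R A → Unitization R A) : Per R A →L[R] Per R A :=
  perOdd (iotaOne D) (cyclicSOne D)

theorem perD_eq_perOdd : perD R A = perOdd (hochschildB R A) (connesB R A) := rfl

section Odd

variable (f : ∀ n, Chain R A (n + 1) →L[R] Chain R A n)
  (g : ∀ n, Chain R A n →L[R] Chain R A (n + 1))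

theorem perOdd_single_zero (z : Chain R A 0) :
    perOdd f g (Pi.single 0 z) = Pi.single 1 (g 0 z) := by
  funext m
  match m with
  | 0 => exact map_zero (f 0)
  | m + 1 =>
    have hg : g m (Pi.single 0 z m) = (Pi.single 1 (g 0 z) : Per R A) (m + 1) :=
      map_single_of_injective (e := id) Function.injective_id Nat.succ_injective
        (fun n => (g n : Chain R A n →+ Chain R A (n + 1))) 0 m z
    exact (congrArg₂ (· + ·) (map_zero (f (m + 1))) hg).trans (zero_add _)

theorem perOdd_single_succ (n : ℕ) (z : Chain R A (n + 1)) :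
    perOdd f g (Pi.single (n + 1) z) = Pi.single n (f n z) + Pi.single (n + 2) (g (n + 1) z) := by
  have hf (m : ℕ) : f m (Pi.single (n + 1) z (m + 1)) = (Pi.single n (f n z) : Per R A) m :=
    map_single_of_injective (e' := id) Nat.succ_injective Function.injective_id
      (fun n => (f n : Chain R A (n + 1) →+ Chain R A n)) n m z
  funext m
  match m with
  | 0 => exact (hf 0).trans (add_zero _).symm
  | m + 1 =>
    have hg : g m (Pi.single (n + 1) z m) = (Pi.single (n + 2) (g (n + 1) z) : Per R A) (m + 1) :=
      map_single_of_injective (e := id) Function.injective_id Nat.succ_injective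
        (fun n => (g n : Chain R A n →+ Chain R A (n + 1))) (n + 1) m z
    exact congrArg₂ (· + ·) (hf (m + 1)) hg

theorem perOdd_mem_parity {p : ZMod 2} {c : Per R A} (hc : c ∈ parity R A p) :
    perOdd f g c ∈ parity R A (p + 1) := by
  have hone : (1 : ZMod 2) + 1 = 0 := rfl
  rintro (_ | n) hn
  · have h1 : c 1 = 0 := hc 1 fun h => hn (by rw [← h, Nat.cast_one, Nat.cast_zero, hone])
    exact (congrArg (f 0) h1).trans (map_zero _)
  · have hn0 : c n = 0 := hc n fun h => hn (by rw [← h, Nat.cast_succ])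
    have hn2 : c (n + 2) = 0 := hc (n + 2) fun h => hn (by
      rw [← h, Nat.cast_succ, Nat.cast_succ, add_assoc, hone, add_zero, Nat.cast_succ])
    exact (congrArg₂ (f (n + 1) · + g n ·) hn2 hn0).trans (by rw [map_zero, map_zero, add_zero])

end Odd

theorem perLie_single (der : R → R) (nabla : A → A) (n : ℕ) (z : Chain R A n) :
    perLie der nabla (Pi.single n z) = Pi.single n (lie der nabla n z) :=
  funext fun m => map_single_of_injective (e := id) (e' := id) Function.injective_id
    Function.injective_id (fun n => (lie der nabla n : Chain R A n →+ Chain R A n)) n m z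

theorem perI_single_of_lt (E : A → A → A) {n : ℕ} (hn : n < 2) (z : Chain R A n) :
    perI R E (Pi.single n z) = Pi.single n (cyclicS R E n z) := by
  funext m
  have hι : iota R E m ((Pi.single n z : Per R A) (m + 2)) = 0 := by
    rw [Pi.single_eq_of_ne (by omega), map_zero]
  have hS : cyclicS R E m (Pi.single n z m) = (Pi.single n (cyclicS R E n z) : Per R A) m :=
    map_single_of_injective (e := id) (e' := id) Function.injective_id Function.injective_id
      (fun n => (cyclicS R E n : Chain R A n →+ Chain R A n)) n m z
  exact (congrArg₂ (· + ·) hι hS).trans (zero_add _)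

theorem perI_single_add_two (E : A → A → A) (n : ℕ) (z : Chain R A (n + 2)) :
    perI R E (Pi.single (n + 2) z) =
      Pi.single n (iota R E n z) + Pi.single (n + 2) (cyclicS R E (n + 2) z) := by
  funext m
  have hι := map_single_of_injective (e' := id) (add_left_injective 2) Function.injective_id
    (fun n => (iota R E n : Chain R A (n + 2) →+ Chain R A n)) n m z
  have hS := map_single_of_injective (e := id) (e' := id) Function.injective_id
    Function.injective_id (fun n => (cyclicS R E n : Chain R A n →+ Chain R A n)) (n + 2) m z
  exact congrArg₂ (· + ·) hι hS

theorem perGM_mem_parity (der : R → R) (nabla : A → A) {p : ZMod 2} {c : Per R A}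
    (hc : c ∈ parity R A p) : perGM der nabla c ∈ parity R A p := by
  intro n hn
  have hn0 : c n = 0 := hc n hn
  have hn2 : c (n + 2) = 0 := hc (n + 2) fun h => hn (by
    rw [← h, Nat.cast_add, show ((2 : ℕ) : ZMod 2) = 0 from rfl, add_zero])
  change lie der nabla n (c n) - (iota R _ n (c (n + 2)) + cyclicS R _ n (c n)) = 0
  rw [hn0, hn2, map_zero, map_zero, map_zero, add_zero, sub_zero]

end Definition

section ElementaryChains

variable [ContinuousMul R] [IsTopologicalAddGroup A] [ContinuousSMul R A] [T2Space A]
  [PolynormableSpace ℂ A] (hA : @CompleteSpace A (IsTopologicalAddGroup.rightUniformSpace A))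
include hA

theorem connesB_elem (n : ℕ) (x : ℕ → Unitization R A) :
    connesB R A n (Chain.elem n x) = connesOp (Chain R A (n + 1)) n (Chain.elem (n + 1)) x :=
  ((actsBy_connesB hA n).apply_elem (isCochain_BFormula n).isBalancedCochain x).trans
    (congrFun (BFormula_eq_connesOp n) x)

section Connection

variable {der : Derivation ℂ R R} {nabla : A →L[ℂ] A} (h : IsConnectionAlong der nabla)
include h

theorem lie_elem (hder : Continuous der) (n : ℕ) (x : ℕ → Unitization R A) :
    lie der nabla n (Chain.elem n x) =
      lieOp (Chain R A n) (unitalExt der nabla) n (Chain.elem n) x := by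
  have hφ : IsBalancedCochain n (lieFormula der nabla n) :=
    lieFormula_eq_lieOp (R := R) der nabla n ▸ isBalancedCochain_lieOp h Chain.isCochain_elem
  exact ((actsBy_lie hA hder h n).apply_elem hφ x).trans
    (congrFun (lieFormula_eq_lieOp der nabla n) x)

theorem lie_smul (hder : Continuous der) (n : ℕ) (r : R) (z : Chain R A n) :
    lie der nabla n (r • z) = der r • z + r • lie der nabla n z := by
  refine DFunLike.congr_fun (Chain.addMonoidHom_ext
    (S := (lie der nabla n : Chain R A n →+ Chain R A n).comp (DistribSMul.toAddMonoidHom _ r))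
    (T := DistribSMul.toAddMonoidHom _ (der r) +
      (DistribSMul.toAddMonoidHom _ r).comp (lie der nabla n : Chain R A n →+ Chain R A n))
    ((lie der nabla n).continuous.comp (continuous_const_smul r))
    ((continuous_const_smul (der r)).add
      ((lie der nabla n).continuous.const_smul r)) fun x => ?_) z
  change lie der nabla n (r • Chain.elem n x) =
    der r • Chain.elem n x + r • lie der nabla n (Chain.elem n x)
  rw [Chain.smul_elem, lie_elem hA h hder, lie_elem hA h hder]
  exact h.unitalExt.lieOp_update_smul Chain.isCochain_elem.toIsWordMultilinear n.zero_le x r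

theorem isConnectionAlong_perGM (hder : Continuous der) :
    IsConnectionAlong der (perGM (R := R) der nabla) := by
  intro r c
  have hlie : perLie der nabla (r • c) = der r • c + r • perLie der nabla c :=
    funext fun n => lie_smul hA h hder n r (c n)
  change perLie der nabla (r • c) - perI R (coboundary nabla) (r • c) =
    der r • c + r • (perLie der nabla c - perI R (coboundary nabla) c)
  rw [hlie, map_smul, smul_sub, add_sub_assoc]

variable [ContinuousMul A]

theorem cyclicS_elem (n : ℕ) (x : ℕ → Unitization R A) :
    cyclicS R (coboundary nabla) n (Chain.elem n x) =
      cyclicTwo (Chain R A n) (coboundary (unitalExt der nabla)) n (Chain.elem n) x := by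
  have hleft := h.isLinearMap_coboundary_left (D := (nabla : A →+ A))
  have hright := h.isLinearMap_coboundary_right (D := (nabla : A →+ A))
  rw [funext₂ (coboundary_unitalExt h), ← sFormula_eq_cyclicTwo]
  exact (actsBy_cyclicS hA hleft hright (continuous_coboundary nabla.continuous) n).apply_elem
    (isCochain_sFormula hleft hright n).isBalancedCochain x

theorem iota_elem (n : ℕ) (x : ℕ → Unitization R A) :
    iota R (coboundary nabla) n (Chain.elem (n + 2) x) =
      contractTwo (Chain R A n) (coboundary (unitalExt der nabla)) (Chain.elem n) x := by
  have hleft := h.isLinearMap_coboundary_left (D := (nabla : A →+ A))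
  have hright := h.isLinearMap_coboundary_right (D := (nabla : A →+ A))
  rw [funext₂ (coboundary_unitalExt h), ← iotaFormula_eq_contractTwo]
  exact (actsBy_iota hA hleft hright (continuous_coboundary nabla.continuous) n).apply_elem
    (isCochain_iotaFormula hleft hright n).isBalancedCochain x

theorem perGM_ofWord (hder : Continuous der) (n : ℕ) (x : ℕ → Unitization R A) :
    perGM der nabla (Per.ofWord n x) =
      totalGaussManin (Per R A) (unitalExt der nabla) Per.ofWord n x := by
  have hlie : perLie der nabla (Per.ofWord n x) =
      lieOp (Per R A) (unitalExt der nabla) n (Per.ofWord n) x := by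
    rw [Per.ofWord, perLie_single, lie_elem hA h hder]
    exact map_lieOp (AddMonoidHom.single (Chain R A) n) _ _ _ _
  have hS (n : ℕ) : Pi.single n (cyclicS R (coboundary nabla) n (Chain.elem n x)) =
      cyclicTwo (Per R A) (coboundary (unitalExt der nabla)) n (Per.ofWord n) x := by
    rw [cyclicS_elem hA h]
    exact map_cyclicTwo (AddMonoidHom.single (Chain R A) n) _ _ _ _
  have hι (n : ℕ) : Pi.single n (iota R (coboundary nabla) n (Chain.elem (n + 2) x)) =
      contractTwo (Per R A) (coboundary (unitalExt der nabla)) (Per.ofWord n) x := by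
    rw [iota_elem hA h]
    exact map_contractTwo (AddMonoidHom.single (Chain R A) n) _ _ _
  refine congrArg₂ (· - ·) hlie ?_
  match n with
  | 0 => exact (perI_single_of_lt _ two_pos _).trans (hS 0)
  | 1 => exact (perI_single_of_lt _ one_lt_two _).trans (hS 1)
  | n + 2 => exact (perI_single_add_two _ n _).trans (congrArg₂ (· + ·) (hι n) (hS (n + 2)))

end Connection

section Boundary

variable [ContinuousMul A]

theorem hochschildB_elem (n : ℕ) (x : ℕ → Unitization R A) :
    hochschildB R A n (Chain.elem (n + 1) x) = hochschildOp (Chain R A n) n (Chain.elem n) x :=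
  ((actsBy_hochschildB hA n).apply_elem (isCochain_bFormula n).isBalancedCochain x).trans
    (congrFun (bFormula_eq_hochschildOp n) x)

theorem perD_ofWord (n : ℕ) (x : ℕ → Unitization R A) :
    perD R A (Per.ofWord n x) = totalBoundary (Per R A) Per.ofWord n x := by
  have hb (n : ℕ) : Pi.single n (hochschildB R A n (Chain.elem (n + 1) x)) =
      hochschildOp (Per R A) n (Per.ofWord n) x := by
    rw [hochschildB_elem hA]
    exact map_hochschildOp (AddMonoidHom.single (Chain R A) n) _ _ _
  have hB (n : ℕ) : Pi.single (n + 1) (connesB R A n (Chain.elem n x)) =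
      connesOp (Per R A) n (Per.ofWord (n + 1)) x := by
    rw [connesB_elem hA]
    exact map_connesOp (AddMonoidHom.single (Chain R A) (n + 1)) _ _ _
  rw [perD_eq_perOdd]
  match n with
  | 0 => exact (perOdd_single_zero _ _ _).trans (hB 0)
  | n + 1 => exact (perOdd_single_succ _ _ n _).trans (congrArg₂ (· + ·) (hb n) (hB (n + 1)))

theorem perIOne_ofWord {D : Unitization R A → Unitization R A} (hD : IsLinearMap R D)
    (hD1 : D 1 = 0) (hDcont : Continuous D) (n : ℕ) (x : ℕ → Unitization R A) :
    perIOne D (Per.ofWord n x) = totalContractOne (Per R A) D Per.ofWord n x := by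
  have hι (n : ℕ) : Pi.single n (iotaOne D n (Chain.elem (n + 1) x)) =
      contractOne (Per R A) D (Per.ofWord n) x := by
    rw [iotaOne_elem hA hD hD1 hDcont]
    exact map_contractOne (AddMonoidHom.single (Chain R A) n) _ _ _
  have hS (n : ℕ) : Pi.single (n + 1) (cyclicSOne D n (Chain.elem n x)) =
      cyclicOne (Per R A) D n (Per.ofWord (n + 1)) x := by
    rw [cyclicSOne_elem hA hD hD1 hDcont]
    exact map_cyclicOne (AddMonoidHom.single (Chain R A) (n + 1)) _ _ _ _
  match n with
  | 0 => exact (perOdd_single_zero _ _ _).trans (hS 0)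
  | n + 1 => exact (perOdd_single_succ _ _ n _).trans (congrArg₂ (· + ·) (hι n) (hS (n + 1)))

end Boundary

end ElementaryChains

end PeriodicOperators

section Homology

variable {R : Type} {A : Type*} [CommRing R] [Algebra ℂ R] [NonUnitalRing A] [Module ℂ A]
  [Module R A] [IsScalarTower ℂ R A] [IsScalarTower R A A] [SMulCommClass R A A]
  [TopologicalSpace R] [TopologicalSpace A] [ContinuousConstSMul R R] [IsTopologicalAddGroup A]
  [ContinuousConstSMul R A]

theorem exists_induces {T : Per R A →L[ℂ] Per R A} {p : ZMod 2}
    (hT : ∀ c, perD R A (T c) = T (perD R A c))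
    (hparity : ∀ q, ∀ c ∈ parity R A q, T c ∈ parity R A q) :
    ∃ N : HP R A p →L[ℂ] HP R A p, Induces T p N := by
  have hcycles (z : cycles R A p) : T z ∈ cycles R A p := by
    have hz : perD R A z = 0 := z.2.1
    exact ⟨(hT z).trans ((congrArg T hz).trans (map_zero T)), hparity p _ z.2.2⟩
  let f : cycles R A p →ₗ[ℂ] HP R A p :=
    { toFun := fun z => Submodule.Quotient.mk ⟨T z, hcycles z⟩
      map_add' := fun z w => congrArg Submodule.Quotient.mk (Subtype.ext (map_add T z.1 w.1))
      map_smul' := fun c z => congrArg Submodule.Quotient.mk (Subtype.ext (map_smul T c z.1)) }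
  let P := (boundaries R A p).submoduleOf (cycles R A p)
  have hboundaries : P.restrictScalars ℂ ≤ LinearMap.ker f := by
    rintro z ⟨w, hw, hwz⟩
    exact (Submodule.Quotient.mk_eq_zero _).2
      ⟨T w, hparity _ _ hw, (hT w).trans (congrArg T hwz)⟩
  refine ⟨⟨(P.restrictScalars ℂ).liftQ f hboundaries ∘ₗ
    (Submodule.Quotient.restrictScalarsEquiv ℂ P).symm.toLinearMap, ?_⟩,
    fun z => ⟨hcycles z, rfl⟩⟩
  have hmk : IsQuotientMap (Submodule.Quotient.mk : cycles R A p → HP R A p) :=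
    isQuotientMap_quot_mk
  exact hmk.continuous_iff.2
    (continuous_quot_mk.comp ((T.continuous.comp continuous_subtype_val).subtype_mk hcycles))

namespace Induces

variable {T : Per R A →L[ℂ] Per R A} {p : ZMod 2} {N : HP R A p →L[ℂ] HP R A p}

theorem isConnectionAlong (hN : Induces T p N) {der : R → R} (hT : IsConnectionAlong der T) :
    IsConnectionAlong der N := by
  intro r m
  obtain ⟨z, rfl⟩ := Submodule.Quotient.mk_surjective _ m
  obtain ⟨hz, hNz⟩ := hN z
  obtain ⟨hrz, hNrz⟩ := hN (r • z)
  rw [← Submodule.Quotient.mk_smul, hNrz, hNz, ← Submodule.Quotient.mk_smul,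
    ← Submodule.Quotient.mk_smul, ← Submodule.Quotient.mk_add]
  exact congrArg Submodule.Quotient.mk (Subtype.ext (hT r z.1))

theorem eq_of_homotopy (hN : Induces T p N) {T' : Per R A →L[ℂ] Per R A}
    {N' : HP R A p →L[ℂ] HP R A p} (hN' : Induces T' p N') {H : Per R A →+ Per R A}
    (hparity : ∀ c ∈ parity R A p, H c ∈ parity R A (p + 1))
    (hH : ∀ c, T c - T' c = perD R A (H c) + H (perD R A c)) : N = N' := by
  ext m
  obtain ⟨z, rfl⟩ := Submodule.Quotient.mk_surjective _ m
  obtain ⟨hTz, hNz⟩ := hN z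
  obtain ⟨hTz', hNz'⟩ := hN' z
  have hz : perD R A z = 0 := z.2.1
  rw [hNz, hNz', Submodule.Quotient.eq]
  refine ⟨H z, hparity _ z.2.2, ((hH z).trans ?_).symm⟩
  rw [hz, map_zero, add_zero]
  rfl

end Induces

end Homology

section GaussManinConnection

variable {R : Type} {A : Type*} [CommRing R] [Algebra ℂ R] [NonUnitalRing A] [Module ℂ A]
  [Module R A] [IsScalarTower ℂ R A] [IsScalarTower R A A] [SMulCommClass R A A]
  [TopologicalSpace R] [TopologicalSpace A] [ContinuousMul R] [ContinuousMul A]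
  [IsTopologicalAddGroup A] [ContinuousSMul R A] [T2Space A] [PolynormableSpace ℂ A]
  (hA : @CompleteSpace A (IsTopologicalAddGroup.rightUniformSpace A)) {der : Derivation ℂ R R}
  (hder : Continuous der) {nabla nabla' : A →L[ℂ] A} (h : IsConnectionAlong der nabla)
  (h' : IsConnectionAlong der nabla')
include hA hder h

theorem perD_perGM (c : Per R A) :
    perD R A (perGM der nabla c) = perGM der nabla (perD R A c) := by
  refine DFunLike.congr_fun (Per.addMonoidHom_ext
    (S := (perD R A : Per R A →+ Per R A).comp (perGM der nabla : Per R A →+ Per R A))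
    (T := (perGM der nabla : Per R A →+ Per R A).comp (perD R A : Per R A →+ Per R A))
    ((perD R A).continuous.comp (perGM der nabla).continuous)
    ((perGM der nabla).continuous.comp (perD R A).continuous) fun n x => ?_) c
  calc perD R A (perGM der nabla (Per.ofWord n x))
      = perD R A (totalGaussManin (Per R A) (unitalExt der nabla) Per.ofWord n x) :=
        congrArg _ (perGM_ofWord hA h hder n x)
    _ = totalGaussManin (Per R A) (unitalExt der nabla) (fun n y => perD R A (Per.ofWord n y))
          n x := map_totalGaussManin (perD R A : Per R A →+ Per R A) _ _ _ _
    _ = totalGaussManin (Per R A) (unitalExt der nabla) (totalBoundary (Per R A) Per.ofWord) n x :=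
        by rw [funext₂ (perD_ofWord hA)]
    _ = totalBoundary (Per R A) (totalGaussManin (Per R A) (unitalExt der nabla) Per.ofWord) n x :=
        by rw [totalGaussManin_totalBoundary (fun n => (Per.isCochain_ofWord n).complex)
          (unitalExt der nabla).isLinear (unitalExt_one der nabla)]
    _ = totalBoundary (Per R A) (fun n y => perGM der nabla (Per.ofWord n y)) n x := by
        rw [funext₂ (perGM_ofWord hA h hder)]
    _ = perGM der nabla (totalBoundary (Per R A) Per.ofWord n x) :=
        (map_totalBoundary (perGM der nabla : Per R A →+ Per R A) _ _ _).symm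
    _ = perGM der nabla (perD R A (Per.ofWord n x)) := congrArg _ (perD_ofWord hA n x).symm

include h' in
theorem perGM_sub_perGM (c : Per R A) : perGM der nabla c - perGM der nabla' c =
    perD R A (perIOne (unitalExt 0 (nabla - nabla')) c) +
      perIOne (unitalExt 0 (nabla - nabla')) (perD R A c) := by
  have hsub := unitalExt_sub_unitalExt der nabla nabla'
  set D := unitalExt (R := R) 0 (nabla - nabla')
  have hDlin : IsLinearMap R D := by
    rw [← hsub]
    exact IsConnectionAlong.isLinearMap_sub (T := (unitalExt der nabla).toAddMonoidHom)
      (T' := (unitalExt der nabla').toAddMonoidHom) h.unitalExt h'.unitalExt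
  have hDcont : Continuous D := continuous_unitalExt _ _ continuous_zero
  have hI := perIOne_ofWord hA hDlin (unitalExt_one _ _) hDcont
  refine DFunLike.congr_fun (Per.addMonoidHom_ext
    (S := (perGM der nabla : Per R A →+ Per R A) - (perGM der nabla' : Per R A →+ Per R A))
    (T := (perD R A : Per R A →+ Per R A).comp (perIOne D : Per R A →+ Per R A) +
      (perIOne D : Per R A →+ Per R A).comp (perD R A : Per R A →+ Per R A))
    ((perGM der nabla).continuous.sub (perGM der nabla').continuous)
    (((perD R A).continuous.comp (perIOne D).continuous).add
      ((perIOne D).continuous.comp (perD R A).continuous)) fun n x => ?_) c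
  calc perGM der nabla (Per.ofWord n x) - perGM der nabla' (Per.ofWord n x)
      = (totalGaussManin (Per R A) (unitalExt der nabla) Per.ofWord -
          totalGaussManin (Per R A) (unitalExt der nabla') Per.ofWord) n x :=
        congrArg₂ (· - ·) (perGM_ofWord hA h hder n x) (perGM_ofWord hA h' hder n x)
    _ = totalBoundary (Per R A) (totalContractOne (Per R A) D Per.ofWord) n x +
          totalContractOne (Per R A) D (totalBoundary (Per R A) Per.ofWord) n x := by
        rw [totalGaussManin_sub Per.isCochain_ofWord, hsub]
        rfl
    _ = totalBoundary (Per R A) (fun n y => perIOne D (Per.ofWord n y)) n x +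
          totalContractOne (Per R A) D (fun n y => perD R A (Per.ofWord n y)) n x := by
        rw [funext₂ hI, funext₂ (perD_ofWord hA)]
    _ = perIOne D (totalBoundary (Per R A) Per.ofWord n x) +
          perD R A (totalContractOne (Per R A) D Per.ofWord n x) :=
        congrArg₂ (· + ·) (map_totalBoundary (perIOne D : Per R A →+ Per R A) _ _ _).symm
          (map_totalContractOne (perD R A : Per R A →+ Per R A) _ _ _ _).symm
    _ = perD R A (perIOne D (Per.ofWord n x)) + perIOne D (perD R A (Per.ofWord n x)) := by
        rw [hI, perD_ofWord hA, add_comm]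

end GaussManinConnection

section Sections

variable {J : Opens ℝ}

/-- The derivation `f ↦ f'` of the algebra `C^∞(J)`. The connections over `C^∞(J)` are the
connections along this derivation. -/
def SmoothFun.derivation : Derivation ℂ (SmoothFun J ℂ) (SmoothFun J ℂ) :=
  Derivation.mk' SmoothFun.D fun f g =>
    (SmoothFun.D_fsmul f g).trans ((add_comm _ _).trans (congrArg _ (mul_comm _ _)))

instance {X : Type*} [AddCommGroup X] [Module ℂ X] [UniformSpace X] [IsUniformAddGroup X]
    [ContinuousSMul ℂ X] [T2Space X] [PolynormableSpace ℂ X] {𝒜 : SmoothDeformation J X} :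
    PolynormableSpace ℂ 𝒜.Sections :=
  inferInstanceAs (PolynormableSpace ℂ (SmoothFun J X))

end Sections

end GaussManin

end

open GaussManin in
theorem mainTheorem3_general {R : Type} {A : Type*} [CommRing R] [Algebra ℂ R]
    [NonUnitalRing A] [Module ℂ A] [Module R A] [IsScalarTower ℂ R A] [IsScalarTower R A A]
    [SMulCommClass R A A] [TopologicalSpace R] [TopologicalSpace A] [ContinuousMul R]
    [ContinuousMul A] [IsTopologicalAddGroup A] [ContinuousSMul R A] [T2Space A]
    [PolynormableSpace ℂ A]
    (hA : @CompleteSpace A (IsTopologicalAddGroup.rightUniformSpace A)) {der : Derivation ℂ R R}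
    (hder : Continuous der) :
    (∀ n, ActsBy (hochschildB R A n) (bFormula n)) ∧
    (∀ n, ActsBy (connesB R A n) (BFormula n)) ∧
    (∀ nabla : A →L[ℂ] A, IsConnectionAlong der nabla →
      (∀ n, ActsBy (lie der nabla n) (lieFormula der nabla n)) ∧
      (∀ n, ActsBy (iota R (coboundary nabla) n) (iotaFormula (coboundary nabla) n)) ∧
      (∀ n, ActsBy (cyclicS R (coboundary nabla) n) (sFormula (coboundary nabla) n)) ∧
      IsConnectionAlong der (perGM (R := R) der nabla) ∧
      (∀ c, perD R A (perGM der nabla c) = perGM der nabla (perD R A c)) ∧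
      (∀ p : ZMod 2, ∃ N : HP R A p →L[ℂ] HP R A p,
        Induces (perGM der nabla) p N ∧ IsConnectionAlong der N)) ∧
    (∀ nabla nabla' : A →L[ℂ] A, IsConnectionAlong der nabla → IsConnectionAlong der nabla' →
      ∀ (p : ZMod 2) (N N' : HP R A p →L[ℂ] HP R A p),
        Induces (perGM der nabla) p N → Induces (perGM der nabla') p N' → N = N') := by
  refine ⟨actsBy_hochschildB hA, actsBy_connesB hA, fun nabla h => ?_,
    fun nabla nabla' h h' p N N' hN hN' => ?_⟩
  · have hleft := h.isLinearMap_coboundary_left (D := (nabla : A →+ A))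
    have hright := h.isLinearMap_coboundary_right (D := (nabla : A →+ A))
    have hE := continuous_coboundary nabla.continuous
    have hcommutes := perD_perGM hA hder h
    have hLeibniz : IsConnectionAlong der (perGM (R := R) der nabla) :=
      isConnectionAlong_perGM hA h hder
    refine ⟨actsBy_lie hA hder h, actsBy_iota hA hleft hright hE,
      actsBy_cyclicS hA hleft hright hE, hLeibniz, hcommutes, fun p => ?_⟩
    obtain ⟨N, hN⟩ := exists_induces (p := p) hcommutes
      fun _ _ hc => perGM_mem_parity der nabla hc
    exact ⟨N, hN, hN.isConnectionAlong hLeibniz⟩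
  · exact hN.eq_of_homotopy hN' (H := AddMonoidHomClass.toAddMonoidHom
      (perIOne (unitalExt (R := R) 0 (nabla - nabla'))))
      (fun _ hc => perOdd_mem_parity _ _ hc)
      (perGM_sub_perGM hA hder h h')

open GaussManin in
theorem mainTheorem3 {X : Type*} [AddCommGroup X] [Module ℂ X] [UniformSpace X]
    [IsUniformAddGroup X] [ContinuousSMul ℂ X] [PolynormableSpace ℂ X] [T2Space X]
    [CompleteSpace X] (J : TopologicalSpace.Opens ℝ) (hJ : (J : Set ℝ).OrdConnected)
    (hJ' : (J : Set ℝ).Nonempty) (𝒜 : SmoothDeformation J X) :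
    -- `b` and `B` are well-defined on `C_per(A_J)`
    (∀ n, ActsBy (hochschildB (SmoothFun J ℂ) 𝒜.Sections n) (bFormula n)) ∧
    (∀ n, ActsBy (connesB (SmoothFun J ℂ) 𝒜.Sections n) (BFormula n)) ∧
    (∀ nabla : 𝒜.Sections →L[ℂ] 𝒜.Sections, IsConnection (J := J) nabla →
      -- `L_∇` and `I_E` are well-defined on `C_per(A_J)`
      (∀ n, ActsBy (lie (SmoothFun.D (J := J) (X := ℂ)) nabla n)
        (lieFormula SmoothFun.D nabla n)) ∧
      (∀ n, ActsBy (iota (SmoothFun J ℂ) (coboundary nabla) n)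
        (iotaFormula (coboundary nabla) n)) ∧
      (∀ n, ActsBy (cyclicS (SmoothFun J ℂ) (coboundary nabla) n)
        (sFormula (coboundary nabla) n)) ∧
      -- `∇_GM` is a connection on `C_per(A_J)` and commutes with `b + B`
      IsConnection (J := J) (gaussManin nabla) ∧
      (∀ c, perD (SmoothFun J ℂ) 𝒜.Sections (gaussManin nabla c) =
        gaussManin nabla (perD (SmoothFun J ℂ) 𝒜.Sections c)) ∧
      -- it induces a connection on the even and the odd periodic cyclic homology
      (∀ p : ZMod 2, ∃ N : HP (SmoothFun J ℂ) 𝒜.Sections p →L[ℂ] HP (SmoothFun J ℂ) 𝒜.Sections p,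
        Induces (gaussManin nabla) p N ∧ IsConnection (J := J) N)) ∧
    -- the induced connection does not depend on `∇`
    (∀ nabla nabla' : 𝒜.Sections →L[ℂ] 𝒜.Sections,
      IsConnection (J := J) nabla → IsConnection (J := J) nabla' →
      ∀ (p : ZMod 2) (N N' : HP (SmoothFun J ℂ) 𝒜.Sections p →L[ℂ] HP (SmoothFun J ℂ) 𝒜.Sections p),
        Induces (gaussManin nabla) p N → Induces (gaussManin nabla') p N' → N = N') := by
  exact mainTheorem3_general (SmoothFun.completeSpace (X := X))
    (der := SmoothFun.derivation) SmoothFun.continuous_D
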